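/- Let $1<\alpha<\tfrac32$, $\delta=\min\{0.001,\frac{1.5-\alpha}{20}\}$ and $\theta=\min\{2-\alpha-10\delta,\ \log_{3.9}2\}$. For $M_0>2$ put $M_\ell=M_02^{\delta\ell}$. For integers $\ell\ge0$ and $x$, the set $I_\ell(x)=[2^{\ell-4}x-2^{\ell-1},\,2^{\ell-4}x+2^{\ell-1})\cap\mathbb Z$ is called an $\ell$-interval. Balanced sets. Let $\sigma\in\{-1,1\}^{\mathbb Z}$. For $I\subset\mathbb Z$ let $I^{\pm}(\sigma)=\{y\in I:\sigma_y=\pm1\}$. An $\ell$-interval $I$ is plus dense if $|I^+(\sigma)|/|I|>1-1/M_\ell$. The interval $I_\ell(x)$ is plus favored if $\sigma_y=1$ whenever $1\le d(y,I_\ell(x))\le 2^{\ell-1}$, and $I_\ell(x+16k)$, $I_\ell(x-16k)$ are plus dense for all integers $1\le k\le M_\ell$. Minus dense and minus favored are defined by exchanging the signs. An $\ell$-interval is isolated if it is plus favored and contains a minus spin, or minus favored and contains a plus spin. For a finite interval $I$ let $\rho_r(I)=\{y\in\mathbb Z:d(y,I)\le(r-1)|I|\}$. The configuration $\sigma$ is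 balanced in $I$ if for every $\ell\ge0$ no $\ell$-interval $I'$ with $\rho_{M_\ell}(I')\subset I$ is isolated. Let $\mathcal A(I)$ be the collection of the sets $I^-(\sigma)$ over all $\sigma$ balanced in $I$. The model. Let $J_{xy}=|x-y|^{-\alpha}$ for $x\ne y$ in $\mathbb Z$, $J_{xx}=0$, and $J(A,B)=\sum_{x\in A,y\in B}J_{xy}$. Let $h=(h_x)_{x\in\mathbb Z}$ be i.i.d. standard Gaussian variables under $\mathbb P$. For a finite $\Lambda\subset\mathbb Z$ containing $0$, and $\beta,\varepsilon>0$, let $$Z^+(h)=\sum_{\sigma\in\{-1,1\}^\Lambda}\exp\Big(\beta\Big[\sum_{x,y\in\Lambda}J_{xy}\sigma_x\sigma_y+\sum_{x\in\Lambda,\,y\in\Lambda^c}J_{xy}\sigma_x+\sum_{x\in\Lambda}\varepsilon h_x\sigma_x\Big]\Big).$$ For $A\subset\mathbb Z$ let $\tau_A(h)$ be $h$ with the signs on $A$ flipped, and let $\Delta_A(h)=-\frac1\beta\log\frac{Z^+(h)}{Z^+(\tau_A(h))}$. For $c_2>0$ and an $n$-interval $I_n$ let $\hat{\mathcal A}(I_n)=\{A\in\mathcal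 A(I_n):J(A,A^c)\ge c_2\,2^{\theta n}\}$, and let $$\mathcal E(I_n)=\Big\{\Delta_A(h)\le\tfrac1{10}J(A,A^c)\ \text{ for all }A\in\hat{\mathcal A}(I_n)\Big\}.$$ Proposition. For every $1<\alpha<\frac32$ there is a threshold $\overline M=\overline M(\alpha)>2$ such that for every $M_0\ge\overline M$ and every $c_2>0$ there are constants $\varepsilon_0>0$ and $c_3>0$, depending only on $\alpha,M_0,c_2$, with the following property. For all $0<\varepsilon<\varepsilon_0$, all $\beta>0$, all finite $\Lambda\subset\mathbb Z$ containing $0$, all integers $n\ge0$ and all $n$-intervals $I_n$ containing $0$, $$\mathbb P\big(\mathcal E(I_n)^c\big)\le c_3^{-1}\exp\Big(-c_3\,\frac{2^{(2\theta-1-2\delta)n}}{\varepsilon^2}\Big).$$ -/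

import Mathlib

open MeasureTheory ProbabilityTheory

noncomputable section

namespace LongRangeRFIM

/-! ### Exponents and density thresholds -/

/-- `δ = min {0.001, (1.5 - α) / 20}`. -/
def delta (α : ℝ) : ℝ := min 0.001 ((1.5 - α) / 20)

/-- `θ = min {2 - α - 10 δ, log_{3.9} 2}`. -/
def theta (α : ℝ) : ℝ := min (2 - α - 10 * delta α) (Real.logb 3.9 2)

/-- The threshold `M_ℓ = M₀ 2 ^ (δ ℓ)`. -/
def scaleM (α M₀ : ℝ) (ℓ : ℕ) : ℝ := M₀ * (2 : ℝ) ^ (delta α * (ℓ : ℝ))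

/-! ### Intervals, configurations, balanced configurations -/

/-- A configuration in `{-1, 1}^ℤ`; the two spins are the units of `ℤ`. -/
abbrev Config : Type := ℤ → ℤˣ

/-- The `ℓ`-interval `[2^(ℓ-4) x - 2^(ℓ-1), 2^(ℓ-4) x + 2^(ℓ-1)) ∩ ℤ`. -/
def ellInterval (ℓ : ℕ) (x : ℤ) : Set ℤ :=
  {y : ℤ | (2 : ℝ) ^ ((ℓ : ℤ) - 4) * (x : ℝ) - (2 : ℝ) ^ ((ℓ : ℤ) - 1) ≤ (y : ℝ) ∧
    (y : ℝ) < (2 : ℝ) ^ ((ℓ : ℤ) - 4) * (x : ℝ) + (2 : ℝ) ^ ((ℓ : ℤ) - 1)}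

/-- The sites of `I` where `σ` has spin `s`; `s = 1` gives `I⁺(σ)` and `s = -1` gives `I⁻(σ)`. -/
def spinSites (s : ℤˣ) (I : Set ℤ) (σ : Config) : Set ℤ := {x ∈ I | σ x = s}

/-- `I_ℓ(x)` is dense with spin `s` (plus dense for `s = 1`, minus dense for `s = -1`). -/
def SpinDense (α M₀ : ℝ) (s : ℤˣ) (σ : Config) (ℓ : ℕ) (x : ℤ) : Prop :=
  1 - 1 / scaleM α M₀ ℓ <
    ((spinSites s (ellInterval ℓ x) σ).ncard : ℝ) / ((ellInterval ℓ x).ncard : ℝ)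

/-- `I_ℓ(x)` is favored with spin `s`: the spin is `s` at all sites at distance between `1` and
`2^(ℓ-1)` from the interval, and the `M_ℓ` closest neighboring disjoint `ℓ`-intervals on either
side are dense with spin `s`. -/
def Favored (α M₀ : ℝ) (s : ℤˣ) (σ : Config) (ℓ : ℕ) (x : ℤ) : Prop :=
  (∀ y : ℤ, 1 ≤ Metric.infDist y (ellInterval ℓ x) →
      Metric.infDist y (ellInterval ℓ x) ≤ (2 : ℝ) ^ ((ℓ : ℤ) - 1) → σ y = s) ∧
  (∀ k : ℕ, 1 ≤ k → (k : ℝ) ≤ scaleM α M₀ ℓ →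
      SpinDense α M₀ s σ ℓ (x + 16 * (k : ℤ)) ∧ SpinDense α M₀ s σ ℓ (x - 16 * (k : ℤ)))

/-- `I_ℓ(x)` is isolated: plus favored and containing a minus, or minus favored and containing a
plus. -/
def Isolated (α M₀ : ℝ) (σ : Config) (ℓ : ℕ) (x : ℤ) : Prop :=
  (Favored α M₀ 1 σ ℓ x ∧ (spinSites (-1) (ellInterval ℓ x) σ).Nonempty) ∨
  (Favored α M₀ (-1) σ ℓ x ∧ (spinSites 1 (ellInterval ℓ x) σ).Nonempty)

/-- The expansion `ρ_r(I) = {x : d(x, I) ≤ (r - 1) |I|}`. -/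
def expansion (r : ℝ) (I : Set ℤ) : Set ℤ :=
  {x : ℤ | Metric.infDist x I ≤ (r - 1) * (I.ncard : ℝ)}

/-- `σ` is balanced in `I`: no `ℓ`-interval `I'`, of any scale `ℓ ≥ 0`, with
`ρ_{M_ℓ}(I') ⊆ I` is isolated. -/
def Balanced (α M₀ : ℝ) (σ : Config) (I : Set ℤ) : Prop :=
  ∀ (ℓ : ℕ) (x : ℤ), expansion (scaleM α M₀ ℓ) (ellInterval ℓ x) ⊆ I → ¬ Isolated α M₀ σ ℓ x

/-- The collection `𝒜(I)` of the sets `I⁻(σ)`, for `σ` balanced in `I`. -/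
def balancedSets (α M₀ : ℝ) (I : Set ℤ) : Set (Set ℤ) :=
  {A | ∃ σ : Config, Balanced α M₀ σ I ∧ A = spinSites (-1) I σ}

/-! ### The long-range random field Ising model -/

/-- The interaction `J_{xy} = |x - y|^(-α)` for `x ≠ y`, and `J_{xx} = 0`. -/
def coupling (α : ℝ) (x y : ℤ) : ℝ := if x = y then 0 else 1 / |(x : ℝ) - (y : ℝ)| ^ α

/-- `J(A, B) = ∑_{x ∈ A, y ∈ B} J_{xy}`. -/
def interaction (α : ℝ) (A B : Set ℤ) : ℝ := ∑' p : A × B, coupling α p.1 p.2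

/-- The real value `±1` of a spin. -/
def spinVal (s : ℤˣ) : ℝ := ((s : ℤ) : ℝ)

/-- The local Hamiltonian in `Λ` with boundary condition `η` and external field `ε h`. -/
def hamiltonian (α ε : ℝ) (Λ : Finset ℤ) (η : Config) (h : ℤ → ℝ) (σ : Λ → ℤˣ) : ℝ :=
  - (∑ x : Λ, ∑ y : Λ, coupling α x y * spinVal (σ x) * spinVal (σ y))
  - (∑ x : Λ, ∑' y : ((Λ : Set ℤ)ᶜ : Set ℤ), coupling α x y * spinVal (σ x) * spinVal (η y))
  - (∑ x : Λ, ε * h x * spinVal (σ x))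

/-- The partition function. -/
def partitionFn (α β ε : ℝ) (Λ : Finset ℤ) (η : Config) (h : ℤ → ℝ) : ℝ :=
  ∑ σ : Λ → ℤˣ, Real.exp (-β * hamiltonian α ε Λ η h σ)

open Classical in
/-- `τ_A(h)`: the field `h` with the signs on `A` flipped. -/
def flipField (A : Set ℤ) (h : ℤ → ℝ) : ℤ → ℝ := fun x => if x ∈ A then - h x else h x

/-- `Δ_A(h) = -(1/β) log (Z⁺(h) / Z⁺(τ_A(h)))`, with plus boundary condition. -/
def errorFn (α β ε : ℝ) (Λ : Finset ℤ) (A : Set ℤ) (h : ℤ → ℝ) : ℝ :=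
  -(1 / β) * Real.log (partitionFn α β ε Λ (fun _ => 1) h /
    partitionFn α β ε Λ (fun _ => 1) (flipField A h))

/-! ### The good event -/

/-- `𝒜̂(I_n)`: the sets `A ∈ 𝒜(I_n)` with `J(A, Aᶜ) ≥ c₂ 2^(θ n)`, for `I_n = I_n(x)`. -/
def largeBalancedSets (α M₀ c₂ : ℝ) (n : ℕ) (x : ℤ) : Set (Set ℤ) :=
  {A | A ∈ balancedSets α M₀ (ellInterval n x) ∧
    c₂ * (2 : ℝ) ^ (theta α * (n : ℝ)) ≤ interaction α A Aᶜ}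

/-- The fields `h` for which the good event `ℰ(I_n)` occurs, for `I_n = I_n(x)`. -/
def goodFields (α M₀ c₂ β ε : ℝ) (Λ : Finset ℤ) (n : ℕ) (x : ℤ) : Set (ℤ → ℝ) :=
  {h | ∀ A ∈ largeBalancedSets α M₀ c₂ n x,
    errorFn α β ε Λ A h ≤ interaction α A Aᶜ / 10}

end LongRangeRFIM

end

noncomputable section

namespace LongRangeRFIM

/-! The proof is a chaining argument over dyadic coarsenings of `A`, in which Gaussian tails compete
with the entropy of balanced sets.

Tails. For `B' ⊆ B` the increment `Δ_B - Δ_{B'}` changes sign when the field is flipped on `B \ B'`,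
and it is `2ε`-Lipschitz in each coordinate. Conditionally on the field off `B \ B'` it is thus a
symmetric variable with tail `exp(-t² / (8 ε² |B \ B'|))`, uniformly in `β` and `Λ`
(`measureReal_errorFn_sub_gt_le`).

Energy against roughness. Call a dyadic block of scale `j` mixed if it meets both `A` and its
complement. For `A` coming from a balanced configuration, the number of mixed blocks is at most a
constant times `J 2^(-θ j) + 2^(δ j)`, where `J = J(A, Aᶜ)` (`card_mixedBlocks_le`). To see this,
spin changes are grouped into clusters that are merged or enlarged until each has length at least
`2^j`, while a cluster of length `d` keeps energy of order `d^θ`. Merging keeps this because `3.9^θ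
≤ 2` (`rpow_add_le_of_le`); a cluster alone in its surroundings can be enlarged because balancedness
forbids isolated intervals, so enough opposite spins lie nearby (`extendable`).

Entropy. The approximation of `A` at scale `j` is encoded by the behaviour inside the mixed blocks
of larger scales, at a cost of a factor 16 per mixed block. This is the Kraft inequality
`sum_pow_mixedSum_le`, which weights each set by its own roughness.

Chaining. `Δ_A` is telescoped along the inner approximations of `A`, scale `j` being allotted the
share `chainWeight α j * J / 10`. Because `2θ ≥ 1 + 18δ`, the Gaussian exponent at every scale
dominates both the number of mixed blocks of larger scales and `2^((2θ-1-2δ)n)`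
(`exists_exponent_bound`). For small `ε` a union bound then leaves `n + 1` copies of the wanted
estimate, and the factor `n + 1` is absorbed in the exponent. -/

/-! ### Gaussian concentration for functions odd under a coordinate flip -/

lemma exp_add_exp_neg_le {r t : ℝ} (h : |r| ≤ |t|) :
    Real.exp r + Real.exp (-r) ≤ Real.exp t + Real.exp (-t) := by
  have := Real.cosh_le_cosh.2 h
  rw [Real.cosh_eq, Real.cosh_eq] at this
  linarith

lemma lintegral_exp_mul_gaussianReal (t : ℝ) :
    ∫⁻ u, ENNReal.ofReal (Real.exp (t * u)) ∂gaussianReal 0 1 =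
      ENNReal.ofReal (Real.exp (t ^ 2 / 2)) := by
  rw [← ofReal_integral_eq_lintegral_ofReal]
  · congr 1
    have := congrFun (mgf_id_gaussianReal (μ := 0) (v := 1)) t
    simpa [mgf] using this
  · exact integrable_exp_mul_gaussianReal t
  · exact Filter.Eventually.of_forall fun _ => (Real.exp_pos _).le

lemma measurable_ofReal_exp {β : Type*} [MeasurableSpace β] {g : β → ℝ} (hg : Measurable g) :
    Measurable fun x => ENNReal.ofReal (Real.exp (g x)) :=
  (Real.measurable_exp.comp hg).ennreal_ofReal

/-- One-dimensional exponential inequality for Lipschitz functions of a standard Gaussian. -/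
lemma lintegral_exp_mul_lintegral_exp_neg_le {g : ℝ → ℝ} (hg : Measurable g) {L : ℝ}
    (hL : ∀ u v, |g u - g v| ≤ L * |u - v|) :
    (∫⁻ u, ENNReal.ofReal (Real.exp (g u)) ∂gaussianReal 0 1) *
      (∫⁻ u, ENNReal.ofReal (Real.exp (-g u)) ∂gaussianReal 0 1) ≤
      ENNReal.ofReal (Real.exp (L ^ 2)) := by
  set γ := gaussianReal 0 1
  set A := ∫⁻ u, ENNReal.ofReal (Real.exp (g u)) ∂γ
  set B := ∫⁻ u, ENNReal.ofReal (Real.exp (-g u)) ∂γ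
  have key : ∀ f₁ f₂ : ℝ → ℝ, Measurable f₁ → Measurable f₂ →
      (∫⁻ u, ENNReal.ofReal (Real.exp (f₁ u)) ∂γ) * (∫⁻ u, ENNReal.ofReal (Real.exp (f₂ u)) ∂γ) =
      ∫⁻ u, ∫⁻ v, ENNReal.ofReal (Real.exp (f₁ u + f₂ v)) ∂γ ∂γ := by
    intro f₁ f₂ h1 h2
    rw [← lintegral_mul_const _ (measurable_ofReal_exp h1)]
    refine lintegral_congr fun u => ?_
    rw [← lintegral_const_mul _ (measurable_ofReal_exp h2)]
    refine lintegral_congr fun v => ?_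
    rw [Real.exp_add, ENNReal.ofReal_mul (Real.exp_pos _).le]
  have meas2 : ∀ f₁ f₂ : ℝ → ℝ, Measurable f₁ → Measurable f₂ →
      Measurable fun u => ∫⁻ v, ENNReal.ofReal (Real.exp (f₁ u + f₂ v)) ∂γ := by
    intro f₁ f₂ h1 h2
    exact Measurable.lintegral_prod_right
      (measurable_ofReal_exp ((h1.comp measurable_fst).add (h2.comp measurable_snd)))
  -- Adding the product in both orders makes the double integrand `2 cosh(g u - g v)`, which is at
  -- most `2 cosh(L (u - v))`. The right side is the same expression for the linear function `L u`,
  -- whose exponential moments are explicit.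
  have e1 : A * B + B * A ≤ ENNReal.ofReal (Real.exp (L ^ 2)) + ENNReal.ofReal (Real.exp (L ^ 2)) := by
    have e2 : ENNReal.ofReal (Real.exp (L ^ 2)) =
        (∫⁻ u, ENNReal.ofReal (Real.exp (L * u)) ∂γ) *
          (∫⁻ u, ENNReal.ofReal (Real.exp (-L * u)) ∂γ) := by
      rw [lintegral_exp_mul_gaussianReal, lintegral_exp_mul_gaussianReal,
        ← ENNReal.ofReal_mul (Real.exp_pos _).le, ← Real.exp_add]
      congr 2; ring
    have e3 : ENNReal.ofReal (Real.exp (L ^ 2)) =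
        (∫⁻ u, ENNReal.ofReal (Real.exp (-L * u)) ∂γ) *
          (∫⁻ u, ENNReal.ofReal (Real.exp (L * u)) ∂γ) := by
      rw [mul_comm, ← e2]
    have hgn : Measurable fun u => -g u := hg.neg
    nth_rewrite 1 [e2]
    rw [e3, key _ _ hg hgn, key _ _ hgn hg, key _ _ (by fun_prop) (by fun_prop),
      key _ _ (by fun_prop) (by fun_prop), ← lintegral_add_left (meas2 _ _ hg hgn),
      ← lintegral_add_left (meas2 _ _ (by fun_prop) (by fun_prop))]
    refine lintegral_mono fun u => ?_
    rw [← lintegral_add_left (measurable_ofReal_exp (by fun_prop)),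
      ← lintegral_add_left (measurable_ofReal_exp (by fun_prop))]
    refine lintegral_mono fun v => ?_
    rw [← ENNReal.ofReal_add (Real.exp_pos _).le (Real.exp_pos _).le,
      ← ENNReal.ofReal_add (Real.exp_pos _).le (Real.exp_pos _).le]
    apply ENNReal.ofReal_le_ofReal
    have h1 : |g u - g v| ≤ |L * (u - v)| := by
      rw [abs_mul]
      exact (hL u v).trans (mul_le_mul_of_nonneg_right (le_abs_self L) (abs_nonneg _))
    have := exp_add_exp_neg_le h1
    convert this using 3 <;> ring
  rw [mul_comm B A, ← two_mul, ← two_mul] at e1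
  exact (ENNReal.mul_le_mul_iff_right (by norm_num) (by norm_num)).1 e1

section Marginal

variable {ι : Type*} [DecidableEq ι]

/-- The family of standard Gaussian measures. -/
abbrev stdGauss (ι : Type*) : ι → Measure ℝ := fun _ => gaussianReal 0 1

lemma lintegral_ofReal_exp_pos {g : ℝ → ℝ} (hg : Measurable g) :
    ∫⁻ u, ENNReal.ofReal (Real.exp (g u)) ∂gaussianReal 0 1 ≠ 0 := by
  intro h
  rw [lintegral_eq_zero_iff (measurable_ofReal_exp hg)] at h
  obtain ⟨u, hu⟩ := h.exists
  simp only [Pi.zero_apply, ENNReal.ofReal_eq_zero] at hu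
  exact absurd (Real.exp_pos (g u)) (not_lt.2 hu)

/-- Tensorisation: the coordinates of `D` are integrated out one at a time, each costing a factor
`exp(L²)`. The product of the two moments is controlled, rather than a centred moment, so no mean
has to be tracked; coordinates off `D` stay frozen. -/
lemma lmarginal_exp_mul_lmarginal_exp_neg_le (D : Finset ι) :
    ∀ {g : (ι → ℝ) → ℝ}, Measurable g → ∀ {L : ℝ},
    (∀ i ∈ D, ∀ x u, |g (Function.update x i u) - g x| ≤ L * |u - x i|) → ∀ x,
    lmarginal (stdGauss ι) D (fun x => ENNReal.ofReal (Real.exp (g x))) x *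
      lmarginal (stdGauss ι) D (fun x => ENNReal.ofReal (Real.exp (-g x))) x ≤
      ENNReal.ofReal (Real.exp (L ^ 2)) ^ D.card := by
  induction D using Finset.induction_on with
  | empty =>
    intro g _ L _ x
    simp [← ENNReal.ofReal_mul (Real.exp_pos _).le, ← Real.exp_add]
  | insert i s hi ih =>
    intro g hg L hL x
    have hsec : ∀ x : ι → ℝ, Measurable fun u => g (Function.update x i u) := fun x =>
      hg.comp (measurable_update x)
    have hsecL : ∀ (x : ι → ℝ) (u v : ℝ),
        |g (Function.update x i u) - g (Function.update x i v)| ≤ L * |u - v| := by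
      intro x u v
      have := hL i (Finset.mem_insert_self _ _) (Function.update x i v) u
      simpa using this
    set a : (ι → ℝ) → ENNReal :=
      fun x => ∫⁻ u, ENNReal.ofReal (Real.exp (g (Function.update x i u))) ∂gaussianReal 0 1 with ha
    set b : (ι → ℝ) → ENNReal :=
      fun x => ∫⁻ u, ENNReal.ofReal (Real.exp (-g (Function.update x i u))) ∂gaussianReal 0 1 with hb
    have hab : ∀ x, a x * b x ≤ ENNReal.ofReal (Real.exp (L ^ 2)) := fun x =>
      lintegral_exp_mul_lintegral_exp_neg_le (hsec x) (hsecL x)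
    have ha0 : ∀ x, a x ≠ 0 := fun x => lintegral_ofReal_exp_pos (hsec x)
    have hb0 : ∀ x, b x ≠ 0 := fun x => lintegral_ofReal_exp_pos (hsec x).neg
    have hatop : ∀ x, a x ≠ ⊤ := by
      intro x h
      have := hab x
      rw [h, ENNReal.top_mul (hb0 x)] at this
      exact absurd this (by simp)
    -- Writing the partial integral as `exp g'` returns the problem to its original form: the
    -- one-dimensional bound gives `b ≤ exp(L²) exp(-g')`, and `g'` inherits the Lipschitz bounds in
    -- the remaining coordinates because the pointwise comparison survives integration.
    set g' : (ι → ℝ) → ℝ := fun x => Real.log (a x).toReal with hg'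
    have hag : ∀ x, a x = ENNReal.ofReal (Real.exp (g' x)) := by
      intro x
      rw [hg', Real.exp_log (ENNReal.toReal_pos (ha0 x) (hatop x)), ENNReal.ofReal_toReal (hatop x)]
    have hbg : ∀ x, b x ≤ ENNReal.ofReal (Real.exp (L ^ 2)) * ENNReal.ofReal (Real.exp (-g' x)) := by
      intro x
      rw [Real.exp_neg, ENNReal.ofReal_inv_of_pos (Real.exp_pos _), ← hag x, ← div_eq_mul_inv,
        ENNReal.le_div_iff_mul_le (Or.inl (ha0 x)) (Or.inl (hatop x)), mul_comm]
      exact hab x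
    have ham : Measurable a := by
      have h1 : Measurable fun p : (ι → ℝ) × ℝ => Function.update p.1 i p.2 :=
        measurable_update'
      exact Measurable.lintegral_prod_right (measurable_ofReal_exp (hg.comp h1))
    have hg'm : Measurable g' := Real.measurable_log.comp ham.ennreal_toReal
    have hle : ∀ k ∈ s, ∀ x v, a (Function.update x k v) ≤
        ENNReal.ofReal (Real.exp (L * |v - x k|)) * a x := by
      intro k hk x v
      have hki : k ≠ i := by rintro rfl; exact hi hk
      rw [ha]
      simp only
      rw [← lintegral_const_mul _ (measurable_ofReal_exp (hsec x))]
      refine lintegral_mono fun u => ?_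
      rw [← ENNReal.ofReal_mul (Real.exp_pos _).le, ← Real.exp_add]
      apply ENNReal.ofReal_le_ofReal
      apply Real.exp_le_exp.2
      rw [Function.update_comm hki]
      have := hL k (Finset.mem_insert_of_mem hk) (Function.update x i u) v
      rw [Function.update_of_ne hki] at this
      linarith [(abs_le.1 this).2]
    have hle' : ∀ k ∈ s, ∀ x v, g' (Function.update x k v) ≤ L * |v - x k| + g' x := by
      intro k hk x v
      have := hle k hk x v
      rw [hag, hag x, ← ENNReal.ofReal_mul (Real.exp_pos _).le, ← Real.exp_add,
        ENNReal.ofReal_le_ofReal_iff (Real.exp_pos _).le] at this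
      exact Real.exp_le_exp.1 this
    have hL' : ∀ k ∈ s, ∀ x u, |g' (Function.update x k u) - g' x| ≤ L * |u - x k| := by
      intro k hk x u
      rw [abs_le]
      constructor
      · have := hle' k hk (Function.update x k u) (x k)
        simp only [Function.update_idem, Function.update_eq_self, Function.update_self] at this
        rw [abs_sub_comm] at this
        linarith
      · linarith [hle' k hk x u]
    have h1 := ih hg'm hL' x
    rw [lmarginal_insert' _ (measurable_ofReal_exp hg) hi,
      lmarginal_insert' _ (measurable_ofReal_exp (show Measurable fun x => -g x from hg.neg)) hi, Finset.card_insert_of_notMem hi]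
    change lmarginal (stdGauss ι) s a x * lmarginal (stdGauss ι) s b x ≤ _
    have h2 : lmarginal (stdGauss ι) s b x ≤ ENNReal.ofReal (Real.exp (L ^ 2)) *
        lmarginal (stdGauss ι) s (fun x => ENNReal.ofReal (Real.exp (-g' x))) x := by
      refine (lmarginal_mono (fun x => hbg x) x).trans (le_of_eq ?_)
      simp only [lmarginal]
      rw [lintegral_const_mul]
      exact (measurable_ofReal_exp hg'm.neg).comp measurable_updateFinset
    have h3 : lmarginal (stdGauss ι) s a x =
        lmarginal (stdGauss ι) s (fun x => ENNReal.ofReal (Real.exp (g' x))) x := by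
      congr 1; funext x; exact hag x
    rw [h3]
    refine (mul_le_mul_right h2 _).trans ?_
    rw [mul_left_comm, pow_succ _ s.card, mul_comm (_ ^ s.card)]
    exact mul_le_mul_right h1 _

/-- Flipping the coordinates in `D`. -/
def flipCoords (D : Finset ι) (x : ι → ℝ) : ι → ℝ := fun i => if i ∈ D then -x i else x i

lemma lmarginal_comp_flipCoords (D : Finset ι) {f : (ι → ℝ) → ENNReal} (hf : Measurable f)
    (x : ι → ℝ) :
    lmarginal (stdGauss ι) D (fun x => f (flipCoords D x)) x = lmarginal (stdGauss ι) D f x := by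
  simp only [lmarginal]
  have hmp : MeasurePreserving (fun (y : D → ℝ) i => -y i)
      (Measure.pi fun i : D => stdGauss ι i) (Measure.pi fun i : D => stdGauss ι i) := by
    apply measurePreserving_pi
    intro i
    exact ⟨measurable_neg, by simpa using gaussianReal_map_neg (μ := 0) (v := 1)⟩
  rw [← hmp.lintegral_comp (f := fun y => f (Function.updateFinset x D y))
    (hf.comp measurable_updateFinset)]
  refine lintegral_congr fun y => ?_
  congr 1
  funext i
  by_cases h : i ∈ D <;> simp [flipCoords, Function.updateFinset, h]

variable [Fintype ι]

/-- Exponential moments of coordinatewise Lipschitz functions that are odd under a flip. -/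
lemma lintegral_exp_le_of_odd (D : Finset ι) {g : (ι → ℝ) → ℝ} (hg : Measurable g) {L : ℝ}
    (hL : ∀ i ∈ D, ∀ x u, |g (Function.update x i u) - g x| ≤ L * |u - x i|)
    (hodd : ∀ x, g (flipCoords D x) = - g x) :
    ∫⁻ x, ENNReal.ofReal (Real.exp (g x)) ∂Measure.pi (stdGauss ι) ≤
      ENNReal.ofReal (Real.exp (L ^ 2 * D.card / 2)) := by
  have h1 : ∀ x, lmarginal (stdGauss ι) D (fun x => ENNReal.ofReal (Real.exp (g x))) x ≤
      ENNReal.ofReal (Real.exp (L ^ 2 * D.card / 2)) := by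
    intro x
    have h2 := lmarginal_exp_mul_lmarginal_exp_neg_le D hg hL x
    have h3 := lmarginal_comp_flipCoords D (measurable_ofReal_exp hg) x
    simp only [hodd] at h3
    -- Oddness makes the two marginals equal, so the product bound becomes a bound on a square.
    rw [h3, ← sq] at h2
    have h4 : ENNReal.ofReal (Real.exp (L ^ 2)) ^ D.card =
        ENNReal.ofReal (Real.exp (L ^ 2 * D.card / 2)) ^ 2 := by
      rw [← ENNReal.ofReal_pow (Real.exp_pos _).le, ← ENNReal.ofReal_pow (Real.exp_pos _).le,
        ← Real.exp_nat_mul, ← Real.exp_nat_mul]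
      congr 2; push_cast; ring
    rw [h4] at h2
    exact (ENNReal.pow_le_pow_left_iff two_ne_zero).1 h2
  have h5 := lintegral_le_of_lmarginal_le D (μ := stdGauss ι) (measurable_ofReal_exp hg)
    (measurable_const (a := ENNReal.ofReal (Real.exp (L ^ 2 * D.card / 2)))) (fun x => by
      refine (h1 x).trans (le_of_eq ?_)
      simp [lmarginal])
  simpa using h5

/-- Gaussian tail bound for odd coordinatewise Lipschitz functions. -/
lemma measureReal_pi_gt_le_of_odd (D : Finset ι) {g : (ι → ℝ) → ℝ} (hg : Measurable g) {L : ℝ}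
    (hL0 : 0 < L)
    (hL : ∀ i ∈ D, ∀ x u, |g (Function.update x i u) - g x| ≤ L * |u - x i|)
    (hodd : ∀ x, g (flipCoords D x) = - g x) {m : ℝ} (hm : 0 < m) (hDm : D.card ≤ m)
    {t : ℝ} (ht : 0 < t) :
    (Measure.pi (stdGauss ι)).real {x | t < g x} ≤ Real.exp (-(t ^ 2 / (2 * L ^ 2 * m))) := by
  -- The Chernoff parameter minimising `l² L² m / 2 - l t`.
  set l : ℝ := t / (L ^ 2 * m) with hl
  have hl0 : 0 < l := by positivity
  have h1 := lintegral_exp_le_of_odd D (g := fun x => l * g x) (hg.const_mul l) (L := l * L)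
    (by
      intro i hi x u
      rw [← mul_sub, abs_mul, abs_of_pos hl0, mul_assoc]
      exact mul_le_mul_of_nonneg_left (hL i hi x u) hl0.le)
    (by intro x; rw [hodd]; ring)
  have h2 : ENNReal.ofReal (Real.exp (l * t)) * Measure.pi (stdGauss ι) {x | t < g x} ≤
      ENNReal.ofReal (Real.exp ((l * L) ^ 2 * m / 2)) := by
    refine le_trans ?_ (h1.trans (ENNReal.ofReal_le_ofReal (Real.exp_le_exp.2 (by gcongr))))
    refine le_trans ?_ (mul_meas_ge_le_lintegral (measurable_ofReal_exp (hg.const_mul l))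
      (ENNReal.ofReal (Real.exp (l * t))))
    refine mul_le_mul_right (measure_mono fun x hx => ?_) _
    have hx' : t < g x := hx
    exact ENNReal.ofReal_le_ofReal (Real.exp_le_exp.2 (mul_le_mul_of_nonneg_left hx'.le hl0.le))
  have h3 := ENNReal.toReal_mono (by simp) h2
  rw [ENNReal.toReal_mul, ENNReal.toReal_ofReal (Real.exp_pos _).le,
    ENNReal.toReal_ofReal (Real.exp_pos _).le] at h3
  change _ * (Measure.pi (stdGauss ι)).real _ ≤ _ at h3
  rw [mul_comm, ← le_div_iff₀ (Real.exp_pos _), ← Real.exp_sub] at h3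
  refine h3.trans (le_of_eq ?_)
  congr 1
  rw [hl]
  field_simp
  ring

end Marginal

/-! ### Dependence of the free energy on the field -/

lemma abs_spinVal (s : ℤˣ) : |spinVal s| = 1 := by
  rcases Int.units_eq_one_or s with rfl | rfl <;> simp [spinVal]

lemma partitionFn_pos (α β ε : ℝ) (Λ : Finset ℤ) (η : Config) (h : ℤ → ℝ) :
    0 < partitionFn α β ε Λ η h :=
  Finset.sum_pos (fun _ _ => Real.exp_pos _) Finset.univ_nonempty

lemma partitionFn_congr {α β ε : ℝ} {Λ : Finset ℤ} {η : Config} {h h' : ℤ → ℝ}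
    (hh : ∀ y ∈ Λ, h y = h' y) : partitionFn α β ε Λ η h = partitionFn α β ε Λ η h' := by
  unfold partitionFn hamiltonian
  have : ∀ x : Λ, h x = h' x := fun x => hh x x.2
  simp only [this]

lemma partitionFn_le_exp_mul {α β ε : ℝ} (hβ : 0 < β) (hε : 0 < ε) {Λ : Finset ℤ} {η : Config}
    {h h' : ℤ → ℝ} {x : ℤ} (hh : ∀ y ∈ Λ, y ≠ x → h y = h' y) :
    partitionFn α β ε Λ η h ≤ Real.exp (β * ε * |h x - h' x|) * partitionFn α β ε Λ η h' := by
  unfold partitionFn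
  rw [Finset.mul_sum]
  refine Finset.sum_le_sum fun σ _ => ?_
  rw [← Real.exp_add]
  apply Real.exp_le_exp.2
  have key : ∑ y : Λ, ε * h y * spinVal (σ y) ≤
      ε * |h x - h' x| + ∑ y : Λ, ε * h' y * spinVal (σ y) := by
    rw [← sub_le_iff_le_add, ← Finset.sum_sub_distrib]
    have hterm : ∀ y : Λ, ε * h y * spinVal (σ y) - ε * h' y * spinVal (σ y) ≤
        if (y : ℤ) = x then ε * |h x - h' x| else 0 := by
      intro y
      split_ifs with hy
      · rw [← sub_mul, ← mul_sub, hy, mul_assoc]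
        refine mul_le_mul_of_nonneg_left ?_ hε.le
        refine (le_abs_self _).trans ?_
        rw [abs_mul, abs_spinVal, mul_one]
      · rw [hh y y.2 hy, sub_self]
    refine (Finset.sum_le_sum fun y _ => hterm y).trans ?_
    rw [Finset.sum_coe_sort Λ (fun y => if y = x then ε * |h x - h' x| else 0),
      Finset.sum_ite_eq']
    split_ifs
    · exact le_rfl
    · positivity
  unfold hamiltonian
  nlinarith

lemma abs_log_partitionFn_sub_le {α β ε : ℝ} (hβ : 0 < β) (hε : 0 < ε) {Λ : Finset ℤ} {η : Config}
    {h h' : ℤ → ℝ} {x : ℤ} (hh : ∀ y ∈ Λ, y ≠ x → h y = h' y) :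
    |Real.log (partitionFn α β ε Λ η h) - Real.log (partitionFn α β ε Λ η h')| ≤
      β * ε * |h x - h' x| := by
  have aux : ∀ {h h' : ℤ → ℝ}, (∀ y ∈ Λ, y ≠ x → h y = h' y) →
      Real.log (partitionFn α β ε Λ η h) ≤
        β * ε * |h x - h' x| + Real.log (partitionFn α β ε Λ η h') := by
    intro h h' hh
    have := Real.log_le_log (partitionFn_pos _ _ _ _ _ _)
      (partitionFn_le_exp_mul (α := α) (η := η) hβ hε hh)
    rwa [Real.log_mul (Real.exp_pos _).ne' (partitionFn_pos _ _ _ _ _ _).ne', Real.log_exp] at this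
  rw [abs_le]
  constructor
  · have := aux (h := h') (h' := h) (fun y hy hne => (hh y hy hne).symm)
    rw [abs_sub_comm] at this
    linarith
  · linarith [aux hh]

lemma errorFn_eq (α β ε : ℝ) (Λ : Finset ℤ) (A : Set ℤ) (h : ℤ → ℝ) :
    errorFn α β ε Λ A h = 1 / β * (Real.log (partitionFn α β ε Λ (fun _ => 1) (flipField A h)) -
      Real.log (partitionFn α β ε Λ (fun _ => 1) h)) := by
  rw [errorFn, Real.log_div (partitionFn_pos _ _ _ _ _ _).ne' (partitionFn_pos _ _ _ _ _ _).ne']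
  ring

lemma errorFn_empty (α β ε : ℝ) (Λ : Finset ℤ) (h : ℤ → ℝ) :
    errorFn α β ε Λ ∅ h = 0 := by
  have : flipField ∅ h = h := by funext x; simp [flipField]
  rw [errorFn_eq, this, sub_self, mul_zero]

/-- Extension by zero of a field on `Λ`. -/
def extendField (Λ : Finset ℤ) (z : Λ → ℝ) : ℤ → ℝ := fun y => if hy : y ∈ Λ then z ⟨y, hy⟩ else 0

lemma measurable_partitionFn_flipField (α β ε : ℝ) (Λ : Finset ℤ) (η : Config) (A : Set ℤ) :
    Measurable fun z : Λ → ℝ => partitionFn α β ε Λ η (flipField A (extendField Λ z)) := by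
  unfold partitionFn hamiltonian
  refine Finset.measurable_sum _ fun σ _ => Real.measurable_exp.comp (Measurable.const_mul ?_ _)
  refine Measurable.sub measurable_const (Finset.measurable_sum _ fun x _ => ?_)
  refine Measurable.mul_const (Measurable.const_mul ?_ _) _
  by_cases hx : (x : ℤ) ∈ A
  · simp only [flipField, hx, if_true, extendField, x.2, dif_pos]
    exact (measurable_pi_apply x).neg
  · simp only [flipField, hx, if_false, extendField, x.2, dif_pos]
    exact measurable_pi_apply x

/-- Increments of the error function along nested sets have Gaussian tails. -/
lemma measureReal_errorFn_sub_gt_le {Ω : Type*} [MeasurableSpace Ω] {P : Measure Ω}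
    [IsProbabilityMeasure P] {h : ℤ → Ω → ℝ} (hlaw : ∀ x, HasLaw (h x) (gaussianReal 0 1) P)
    (hind : iIndepFun h P) {α β ε : ℝ} (hβ : 0 < β) (hε : 0 < ε) (Λ : Finset ℤ)
    {B B' : Finset ℤ} (hB : B' ⊆ B) {m : ℝ} (hm : 0 < m) (hBm : ((B \ B').card : ℝ) ≤ m) {t : ℝ}
    (ht : 0 < t) :
    P.real {ω | t < errorFn α β ε Λ B (fun y => h y ω) - errorFn α β ε Λ B' (fun y => h y ω)} ≤
      Real.exp (-(t ^ 2 / (8 * ε ^ 2 * m))) := by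
  set F : Set ℤ → (Λ → ℝ) → ℝ := fun A z =>
    Real.log (partitionFn α β ε Λ (fun _ => 1) (flipField A (extendField Λ z))) with hF
  set g : (Λ → ℝ) → ℝ := fun z => 1 / β * (F B z - F B' z) with hg
  have hFm : ∀ A, Measurable (F A) := fun A =>
    Real.measurable_log.comp (measurable_partitionFn_flipField _ _ _ _ _ _)
  have hgm : Measurable g := ((hFm _).sub (hFm _)).const_mul _
  have hFL : ∀ (A : Set ℤ) (i : Λ) (z : Λ → ℝ) (u : ℝ),
      |F A (Function.update z i u) - F A z| ≤ β * ε * |u - z i| := by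
    intro A i z u
    refine (abs_log_partitionFn_sub_le (x := i) hβ hε ?_).trans (le_of_eq ?_)
    · intro y hy hne
      have : (⟨y, hy⟩ : Λ) ≠ i := fun h => hne (by rw [← h])
      simp [flipField, extendField, hy, Function.update_of_ne this]
    · by_cases hA : (i : ℤ) ∈ A
      · simp only [flipField, hA, if_true, extendField, i.2, dif_pos, Function.update_self]
        rw [neg_sub_neg, abs_sub_comm]
      · simp only [flipField, hA, if_false, extendField, i.2, dif_pos, Function.update_self]
  have hgL : ∀ (i : Λ) (z : Λ → ℝ) (u : ℝ),
      |g (Function.update z i u) - g z| ≤ 2 * ε * |u - z i| := by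
    intro i z u
    have h1 := hFL B i z u
    have h2 := hFL B' i z u
    have h3 : g (Function.update z i u) - g z = 1 / β * ((F B (Function.update z i u) - F B z) -
        (F B' (Function.update z i u) - F B' z)) := by rw [hg]; ring
    rw [h3, abs_mul, abs_of_pos (by positivity : 0 < 1 / β)]
    calc 1 / β * |(F B (Function.update z i u) - F B z) - (F B' (Function.update z i u) - F B' z)|
        ≤ 1 / β * (β * ε * |u - z i| + β * ε * |u - z i|) := by
          refine mul_le_mul_of_nonneg_left ((abs_sub _ _).trans (add_le_add h1 h2)) (by positivity)
      _ = 2 * ε * |u - z i| := by field_simp; ring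
  set D : Finset Λ := Finset.univ.filter fun x => (x : ℤ) ∈ B \ B' with hD
  have hcard : D.card ≤ (B \ B').card :=
    Finset.card_le_card_of_injOn (fun x => (x : ℤ)) (fun x hx => by simpa [hD] using hx)
      (fun x _ y _ hxy => Subtype.ext hxy)
  -- Since `B' ⊆ B`, flipping on `B \ B'` exchanges `τ_B` and `τ_{B'}`; this is the source of the
  -- oddness.
  have hflip : ∀ (z : Λ → ℝ), F B (flipCoords D z) = F B' z ∧ F B' (flipCoords D z) = F B z := by
    intro z
    constructor <;>
    · rw [hF]
      dsimp only
      congr 1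
      apply partitionFn_congr
      intro y hy
      have := @hB y
      by_cases h1 : y ∈ B <;> by_cases h2 : y ∈ B' <;>
        simp_all [flipField, extendField, flipCoords]
  have hodd : ∀ z, g (flipCoords D z) = - g z := by
    intro z
    simp only [hg, (hflip z).1, (hflip z).2]
    ring
  have main := measureReal_pi_gt_le_of_odd D hgm (L := 2 * ε) (by positivity)
    (fun i _ z u => hgL i z u) hodd hm ((Nat.cast_le.2 hcard).trans hBm) ht
  have haem : ∀ x, AEMeasurable (h x) P := fun x => (hlaw x).aemeasurable
  have hmap : P.map (fun ω (x : Λ) => h x ω) = Measure.pi (stdGauss Λ) := by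
    have h1 : iIndepFun (fun x : Λ => h x) P := hind.precomp Subtype.val_injective
    rw [(iIndepFun_iff_map_fun_eq_pi_map fun x : Λ => haem x).1 h1]
    congr 1
    funext x
    exact (hlaw x).map_eq
  have hset : {ω | t < errorFn α β ε Λ B (fun y => h y ω) - errorFn α β ε Λ B' (fun y => h y ω)} =
      (fun ω (x : Λ) => h x ω) ⁻¹' {z | t < g z} := by
    ext ω
    change (_ : ℝ) < _ ↔ (_ : ℝ) < _
    have hcon : ∀ A : Set ℤ, partitionFn α β ε Λ (fun _ => 1) (flipField A fun y => h y ω) =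
        partitionFn α β ε Λ (fun _ => 1) (flipField A (extendField Λ fun x => h x ω)) := by
      intro A
      apply partitionFn_congr
      intro y hy
      simp [flipField, extendField, hy]
    rw [errorFn_eq, errorFn_eq, hcon, hcon]
    simp only [hg, hF]
    rw [← mul_sub, sub_sub_sub_cancel_right]
  have hmeas : MeasurableSet {z | t < g z} := measurableSet_lt measurable_const hgm
  rw [hset, ← map_measureReal_apply_of_aemeasurable
    (f := fun ω (x : Λ) => h x ω) (aemeasurable_pi_lambda _ fun x => haem x) hmeas,
    hmap]
  refine main.trans (le_of_eq ?_)
  congr 3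
  ring

/-! ### Clustering of the walls -/

/-- Two clusters of lengths `d ≤ d'` whose gap is at most `1.9 d` can be joined without losing the
energy law `length^s`. The extreme case is `d = d'`, where it is the hypothesis on `3.9^s`;
convexity of `t ↦ t^(1/s)` reduces the general case to it. -/
lemma rpow_add_le_of_le {s d d' : ℝ} (hs0 : 0 < s) (hs1 : s ≤ 1) (hs : (3.9 : ℝ) ^ s ≤ 2)
    (hd : 0 < d) (hdd : d ≤ d') : (d' + 2.9 * d) ^ s ≤ d ^ s + d' ^ s := by
  have hd' : 0 < d' := hd.trans_le hdd
  set p : ℝ := 1 / s with hp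
  have hp1 : 1 ≤ p := by rw [hp, le_div_iff₀ hs0]; linarith
  have hp0 : 0 < p := by positivity
  have hsp : s * p = 1 := by rw [hp]; field_simp
  set x := d' ^ s with hx
  set y := d ^ s with hy
  have hx0 : 0 < x := Real.rpow_pos_of_pos hd' s
  have hy0 : 0 < y := Real.rpow_pos_of_pos hd s
  have hyx : y ≤ x := Real.rpow_le_rpow hd.le hdd hs0.le
  have hxp : x ^ p = d' := by rw [hx, ← Real.rpow_mul hd'.le, hsp, Real.rpow_one]
  have hyp : y ^ p = d := by rw [hy, ← Real.rpow_mul hd.le, hsp, Real.rpow_one]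
  have h2p : (3.9 : ℝ) ≤ 2 ^ p := by
    have := Real.rpow_le_rpow (by positivity) hs hp0.le
    rwa [← Real.rpow_mul (by norm_num), hsp, Real.rpow_one] at this
  have hconv := convexOn_rpow hp1
  -- The pair `x, 2y` has the same sum as `y, x + y` and lies between those two points, so convexity
  -- gives `x^p + (2y)^p ≤ y^p + (x+y)^p`; `c1` and `c2` are its two halves.
  have c1 : x ^ p ≤ (y / x) * y ^ p + ((x - y) / x) * (x + y) ^ p := by
    have := hconv.2 (Set.mem_Ici.2 hy0.le) (Set.mem_Ici.2 (by positivity : (0:ℝ) ≤ x + y))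
      (by positivity : 0 ≤ y / x) (div_nonneg (by linarith) hx0.le : 0 ≤ (x - y) / x)
      (by field_simp; ring)
    simp only [smul_eq_mul] at this
    rwa [show y / x * y + (x - y) / x * (x + y) = x by field_simp; ring] at this
  have c2 : (2 * y) ^ p ≤ ((x - y) / x) * y ^ p + (y / x) * (x + y) ^ p := by
    have := hconv.2 (Set.mem_Ici.2 hy0.le) (Set.mem_Ici.2 (by positivity : (0:ℝ) ≤ x + y))
      (div_nonneg (by linarith) hx0.le : 0 ≤ (x - y) / x) (by positivity : 0 ≤ y / x)
      (by field_simp; ring)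
    simp only [smul_eq_mul] at this
    rwa [show (x - y) / x * y + y / x * (x + y) = 2 * y by field_simp; ring] at this
  have hsum : y / x + (x - y) / x = 1 := by field_simp; ring
  have c3 : x ^ p + (2 * y) ^ p ≤ y ^ p + (x + y) ^ p := by
    have e1 : y ^ p + (x + y) ^ p = (y / x + (x - y) / x) * (y ^ p + (x + y) ^ p) := by
      rw [hsum, one_mul]
    rw [e1]; linarith
  rw [Real.mul_rpow (by norm_num) hy0.le, hxp, hyp] at c3
  have c4 : d' + 2.9 * d ≤ (x + y) ^ p := by nlinarith
  have := Real.rpow_le_rpow (by positivity) c4 hs0.le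
  rw [← Real.rpow_mul (by positivity), mul_comm p s, hsp, Real.rpow_one] at this
  linarith

/-- The integer interval with left end point `C.1` and length `C.2`. -/
def hull (C : ℤ × ℕ) : Finset ℤ := Finset.Ico C.1 (C.1 + C.2)

lemma mem_hull {C : ℤ × ℕ} {x : ℤ} : x ∈ hull C ↔ C.1 ≤ x ∧ x < C.1 + C.2 := Finset.mem_Ico

lemma card_hull (C : ℤ × ℕ) : (hull C).card = C.2 := by simp [hull]

/-- A family of disjoint short intervals and a set `H` of long pieces covering the walls in
`[p, q)`, with enough energy in each of them. -/
structure IsClustering (p q : ℤ) (wall : ℤ → Prop) (e : ℤ → ℝ) (L : ℕ) (c s : ℝ)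
    (H : Finset ℤ) (𝒞 : Finset (ℤ × ℕ)) : Prop where
  sub_left : H ⊆ Finset.Ico p q
  sub_right : ∀ C ∈ 𝒞, hull C ⊆ Finset.Ico p q
  disj : ∀ C ∈ 𝒞, ∀ x ∈ hull C, x ∉ H
  pairwise : ∀ C ∈ 𝒞, ∀ C' ∈ 𝒞, ∀ x ∈ hull C, x ∈ hull C' → C = C'
  cover : ∀ x ∈ Finset.Ico p q, wall x → x ∈ H ∨ ∃ C ∈ 𝒞, x ∈ hull C
  pos : ∀ C ∈ 𝒞, 1 ≤ C.2
  lt : ∀ C ∈ 𝒞, C.2 < L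
  exists_wall : ∀ C ∈ 𝒞, ∃ x ∈ hull C, wall x
  energy : ∀ C ∈ 𝒞, c * (C.2 : ℝ) ^ s ≤ ∑ x ∈ hull C, e x
  card_le : (H.card : ℝ) * c ≤ 5 * (L : ℝ) ^ (1 - s) * ∑ x ∈ H, e x
  thick : ∀ x ∈ H, ∃ a b : ℤ, a ≤ x ∧ x < b ∧ (L : ℤ) ≤ b - a ∧
    ∀ y, a ≤ y → y < b → y ∈ H ∨ y ∉ Finset.Ico p q

/-- The potential which decreases along the clustering procedure. -/
def potential (L : ℕ) (𝒞 : Finset (ℤ × ℕ)) : ℕ := ∑ C ∈ 𝒞, (L - C.2)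

namespace IsClustering

variable {p q : ℤ} {wall : ℤ → Prop} {e : ℤ → ℝ} {L : ℕ} {c s : ℝ} {H : Finset ℤ}
  {𝒞 : Finset (ℤ × ℕ)}

/-- Points outside `[p, q)` count as thick for free, since half-lines contain intervals of any
length. The boundary of the window can therefore be treated like `H`. -/
lemma thick' (h : IsClustering p q wall e L c s H 𝒞) {x : ℤ}
    (hx : x ∈ H ∨ x ∉ Finset.Ico p q) : ∃ a b : ℤ, a ≤ x ∧ x < b ∧ (L : ℤ) ≤ b - a ∧
      ∀ y, a ≤ y → y < b → y ∈ H ∨ y ∉ Finset.Ico p q := by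
  rcases hx with hx | hx
  · exact h.thick x hx
  · rw [Finset.mem_Ico, not_and_or, not_le, not_lt] at hx
    rcases hx with hx | hx
    · exact ⟨x - L, x + 1, by omega, by omega, by omega, fun y _ h2 => Or.inr (by
        rw [Finset.mem_Ico]; omega)⟩
    · exact ⟨x, x + L + 1, by omega, by omega, by omega, fun y h1 _ => Or.inr (by
        rw [Finset.mem_Ico]; omega)⟩

lemma thick_union (h : IsClustering p q wall e L c s H 𝒞) {N : Finset ℤ}
    (hN : ∀ x ∈ N, ∃ a b : ℤ, a ≤ x ∧ x < b ∧ (L : ℤ) ≤ b - a ∧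
      ∀ y, a ≤ y → y < b → y ∈ H ∪ N ∨ y ∉ Finset.Ico p q) :
    ∀ x ∈ H ∪ N, ∃ a b : ℤ, a ≤ x ∧ x < b ∧ (L : ℤ) ≤ b - a ∧
      ∀ y, a ≤ y → y < b → y ∈ H ∪ N ∨ y ∉ Finset.Ico p q := by
  intro x hx
  rcases Finset.mem_union.1 hx with hx | hx
  · obtain ⟨a, b, h1, h2, h3, h4⟩ := h.thick x hx
    exact ⟨a, b, h1, h2, h3, fun y h5 h6 => (h4 y h5 h6).imp_left fun h => Finset.mem_union_left _ h⟩
  · exact hN x hx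

lemma card_union_le (h : IsClustering p q wall e L c s H 𝒞) {N : Finset ℤ} (hNH : Disjoint H N)
    (hN : (N.card : ℝ) * c ≤ 5 * (L : ℝ) ^ (1 - s) * ∑ x ∈ N, e x) :
    ((H ∪ N).card : ℝ) * c ≤ 5 * (L : ℝ) ^ (1 - s) * ∑ x ∈ H ∪ N, e x := by
  rw [Finset.card_union_of_disjoint hNH, Finset.sum_union hNH]
  push_cast
  linarith [h.card_le]

/-- The common step of merging and enlarging: `N` swallows every cluster it meets. If it is still
short it becomes a cluster; otherwise it is moved into `H`, where its length, between `L` and `5 L`,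
gives thickness and the ratio of cardinality to energy. -/
lemma replace (h : IsClustering p q wall e L c s H 𝒞) (hc : 0 < c) (hs0 : 0 < s) (hs1 : s ≤ 1)
    {N : ℤ × ℕ} (hNT : hull N ⊆ Finset.Ico p q)
    (hNH : ∀ x ∈ hull N, x ∉ H) (hN : ∀ C ∈ 𝒞, hull C ⊆ hull N ∨ ∀ x ∈ hull C, x ∉ hull N)
    (he : c * (N.2 : ℝ) ^ s ≤ ∑ x ∈ hull N, e x) (hN5 : N.2 ≤ 5 * L)
    {C₀ : ℤ × ℕ} (hC₀ : C₀ ∈ 𝒞) (hC₀N : hull C₀ ⊆ hull N) (hlt : C₀.2 < N.2) :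
    ∃ H' 𝒞', IsClustering p q wall e L c s H' 𝒞' ∧ potential L 𝒞' < potential L 𝒞 := by
  classical
  set 𝒟 := 𝒞.filter fun C => ∀ x ∈ hull C, x ∉ hull N with h𝒟
  have hC₀mem : C₀.1 ∈ hull C₀ := by
    have := h.pos C₀ hC₀
    rw [mem_hull]; omega
  have hC₀𝒟 : C₀ ∉ 𝒟 := by
    intro hmem
    exact (Finset.mem_filter.1 hmem).2 _ hC₀mem (hC₀N hC₀mem)
  have hpot : potential L 𝒟 + (L - C₀.2) ≤ potential L 𝒞 := by
    have hsub : insert C₀ 𝒟 ⊆ 𝒞 := by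
      intro C hC
      rcases Finset.mem_insert.1 hC with rfl | hC
      · exact hC₀
      · exact (Finset.mem_filter.1 hC).1
    have := Finset.sum_le_sum_of_subset (f := fun C : ℤ × ℕ => L - C.2) hsub
    rw [Finset.sum_insert hC₀𝒟, add_comm] at this
    exact this
  have hC₀L := h.lt C₀ hC₀
  have hcov : ∀ x ∈ Finset.Ico p q, wall x → x ∈ H ∨ x ∈ hull N ∨ ∃ C ∈ 𝒟, x ∈ hull C := by
    intro x hx hw
    rcases h.cover x hx hw with hH | ⟨C, hC, hxC⟩
    · exact Or.inl hH
    · rcases hN C hC with h1 | h1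
      · exact Or.inr (Or.inl (h1 hxC))
      · exact Or.inr (Or.inr ⟨C, Finset.mem_filter.2 ⟨hC, h1⟩, hxC⟩)
  have hwN : ∃ x ∈ hull N, wall x := by
    obtain ⟨x, hx, hw⟩ := h.exists_wall C₀ hC₀
    exact ⟨x, hC₀N hx, hw⟩
  by_cases hNL : N.2 < L
  · refine ⟨H, insert N 𝒟, ⟨h.sub_left, ?_, ?_, ?_, ?_, ?_, ?_, ?_, ?_, h.card_le, h.thick⟩, ?_⟩
    · intro C hC
      rcases Finset.mem_insert.1 hC with rfl | hC
      · exact hNT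
      · exact h.sub_right C (Finset.mem_filter.1 hC).1
    · intro C hC
      rcases Finset.mem_insert.1 hC with rfl | hC
      · exact hNH
      · exact h.disj C (Finset.mem_filter.1 hC).1
    · intro C hC C' hC' x hx hx'
      rcases Finset.mem_insert.1 hC with rfl | hC <;> rcases Finset.mem_insert.1 hC' with rfl | hC'
      · rfl
      · exact absurd hx ((Finset.mem_filter.1 hC').2 x hx')
      · exact absurd hx' ((Finset.mem_filter.1 hC).2 x hx)
      · exact h.pairwise C (Finset.mem_filter.1 hC).1 C' (Finset.mem_filter.1 hC').1 x hx hx'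
    · intro x hx hw
      rcases hcov x hx hw with h1 | h1 | ⟨C, hC, h1⟩
      · exact Or.inl h1
      · exact Or.inr ⟨N, Finset.mem_insert_self _ _, h1⟩
      · exact Or.inr ⟨C, Finset.mem_insert_of_mem hC, h1⟩
    · intro C hC
      rcases Finset.mem_insert.1 hC with rfl | hC
      · omega
      · exact h.pos C (Finset.mem_filter.1 hC).1
    · intro C hC
      rcases Finset.mem_insert.1 hC with rfl | hC
      · exact hNL
      · exact h.lt C (Finset.mem_filter.1 hC).1
    · intro C hC
      rcases Finset.mem_insert.1 hC with rfl | hC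
      · exact hwN
      · exact h.exists_wall C (Finset.mem_filter.1 hC).1
    · intro C hC
      rcases Finset.mem_insert.1 hC with rfl | hC
      · exact he
      · exact h.energy C (Finset.mem_filter.1 hC).1
    · have h1 : potential L (insert N 𝒟) ≤ (L - N.2) + potential L 𝒟 := by
        by_cases hN𝒟 : N ∈ 𝒟
        · rw [Finset.insert_eq_of_mem hN𝒟]; omega
        · unfold potential; rw [Finset.sum_insert hN𝒟]
      omega
  · refine ⟨H ∪ hull N, 𝒟, ⟨Finset.union_subset h.sub_left hNT, ?_, ?_, ?_, ?_, ?_, ?_, ?_, ?_,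
      h.card_union_le ?_ ?_, h.thick_union ?_⟩, by omega⟩
    · exact fun C hC => h.sub_right C (Finset.mem_filter.1 hC).1
    · intro C hC x hx hxH
      rcases Finset.mem_union.1 hxH with h1 | h1
      · exact h.disj C (Finset.mem_filter.1 hC).1 x hx h1
      · exact (Finset.mem_filter.1 hC).2 x hx h1
    · exact fun C hC C' hC' =>
        h.pairwise C (Finset.mem_filter.1 hC).1 C' (Finset.mem_filter.1 hC').1
    · intro x hx hw
      rcases hcov x hx hw with h1 | h1 | h1
      · exact Or.inl (Finset.mem_union_left _ h1)
      · exact Or.inl (Finset.mem_union_right _ h1)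
      · exact Or.inr h1
    · exact fun C hC => h.pos C (Finset.mem_filter.1 hC).1
    · exact fun C hC => h.lt C (Finset.mem_filter.1 hC).1
    · exact fun C hC => h.exists_wall C (Finset.mem_filter.1 hC).1
    · exact fun C hC => h.energy C (Finset.mem_filter.1 hC).1
    · rw [Finset.disjoint_right]; exact hNH
    · rw [card_hull]
      have hN0 : (0 : ℝ) < N.2 := by exact_mod_cast (by omega : 0 < N.2)
      have hL0 : (0 : ℝ) ≤ (L : ℝ) ^ (1 - s) := by positivity
      have h1 : (N.2 : ℝ) = (N.2 : ℝ) ^ s * (N.2 : ℝ) ^ (1 - s) := by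
        rw [← Real.rpow_add hN0]; simp
      have h2 : (N.2 : ℝ) ^ (1 - s) ≤ 5 * (L : ℝ) ^ (1 - s) := by
        have h3 : (N.2 : ℝ) ≤ 5 * L := by exact_mod_cast hN5
        refine (Real.rpow_le_rpow hN0.le h3 (by linarith)).trans ?_
        rw [Real.mul_rpow (by norm_num) (by positivity)]
        refine mul_le_mul_of_nonneg_right ?_ hL0
        calc (5 : ℝ) ^ (1 - s) ≤ 5 ^ (1 : ℝ) :=
              Real.rpow_le_rpow_of_exponent_le (by norm_num) (by linarith)
          _ = 5 := Real.rpow_one _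
      calc (N.2 : ℝ) * c = (c * (N.2 : ℝ) ^ s) * (N.2 : ℝ) ^ (1 - s) := by
            nth_rewrite 1 [h1]; ring
        _ ≤ (c * (N.2 : ℝ) ^ s) * (5 * (L : ℝ) ^ (1 - s)) :=
            mul_le_mul_of_nonneg_left h2 (by positivity)
        _ ≤ (∑ x ∈ hull N, e x) * (5 * (L : ℝ) ^ (1 - s)) :=
            mul_le_mul_of_nonneg_right he (by positivity)
        _ = _ := by ring
    · intro x hx
      rw [mem_hull] at hx
      refine ⟨N.1, N.1 + N.2, hx.1, hx.2, by omega, fun y h1 h2 => Or.inl ?_⟩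
      exact Finset.mem_union_right _ (mem_hull.2 ⟨h1, h2⟩)

/-- A cluster close to `H`, or to the boundary of the window, joins `H` together with the gap. The
result is thick because it touches a thick piece, and the energy of the cluster pays for the gap
because the enlarged length is at most three times the old one. -/
lemma absorb (h : IsClustering p q wall e L c s H 𝒞) (hc : 0 < c) (hs1 : s ≤ 1)
    (he : ∀ x, 0 ≤ e x) {C : ℤ × ℕ} (hC : C ∈ 𝒞) {N : ℤ × ℕ} (hCN : hull C ⊆ hull N)
    (hN : ∀ x ∈ hull N, x ∈ hull C ∨ (x ∈ Finset.Ico p q ∧ x ∉ H ∧ ∀ C' ∈ 𝒞, x ∉ hull C'))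
    (hN3 : N.2 ≤ 3 * C.2)
    (hadj : ∃ y, (y = N.1 - 1 ∨ y = N.1 + N.2) ∧ (y ∈ H ∨ y ∉ Finset.Ico p q)) :
    ∃ H' 𝒞', IsClustering p q wall e L c s H' 𝒞' ∧ potential L 𝒞' < potential L 𝒞 := by
  classical
  have hCL := h.lt C hC
  have hC1 := h.pos C hC
  refine ⟨H ∪ hull N, 𝒞.erase C, ⟨Finset.union_subset h.sub_left ?_, ?_, ?_, ?_, ?_, ?_, ?_, ?_, ?_,
      h.card_union_le ?_ ?_, h.thick_union ?_⟩, ?_⟩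
  · intro x hx
    rcases hN x hx with h1 | h1
    · exact h.sub_right C hC h1
    · exact h1.1
  · exact fun C' hC' => h.sub_right C' (Finset.mem_of_mem_erase hC')
  · intro C' hC' x hx hxH
    have hC'' := Finset.mem_of_mem_erase hC'
    rcases Finset.mem_union.1 hxH with h1 | h1
    · exact h.disj C' hC'' x hx h1
    · rcases hN x h1 with h2 | h2
      · exact Finset.ne_of_mem_erase hC' (h.pairwise C' hC'' C hC x hx h2)
      · exact h2.2.2 C' hC'' hx
  · exact fun C' hC' C'' hC'' =>
      h.pairwise C' (Finset.mem_of_mem_erase hC') C'' (Finset.mem_of_mem_erase hC'')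
  · intro x hx hw
    rcases h.cover x hx hw with h1 | ⟨C', hC', h1⟩
    · exact Or.inl (Finset.mem_union_left _ h1)
    · by_cases hCC : C' = C
      · exact Or.inl (Finset.mem_union_right _ (hCN (hCC ▸ h1)))
      · exact Or.inr ⟨C', Finset.mem_erase.2 ⟨hCC, hC'⟩, h1⟩
  · exact fun C' hC' => h.pos C' (Finset.mem_of_mem_erase hC')
  · exact fun C' hC' => h.lt C' (Finset.mem_of_mem_erase hC')
  · exact fun C' hC' => h.exists_wall C' (Finset.mem_of_mem_erase hC')
  · exact fun C' hC' => h.energy C' (Finset.mem_of_mem_erase hC')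
  · rw [Finset.disjoint_right]
    intro x hx
    rcases hN x hx with h1 | h1
    · exact h.disj C hC x h1
    · exact h1.2.1
  · rw [card_hull]
    have hC0 : (0 : ℝ) < C.2 := by exact_mod_cast (by omega : 0 < C.2)
    have h1 : (C.2 : ℝ) = (C.2 : ℝ) ^ s * (C.2 : ℝ) ^ (1 - s) := by
      rw [← Real.rpow_add hC0]; simp
    have h2 : (C.2 : ℝ) ^ (1 - s) ≤ (L : ℝ) ^ (1 - s) :=
      Real.rpow_le_rpow hC0.le (by exact_mod_cast hCL.le) (by linarith)
    have h3 : (N.2 : ℝ) ≤ 5 * C.2 := by exact_mod_cast (by omega : N.2 ≤ 5 * C.2)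
    have h4 : ∑ x ∈ hull C, e x ≤ ∑ x ∈ hull N, e x :=
      Finset.sum_le_sum_of_subset_of_nonneg hCN fun x _ _ => he x
    calc (N.2 : ℝ) * c ≤ 5 * C.2 * c := mul_le_mul_of_nonneg_right h3 hc.le
      _ = 5 * (c * (C.2 : ℝ) ^ s) * (C.2 : ℝ) ^ (1 - s) := by nth_rewrite 1 [h1]; ring
      _ ≤ 5 * (c * (C.2 : ℝ) ^ s) * (L : ℝ) ^ (1 - s) :=
          mul_le_mul_of_nonneg_left h2 (by positivity)
      _ ≤ 5 * (∑ x ∈ hull N, e x) * (L : ℝ) ^ (1 - s) := by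
          gcongr; exact (h.energy C hC).trans h4
      _ = _ := by ring
  · intro x hx
    obtain ⟨y, hy, hyH⟩ := hadj
    obtain ⟨a, b, h1, h2, h3, h4⟩ := h.thick' hyH
    rw [mem_hull] at hx
    refine ⟨min a N.1, max b (N.1 + N.2), by omega, by omega, by omega, fun z hz1 hz2 => ?_⟩
    by_cases hz : z ∈ hull N
    · exact Or.inl (Finset.mem_union_right _ hz)
    · rw [mem_hull] at hz
      exact (h4 z (by omega) (by omega)).imp_left fun h => Finset.mem_union_left _ h
  · unfold potential
    rw [← Finset.add_sum_erase _ _ hC]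
    omega

/-- The energies of the disjoint clusters add up, and `rpow_add_le_of_le` turns their sum into the
energy required for the joint interval. -/
lemma merge (h : IsClustering p q wall e L c s H 𝒞) (hc : 0 < c) (hs0 : 0 < s) (hs1 : s ≤ 1)
    (hs : (3.9 : ℝ) ^ s ≤ 2) (he : ∀ x, 0 ≤ e x) {C C' : ℤ × ℕ} (hC : C ∈ 𝒞) (hC' : C' ∈ 𝒞)
    (hne : C ≠ C') (hle : C.2 ≤ C'.2) {N : ℤ × ℕ} (hCN : hull C ⊆ hull N) (hCN' : hull C' ⊆ hull N)
    (hN : ∀ x ∈ hull N, x ∈ hull C ∨ x ∈ hull C' ∨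
      (x ∈ Finset.Ico p q ∧ x ∉ H ∧ ∀ C' ∈ 𝒞, x ∉ hull C'))
    (hN3 : 10 * N.2 ≤ 29 * C.2 + 10 * C'.2) (hlt : C.2 < N.2) :
    ∃ H' 𝒞', IsClustering p q wall e L c s H' 𝒞' ∧ potential L 𝒞' < potential L 𝒞 := by
  classical
  have hCL := h.lt C' hC'
  have hC1 := h.pos C hC
  refine h.replace hc hs0 hs1 (N := N) ?_ ?_ ?_ ?_ (by omega) hC hCN hlt
  · intro x hx
    rcases hN x hx with h1 | h1 | h1
    · exact h.sub_right C hC h1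
    · exact h.sub_right C' hC' h1
    · exact h1.1
  · intro x hx
    rcases hN x hx with h1 | h1 | h1
    · exact h.disj C hC x h1
    · exact h.disj C' hC' x h1
    · exact h1.2.1
  · intro C'' hC''
    by_cases h1 : C'' = C
    · exact Or.inl (h1 ▸ hCN)
    by_cases h2 : C'' = C'
    · exact Or.inl (h2 ▸ hCN')
    right
    intro x hx hxN
    rcases hN x hxN with h3 | h3 | h3
    · exact h1 (h.pairwise C'' hC'' C hC x hx h3)
    · exact h2 (h.pairwise C'' hC'' C' hC' x hx h3)
    · exact h3.2.2 C'' hC'' hx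
  · have hdisj : Disjoint (hull C) (hull C') := by
      rw [Finset.disjoint_left]
      intro x hx hx'
      exact hne (h.pairwise C hC C' hC' x hx hx')
    have hC0 : (0 : ℝ) < C.2 := by exact_mod_cast hC1
    have h1 : (N.2 : ℝ) ≤ C'.2 + 2.9 * C.2 := by
      have : (10 : ℝ) * N.2 ≤ 29 * C.2 + 10 * C'.2 := by exact_mod_cast hN3
      linarith
    calc c * (N.2 : ℝ) ^ s ≤ c * ((C'.2 : ℝ) + 2.9 * C.2) ^ s := by gcongr
      _ ≤ c * ((C.2 : ℝ) ^ s + (C'.2 : ℝ) ^ s) := by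
          refine mul_le_mul_of_nonneg_left ?_ hc.le
          exact rpow_add_le_of_le hs0 hs1 hs hC0 (by exact_mod_cast hle)
      _ = c * (C.2 : ℝ) ^ s + c * (C'.2 : ℝ) ^ s := by ring
      _ ≤ ∑ x ∈ hull C, e x + ∑ x ∈ hull C', e x :=
          add_le_add (h.energy C hC) (h.energy C' hC')
      _ = ∑ x ∈ hull C ∪ hull C', e x := (Finset.sum_union hdisj).symm
      _ ≤ ∑ x ∈ hull N, e x :=
          Finset.sum_le_sum_of_subset_of_nonneg (Finset.union_subset hCN hCN') fun x _ _ => he x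

/-- The extension hypothesis: a short cluster surrounded by wall-free gaps sits in a longer
interval with enough energy. -/
def Extendable (p q : ℤ) (wall : ℤ → Prop) (e : ℤ → ℝ) (L : ℕ) (c s : ℝ) : Prop :=
  ∀ (m : ℤ) (d g : ℕ), 1 ≤ d → d < L → g = 19 * d / 10 + 1 →
    (∀ y, m - g ≤ y → y < m + d + g → y ∈ Finset.Ico p q) →
    (∀ y, m - g ≤ y → y < m + d + g → wall y → y ∈ hull (m, d)) →
    (∃ x ∈ hull (m, d), wall x) →
    ∃ N : ℤ × ℕ, m - g ≤ N.1 ∧ N.1 ≤ m ∧ m + d ≤ N.1 + N.2 ∧ N.1 + N.2 ≤ m + d + g ∧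
      d < N.2 ∧ N.2 ≤ 5 * L ∧ c * (N.2 : ℝ) ^ s ≤ ∑ x ∈ hull N, e x

/-- A shortest cluster is inspected. Either something lies within `1.9` times its length on one
side, giving `absorb` or `merge`, or both gaps are free of walls and the extension hypothesis
enlarges it. Minimality supplies the order of lengths needed for merging. -/
lemma exists_potential_lt (h : IsClustering p q wall e L c s H 𝒞) (hc : 0 < c) (hs0 : 0 < s)
    (hs1 : s ≤ 1) (hs : (3.9 : ℝ) ^ s ≤ 2) (he : ∀ x, 0 ≤ e x)
    (hext : Extendable p q wall e L c s) (hne : 𝒞.Nonempty) :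
    ∃ H' 𝒞', IsClustering p q wall e L c s H' 𝒞' ∧ potential L 𝒞' < potential L 𝒞 := by
  classical
  obtain ⟨C, hC, hmin⟩ := Finset.exists_min_image 𝒞 (fun C => C.2) hne
  obtain ⟨m, d⟩ := C
  simp only at hmin
  have hd1 : 1 ≤ d := h.pos _ hC
  have hdL : d < L := h.lt _ hC
  -- The division is in `ℕ`, so `i < g` means exactly `i ≤ 1.9 d`.
  set g := 19 * d / 10 + 1 with hg
  have hmH : ∀ y, m ≤ y → y < m + d → y ∈ hull (m, d) := fun y h1 h2 => mem_hull.2 ⟨h1, h2⟩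
  by_cases hR : ∃ i : ℕ, i < g ∧ (m + d + i ∈ H ∨ m + d + i ∉ Finset.Ico p q ∨
      ∃ C' ∈ 𝒞, m + d + i ∈ hull C')
  -- The nearest obstacle is taken, so that everything between it and the cluster is free.
  · obtain ⟨hig, hi⟩ := Nat.find_spec hR
    have hfree := fun k => Nat.find_min hR (m := k)
    set i := Nat.find hR with hidef
    have hfree' : ∀ y, m + d ≤ y → y < m + d + i →
        y ∈ Finset.Ico p q ∧ y ∉ H ∧ ∀ C' ∈ 𝒞, y ∉ hull C' := by
      intro y h1 h2
      obtain ⟨k, rfl⟩ : ∃ k : ℕ, y = m + d + k := ⟨(y - (m + d)).toNat, by omega⟩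
      have := hfree k (by omega)
      push Not at this
      have := this (by omega)
      exact ⟨this.2.1, this.1, this.2.2⟩
    by_cases hi' : m + d + i ∈ H ∨ m + d + i ∉ Finset.Ico p q
    · refine h.absorb hc hs1 he hC (N := (m, d + i)) ?_ ?_ ?_ ⟨m + d + i, ?_, hi'⟩
      · intro x; simp only [mem_hull]; push_cast; omega
      · intro x hx
        simp only [mem_hull] at hx ⊢
        push_cast at hx
        by_cases h1 : x < m + d
        · left; omega
        · right; simpa only [mem_hull] using hfree' x (by omega) (by omega)
      · simp only; omega
      · right; push_cast; ring
    · obtain ⟨⟨m', d'⟩, hC', hx⟩ : ∃ C' ∈ 𝒞, m + d + i ∈ hull C' := by tauto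
      have hdd : d ≤ d' := hmin _ hC'
      have hx2 := mem_hull.1 hx
      simp only at hx2
      have hne' : (m, d) ≠ (m', d') := by
        intro heq
        rw [← heq, mem_hull] at hx
        simp only at hx; omega
      have hm' : m' = m + d + i := by
        by_contra hcon
        by_cases h1 : m' < m + d
        · exact hne' (h.pairwise _ hC _ hC' (m + d - 1) (hmH _ (by omega) (by omega))
            (mem_hull.2 ⟨by simp only; omega, by simp only; omega⟩))
        · exact (hfree' m' (by omega) (by omega)).2.2 _ hC' (mem_hull.2 ⟨le_rfl, by simp only; omega⟩)
      refine h.merge hc hs0 hs1 hs he hC hC' hne' hdd (N := (m, d + i + d')) ?_ ?_ ?_ ?_ ?_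
      · intro x; simp only [mem_hull]; push_cast; omega
      · intro x; simp only [mem_hull]; push_cast; omega
      · intro x hx
        simp only [mem_hull] at hx ⊢
        push_cast at hx
        by_cases h1 : x < m + d
        · left; omega
        by_cases h2 : m' ≤ x
        · right; left; omega
        · right; right; simpa only [mem_hull] using hfree' x (by omega) (by omega)
      · simp only; omega
      · simp only; omega
  by_cases hL : ∃ i : ℕ, i < g ∧ (m - 1 - i ∈ H ∨ m - 1 - i ∉ Finset.Ico p q ∨
      ∃ C' ∈ 𝒞, m - 1 - i ∈ hull C')
  · obtain ⟨hig, hi⟩ := Nat.find_spec hL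
    have hfree := fun k => Nat.find_min hL (m := k)
    set i := Nat.find hL with hidef
    have hfree' : ∀ y, m - 1 - i < y → y < m →
        y ∈ Finset.Ico p q ∧ y ∉ H ∧ ∀ C' ∈ 𝒞, y ∉ hull C' := by
      intro y h1 h2
      obtain ⟨k, rfl⟩ : ∃ k : ℕ, y = m - 1 - k := ⟨(m - 1 - y).toNat, by omega⟩
      have := hfree k (by omega)
      push Not at this
      have := this (by omega)
      exact ⟨this.2.1, this.1, this.2.2⟩
    by_cases hi' : m - 1 - i ∈ H ∨ m - 1 - i ∉ Finset.Ico p q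
    · refine h.absorb hc hs1 he hC (N := (m - i, d + i)) ?_ ?_ ?_ ⟨m - 1 - i, ?_, hi'⟩
      · intro x; simp only [mem_hull]; push_cast; omega
      · intro x hx
        simp only [mem_hull] at hx ⊢
        push_cast at hx
        by_cases h1 : m ≤ x
        · left; omega
        · right; simpa only [mem_hull] using hfree' x (by omega) (by omega)
      · simp only; omega
      · left; simp only; ring
    · obtain ⟨⟨m', d'⟩, hC', hx⟩ : ∃ C' ∈ 𝒞, m - 1 - i ∈ hull C' := by tauto
      have hdd : d ≤ d' := hmin _ hC'
      have hx2 := mem_hull.1 hx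
      simp only at hx2
      have hne' : (m, d) ≠ (m', d') := by
        intro heq
        rw [← heq, mem_hull] at hx
        simp only at hx; omega
      have hm' : m' + d' = m - i := by
        by_contra hcon
        by_cases h1 : m < m' + d'
        · exact hne' (h.pairwise _ hC _ hC' m (hmH _ (by omega) (by omega))
            (mem_hull.2 ⟨by simp only; omega, by simp only; omega⟩))
        · exact (hfree' (m' + d' - 1) (by omega) (by omega)).2.2 _ hC'
            (mem_hull.2 ⟨by simp only; omega, by simp only; omega⟩)
      refine h.merge hc hs0 hs1 hs he hC hC' hne' hdd (N := (m', d' + i + d)) ?_ ?_ ?_ ?_ ?_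
      · intro x; simp only [mem_hull]; push_cast; omega
      · intro x; simp only [mem_hull]; push_cast; omega
      · intro x hx
        simp only [mem_hull] at hx ⊢
        push_cast at hx
        by_cases h1 : m ≤ x
        · left; omega
        by_cases h2 : x < m' + d'
        · right; left; omega
        · right; right; simpa only [mem_hull] using hfree' x (by omega) (by omega)
      · simp only; omega
      · simp only; omega
  push Not at hR hL
  have hfree : ∀ y, m - g ≤ y → y < m + d + g → y ∉ hull (m, d) →
      y ∉ H ∧ y ∈ Finset.Ico p q ∧ ∀ C' ∈ 𝒞, y ∉ hull C' := by
    intro y h1 h2 h3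
    simp only [mem_hull] at h3
    by_cases h4 : y < m
    · obtain ⟨k, rfl⟩ : ∃ k : ℕ, y = m - 1 - k := ⟨(m - 1 - y).toNat, by omega⟩
      exact hL k (by omega)
    · obtain ⟨k, rfl⟩ : ∃ k : ℕ, y = m + d + k := ⟨(y - (m + d)).toNat, by omega⟩
      exact hR k (by omega)
  have hin : ∀ y, m - g ≤ y → y < m + d + g → y ∈ Finset.Ico p q := by
    intro y h1 h2
    by_cases h3 : y ∈ hull (m, d)
    · exact h.sub_right _ hC h3
    · exact (hfree y h1 h2 h3).2.1
  obtain ⟨N, h1, h2, h3, h4, h5, h6, h7⟩ := hext m d g hd1 hdL hg hin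
    (by
      intro y h1 h2 hw
      by_contra h3
      obtain ⟨h4, h5, h6⟩ := hfree y h1 h2 h3
      rcases h.cover y h5 hw with h7 | ⟨C', hC', h7⟩
      · exact h4 h7
      · exact h6 C' hC' h7) (h.exists_wall _ hC)
  have hCN : hull (m, d) ⊆ hull N := by intro x; simp only [mem_hull]; omega
  have hNsub : ∀ x ∈ hull N, x ∈ hull (m, d) ∨
      (x ∉ H ∧ x ∈ Finset.Ico p q ∧ ∀ C' ∈ 𝒞, x ∉ hull C') := by
    intro x hx
    rw [mem_hull] at hx
    by_cases h8 : x ∈ hull (m, d)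
    · exact Or.inl h8
    · exact Or.inr (hfree x (by omega) (by omega) h8)
  refine h.replace hc hs0 hs1 (N := N) ?_ ?_ ?_ h7 h6 hC hCN h5
  · intro x hx
    rw [mem_hull] at hx
    exact hin x (by omega) (by omega)
  · intro x hx
    rcases hNsub x hx with h8 | h8
    · exact h.disj _ hC x h8
    · exact h8.1
  · intro C' hC'
    by_cases hCC : C' = (m, d)
    · exact Or.inl (hCC ▸ hCN)
    · right
      intro x hx hxN
      rcases hNsub x hxN with h8 | h8
      · exact hCC (h.pairwise _ hC' _ hC x hx h8)
      · exact h8.2.2 C' hC' hx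

/-- Starting from the singletons at the walls, the potential decreases until no short cluster is
left. Singletons are short because `2 ≤ L`. -/
lemma exists_empty (hc : 0 < c) (hs0 : 0 < s) (hs1 : s ≤ 1) (hs : (3.9 : ℝ) ^ s ≤ 2)
    (he : ∀ x, 0 ≤ e x) (hext : Extendable p q wall e L c s) (hL : 2 ≤ L)
    (hwall : ∀ x ∈ Finset.Ico p q, wall x → c ≤ e x) :
    ∃ H, IsClustering p q wall e L c s H ∅ := by
  classical
  have main : ∀ (n : ℕ) (H : Finset ℤ) (𝒞 : Finset (ℤ × ℕ)), potential L 𝒞 = n →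
      IsClustering p q wall e L c s H 𝒞 → ∃ H, IsClustering p q wall e L c s H ∅ := by
    intro n
    induction n using Nat.strong_induction_on with
    | _ n ih =>
      intro H 𝒞 hn h
      rcases 𝒞.eq_empty_or_nonempty with rfl | hne
      · exact ⟨H, h⟩
      · obtain ⟨H', 𝒞', h', hlt⟩ := h.exists_potential_lt hc hs0 hs1 hs he hext hne
        exact ih _ (hn ▸ hlt) H' 𝒞' rfl h'
  have hhull : ∀ x y : ℤ, y ∈ hull (x, 1) ↔ y = x := by
    intro x y; rw [mem_hull]; push_cast; omega
  refine main _ ∅ (((Finset.Ico p q).filter wall).image fun x => (x, 1)) rfl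
    ⟨by simp, ?_, by simp, ?_, ?_, ?_, ?_, ?_, ?_, by simp, by simp⟩
  all_goals simp only [Finset.mem_image, Finset.mem_filter, forall_exists_index, and_imp]
  · rintro C x hx _ rfl y hy
    rw [hhull] at hy
    exact hy ▸ hx
  · rintro C x _ _ rfl C' x' _ _ rfl y hy hy'
    rw [hhull] at hy hy'
    rw [← hy, ← hy']
  · intro x hx hw
    exact Or.inr ⟨(x, 1), ⟨x, ⟨hx, hw⟩, rfl⟩, (hhull x x).2 rfl⟩
  · rintro C x _ _ rfl; exact le_rfl
  · rintro C x _ _ rfl; exact hL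
  · rintro C x _ hw rfl
    exact ⟨x, (hhull x x).2 rfl, hw⟩
  · rintro C x hx hw rfl
    have : hull (x, 1) = {x} := by ext y; rw [hhull, Finset.mem_singleton]
    rw [this]
    simpa using hwall x hx hw

end IsClustering

/-! ### Inequalities between the exponents -/

section Parameters

variable {α : ℝ}

lemma delta_pos (hα₂ : α < 3 / 2) : 0 < delta α :=
  lt_min (by norm_num) (by linarith)

lemma delta_le (α : ℝ) : delta α ≤ 0.001 := min_le_left _ _

lemma theta_le (α : ℝ) : theta α ≤ 2 - α - 10 * delta α := min_le_left _ _

lemma rpow_theta_le (α : ℝ) : (3.9 : ℝ) ^ theta α ≤ 2 := by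
  calc (3.9 : ℝ) ^ theta α ≤ (3.9 : ℝ) ^ Real.logb 3.9 2 :=
        Real.rpow_le_rpow_of_exponent_le (by norm_num) (min_le_right _ _)
    _ = 2 := Real.rpow_logb (by norm_num) (by norm_num) (by norm_num)

/-- The margin on which the chaining runs; it is where `α < 3/2` enters. For the logarithmic branch
of `θ`, `(1 + 18δ)/2 ≤ 0.509 < 28/55`, and `28/55 ≤ log_{3.9} 2` because `3.9^28 ≤ 2^55`. -/
lemma one_add_delta_le_theta (hα₂ : α < 3 / 2) : 1 + 18 * delta α ≤ 2 * theta α := by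
  have h1 : delta α ≤ (1.5 - α) / 20 := min_le_right _ _
  have h2 := delta_le α
  have h3 : (28 / 55 : ℝ) ≤ Real.logb 3.9 2 := by
    rw [Real.le_logb_iff_rpow_le (by norm_num) (by norm_num)]
    have h4 : ((3.9 : ℝ) ^ (28 / 55 : ℝ)) ^ (55 : ℕ) ≤ (2 : ℝ) ^ (55 : ℕ) := by
      rw [← Real.rpow_natCast, ← Real.rpow_mul (by norm_num),
        show (28 / 55 : ℝ) * ((55 : ℕ) : ℝ) = ((28 : ℕ) : ℝ) by norm_num, Real.rpow_natCast]
      norm_num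
    exact le_of_pow_le_pow_left₀ (by norm_num) (by norm_num) h4
  have h5 : (1 + 18 * delta α) / 2 ≤ theta α := by
    apply le_min <;> linarith
  linarith

lemma theta_pos (hα₂ : α < 3 / 2) : 0 < theta α := by
  linarith [one_add_delta_le_theta hα₂, delta_pos hα₂]

lemma theta_le_one (hα₁ : 1 < α) (hα₂ : α < 3 / 2) : theta α ≤ 1 := by
  linarith [theta_le α, delta_pos hα₂]

lemma scaleM_mono {M₀ : ℝ} (hα₂ : α < 3 / 2) (hM : 0 < M₀) {i j : ℕ} (h : i ≤ j) :
    scaleM α M₀ i ≤ scaleM α M₀ j := by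
  unfold scaleM
  have := delta_pos hα₂
  have h' : (i : ℝ) ≤ j := by exact_mod_cast h
  gcongr
  norm_num

lemma le_scaleM {M₀ : ℝ} (hα₂ : α < 3 / 2) (hM : 0 < M₀) (j : ℕ) : M₀ ≤ scaleM α M₀ j := by
  have := scaleM_mono hα₂ hM (Nat.zero_le j)
  simpa [scaleM] using this

end Parameters

/-! ### Geometry of the intervals of a given scale -/

section Intervals

lemma mem_ellInterval {ℓ : ℕ} {x y : ℤ} : y ∈ ellInterval ℓ x ↔
    (2 : ℝ) ^ ℓ / 16 * x - 2 ^ ℓ / 2 ≤ y ∧ (y : ℝ) < 2 ^ ℓ / 16 * x + 2 ^ ℓ / 2 := by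
  have h1 : (2 : ℝ) ^ ((ℓ : ℤ) - 4) = 2 ^ ℓ / 16 := by
    rw [zpow_sub₀ (by norm_num)]; norm_num
  have h2 : (2 : ℝ) ^ ((ℓ : ℤ) - 1) = 2 ^ ℓ / 2 := by
    rw [zpow_sub₀ (by norm_num)]; norm_num
  unfold ellInterval
  rw [← h1, ← h2]
  rfl

lemma exists_ellInterval_eq (ℓ : ℕ) (x : ℤ) : ∃ a : ℤ, ellInterval ℓ x = Set.Ico a (a + 2 ^ ℓ) := by
  refine ⟨⌈(2 : ℝ) ^ ℓ / 16 * x - 2 ^ ℓ / 2⌉, ?_⟩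
  ext y
  rw [mem_ellInterval, Set.mem_Ico, Int.ceil_le, ← sub_lt_iff_lt_add (a := y), Int.lt_ceil]
  push_cast
  constructor <;> rintro ⟨h1, h2⟩ <;> exact ⟨h1, by linarith⟩

/-- Left end points of intervals of scale `j` form the grid `2^(j-4) ℤ`, which is no restriction on
integers when `j < 4`. A shift of the index by 16 is a shift by one full length. -/
lemma exists_ellInterval_shift (j : ℕ) (a : ℤ) (ha : 4 ≤ j → (2 : ℤ) ^ (j - 4) ∣ a) :
    ∃ x : ℤ, ∀ k : ℤ, ellInterval j (x + 16 * k) =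
      Set.Ico (a + k * 2 ^ j) (a + k * 2 ^ j + 2 ^ j) := by
  obtain ⟨x, hx⟩ : ∃ x : ℤ, (2 : ℝ) ^ j / 16 * x - 2 ^ j / 2 = a := by
    by_cases hj : 4 ≤ j
    · obtain ⟨b, rfl⟩ := ha hj
      obtain ⟨i, rfl⟩ : ∃ i, j = i + 4 := ⟨j - 4, by omega⟩
      refine ⟨b + 8, ?_⟩
      simp only [Nat.add_sub_cancel]
      push_cast
      ring
    · refine ⟨a * 2 ^ (4 - j) + 8, ?_⟩
      have : j = 0 ∨ j = 1 ∨ j = 2 ∨ j = 3 := by omega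
      rcases this with rfl | rfl | rfl | rfl <;> push_cast <;> ring
  refine ⟨x, fun k => ?_⟩
  ext y
  rw [mem_ellInterval, Set.mem_Ico]
  have h1 : (2 : ℝ) ^ j / 16 * ((x + 16 * k : ℤ) : ℝ) - 2 ^ j / 2 = ((a + k * 2 ^ j : ℤ) : ℝ) := by
    push_cast; rw [← hx]; ring
  have h2 : (2 : ℝ) ^ j / 16 * ((x + 16 * k : ℤ) : ℝ) + 2 ^ j / 2 =
      ((a + k * 2 ^ j + 2 ^ j : ℤ) : ℝ) := by
    push_cast; rw [← hx]; ring
  rw [h1, h2, Int.cast_le, Int.cast_lt]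

lemma sub_le_infDist_Ico {a b y : ℤ} (hab : a < b) :
    ((a - y : ℤ) : ℝ) ≤ Metric.infDist y (Set.Ico a b) := by
  rw [Metric.le_infDist (Set.nonempty_Ico.2 hab)]
  intro z hz
  rw [Int.dist_eq, ← Int.cast_sub, ← Int.cast_abs, Int.cast_le, abs_sub_comm]
  exact (sub_le_sub_right hz.1 y).trans (le_abs_self _)

lemma sub_le_infDist_Ico' {a b y : ℤ} (hab : a < b) :
    ((y - b + 1 : ℤ) : ℝ) ≤ Metric.infDist y (Set.Ico a b) := by
  rw [Metric.le_infDist (Set.nonempty_Ico.2 hab)]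
  intro z hz
  rw [Int.dist_eq, ← Int.cast_sub, ← Int.cast_abs, Int.cast_le]
  have := hz.2
  exact (by omega : y - b + 1 ≤ y - z).trans (le_abs_self _)

lemma ncard_Ico_add (a : ℤ) (d : ℕ) : (Set.Ico a (a + d)).ncard = d := by
  rw [← Finset.coe_Ico, Set.ncard_coe_finset]; simp

/-- A power of two and a grid point locating a cluster with wide gaps inside a window. -/
lemma exists_window (m : ℤ) (d g : ℕ) (hd : 1 ≤ d) (hg : g = 19 * d / 10 + 1) :
    ∃ (i : ℕ) (a : ℤ), (4 ≤ i + 1 → (2 : ℤ) ^ (i + 1 - 4) ∣ a) ∧ 30 * 2 ^ i < 32 * d ∧ d ≤ 2 * 2 ^ i ∧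
      a ≤ m ∧ m + d ≤ a + 2 * 2 ^ i ∧ m - g ≤ a - 2 ^ i ∧ a + 3 * 2 ^ i ≤ m + d + g := by
  -- The least such `i` gives `15/16 * 2^i < d ≤ 15/8 * 2^i`. The upper bound leaves room `2^i / 8`,
  -- one grid step, to slide a window of length `2 * 2^i` over the cluster; the lower bound makes
  -- the gaps, about `1.9 d`, contain a margin `2^i` on both sides.
  have hex : ∃ i : ℕ, 16 * d ≤ 30 * 2 ^ i :=
    ⟨d, by have := (Nat.lt_two_pow_self (n := d)); omega⟩
  classical
  set i := Nat.find hex with hi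
  have h1 : 16 * d ≤ 30 * 2 ^ i := Nat.find_spec hex
  have h2 : 30 * 2 ^ i < 32 * d := by
    rcases Nat.eq_zero_or_pos i with h0 | h0
    · rw [h0]; omega
    · obtain ⟨k, hk⟩ : ∃ k, i = k + 1 := ⟨i - 1, by omega⟩
      have := Nat.find_min hex (m := k) (by omega)
      rw [hk, pow_succ]; omega
  refine ⟨i, ?_⟩
  by_cases h3 : 3 ≤ i
  · obtain ⟨k, hk⟩ : ∃ k, i = k + 3 := ⟨i - 3, by omega⟩
    rw [hk] at h1 h2 ⊢
    have h4 : (2 : ℕ) ^ (k + 3) = 8 * 2 ^ k := by ring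
    have h5 : (2 : ℤ) ^ (k + 3) = 8 * ((2 ^ k : ℕ) : ℤ) := by push_cast; ring
    rw [h4] at h1 h2 ⊢
    rw [h5]
    have hq : 0 < 2 ^ k := by positivity
    have h6 : (2 : ℤ) ^ (k + 3 + 1 - 4) = ((2 ^ k : ℕ) : ℤ) := by
      rw [show k + 3 + 1 - 4 = k by omega]; push_cast; rfl
    rw [h6]
    generalize 2 ^ k = r at *
    -- The largest admissible left end point, with `2^i = 8 r`; it is then rounded down to the grid
    -- `r ℤ`.
    set hi := min m (m + d + g - 24 * r)
    have h7 := Int.emod_add_mul_ediv hi r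
    have h8 := Int.emod_nonneg hi (by omega : (r : ℤ) ≠ 0)
    have h9 := Int.emod_lt_of_pos hi (by omega : (0 : ℤ) < r)
    refine ⟨r * (hi / r), fun _ => Dvd.intro _ rfl, h2, by omega, ?_⟩
    set b := (r : ℤ) * (hi / r)
    omega
  · have : i = 0 ∨ i = 1 ∨ i = 2 := by omega
    refine ⟨max (m + d - 2 * 2 ^ i) (m - g + 2 ^ i), fun h => ?_, h2, by omega, ?_⟩
    · omega
    · clear_value i
      rcases this with rfl | rfl | rfl <;> norm_num at * <;> omega

end Intervals

/-! ### Energy forced by balancedness -/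

lemma coupling_nonneg (α : ℝ) (x y : ℤ) : 0 ≤ coupling α x y := by
  unfold coupling; split_ifs <;> positivity

/-- The interaction of the site `z` with the sites of `I` with a different spin. -/
def siteEnergy (α : ℝ) (I : Finset ℤ) (σ : Config) (z : ℤ) : ℝ :=
  ∑ y ∈ I.filter (fun y => σ y ≠ σ z), coupling α z y

lemma siteEnergy_nonneg (α : ℝ) (I : Finset ℤ) (σ : Config) (z : ℤ) : 0 ≤ siteEnergy α I σ z :=
  Finset.sum_nonneg fun _ _ => coupling_nonneg _ _ _

/-- A site is a wall if one of its neighbours has a different spin. -/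
def IsWall (σ : Config) (z : ℤ) : Prop := σ z ≠ σ (z - 1) ∨ σ z ≠ σ (z + 1)

lemma one_le_siteEnergy (α : ℝ) {I : Finset ℤ} {σ : Config} {z : ℤ} (h1 : z - 1 ∈ I)
    (h2 : z + 1 ∈ I) (hw : IsWall σ z) : 1 ≤ siteEnergy α I σ z := by
  rcases hw with hw | hw
  · refine le_trans (le_of_eq ?_) (Finset.single_le_sum (f := fun y => coupling α z y)
      (fun y _ => coupling_nonneg _ _ _) (Finset.mem_filter.2 ⟨h1, hw.symm⟩))
    rw [coupling, if_neg (by omega)]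
    simp
  · refine le_trans (le_of_eq ?_) (Finset.single_le_sum (f := fun y => coupling α z y)
      (fun y _ => coupling_nonneg _ _ _) (Finset.mem_filter.2 ⟨h2, hw.symm⟩))
    simp [coupling]

lemma le_sum_siteEnergy {α : ℝ} (hα : 0 ≤ α) {I S R : Finset ℤ} {σ : Config} (hR : R ⊆ I) {s : ℤˣ}
    (hS : ∀ z ∈ S, σ z = s) (hRs : ∀ y ∈ R, σ y ≠ s) {D : ℝ}
    (hSR : ∀ z ∈ S, ∀ y ∈ R, |(z : ℝ) - y| ≤ D) :
    S.card * (R.card * D ^ (-α)) ≤ ∑ z ∈ S, siteEnergy α I σ z := by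
  rw [← nsmul_eq_mul]
  refine Finset.card_nsmul_le_sum _ _ _ fun z hz => ?_
  have hsub : R ⊆ I.filter (fun y => σ y ≠ σ z) := fun y hy =>
    Finset.mem_filter.2 ⟨hR hy, by rw [hS z hz]; exact hRs y hy⟩
  refine le_trans ?_ (Finset.sum_le_sum_of_subset_of_nonneg hsub fun y _ _ => coupling_nonneg α z y)
  rw [← nsmul_eq_mul]
  refine Finset.card_nsmul_le_sum _ _ _ fun y hy => ?_
  have hne : z ≠ y := by
    rintro rfl; exact hRs z hy (hS z hz)
  have hpos : 0 < |(z : ℝ) - y| := abs_pos.2 (sub_ne_zero.2 (by exact_mod_cast hne))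
  rw [coupling, if_neg hne, one_div, ← Real.rpow_neg hpos.le]
  exact Real.rpow_le_rpow_of_nonpos hpos (hSR z hz y hy) (by linarith)

lemma spin_const_of_not_isWall {σ : Config} {u v : ℤ} (h : ∀ y, u ≤ y → y < v → ¬ IsWall σ y) :
    ∀ y, u ≤ y → y < v → σ y = σ u := by
  intro y hy
  induction y, hy using Int.leInduction with
  | base => intro _; rfl
  | succ y hy ih =>
    intro hv
    have h1 := h y hy (by omega)
    unfold IsWall at h1
    push Not at h1
    rw [← h1.2]
    exact ih (by omega)

lemma isolated_of_favored {α M₀ : ℝ} {s : ℤˣ} {σ : Config} {j : ℕ} {x : ℤ}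
    (h : Favored α M₀ s σ j x) {y : ℤ} (hy : y ∈ ellInterval j x) (hne : σ y ≠ s) :
    Isolated α M₀ σ j x := by
  rcases Int.units_eq_one_or s with rfl | rfl
  · exact Or.inl ⟨h, y, hy, Int.units_ne_iff_eq_neg.1 hne⟩
  · exact Or.inr ⟨h, y, hy, by simpa using Int.units_ne_iff_eq_neg.1 hne⟩

lemma le_card_of_not_spinDense {α M₀ : ℝ} {s : ℤˣ} {σ : Config} {j : ℕ} {x b : ℤ}
    (hI : ellInterval j x = Set.Ico b (b + 2 ^ j)) (h : ¬ SpinDense α M₀ s σ j x) :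
    (2 : ℝ) ^ j / scaleM α M₀ j ≤
      (((Finset.Ico b (b + 2 ^ j)).filter fun y => σ y ≠ s).card : ℝ) := by
  unfold SpinDense at h
  rw [not_lt, hI] at h
  have h1 : (Set.Ico b (b + 2 ^ j)).ncard = 2 ^ j := by
    have := ncard_Ico_add b (2 ^ j)
    exact_mod_cast this
  have h2 : spinSites s (Set.Ico b (b + 2 ^ j)) σ =
      ((Finset.Ico b (b + 2 ^ j)).filter fun y => σ y = s : Finset ℤ) := by
    ext y
    rw [Finset.coe_filter]
    simp only [Finset.mem_Ico]
    rfl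
  rw [h1, h2, Set.ncard_coe_finset] at h
  have h3 := Finset.card_filter_add_card_filter_not (s := Finset.Ico b (b + 2 ^ j))
    (p := fun y => σ y = s)
  have h4 : (Finset.Ico b (b + 2 ^ j)).card = 2 ^ j := by
    rw [Int.card_Ico]
    have : b + 2 ^ j - b = ((2 ^ j : ℕ) : ℤ) := by push_cast; ring
    rw [this, Int.toNat_natCast]
  rw [h4] at h3
  have h5 : ((((Finset.Ico b (b + 2 ^ j)).filter fun y => σ y = s).card : ℝ) +
      ((Finset.Ico b (b + 2 ^ j)).filter fun y => ¬ σ y = s).card) = 2 ^ j := by exact_mod_cast h3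
  push_cast at h
  rw [div_le_iff₀ (by positivity)] at h
  have h6 : (1 - 1 / scaleM α M₀ j) * 2 ^ j = 2 ^ j - 2 ^ j / scaleM α M₀ j := by ring
  rw [h6] at h
  simp only [ne_eq]
  linarith

/-- The density of energy at the windows of scale `j`. -/
def energyConst (α M₀ : ℝ) : ℝ := 1 / 16 * M₀ ^ (-(1 + α))

lemma energyConst_pos (α : ℝ) {M₀ : ℝ} (hM : 0 < M₀) : 0 < energyConst α M₀ := by
  unfold energyConst; positivity

lemma energyConst_le {α M₀ : ℝ} (hα₁ : 1 < α) (hM : 1 ≤ M₀) : energyConst α M₀ ≤ 1 / 16 := by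
  unfold energyConst
  have := Real.rpow_le_one_of_one_le_of_nonpos hM (by linarith : -(1 + α) ≤ 0)
  linarith

/-- The loss `M_{i+1}^(-(1+α))` costs only a power `δ (1 + α)` of the length, which the term `10 δ`
in `θ` covers. -/
lemma energyConst_mul_le {α M₀ : ℝ} (hα₁ : 1 < α) (hα₂ : α < 3 / 2) (hM : 1 ≤ M₀) {i : ℕ} :
    energyConst α M₀ * (4 * 2 ^ i : ℝ) ^ theta α ≤
      1 / 16 * ((4 * 2 ^ i : ℝ) ^ (2 - α) * scaleM α M₀ (i + 1) ^ (-(1 + α))) := by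
  have hδ := delta_pos hα₂
  have hX : (1 : ℝ) ≤ 4 * 2 ^ i := by
    have : (1 : ℝ) ≤ 2 ^ i := one_le_pow₀ (by norm_num)
    linarith
  set X : ℝ := 4 * 2 ^ i with hXdef
  have hX0 : 0 < X := by linarith
  have hM0 : 0 < M₀ := by linarith
  have h1 : scaleM α M₀ (i + 1) ≤ M₀ * X ^ delta α := by
    unfold scaleM
    refine mul_le_mul_of_nonneg_left ?_ hM0.le
    rw [mul_comm, Real.rpow_mul (by norm_num), Real.rpow_natCast]
    refine Real.rpow_le_rpow (by positivity) ?_ hδ.le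
    rw [hXdef, pow_succ]
    have : (0 : ℝ) < 2 ^ i := by positivity
    linarith
  have hs0 : 0 < scaleM α M₀ (i + 1) := hM0.trans_le (le_scaleM hα₂ hM0 _)
  have h2 : (M₀ * X ^ delta α) ^ (-(1 + α)) ≤ scaleM α M₀ (i + 1) ^ (-(1 + α)) :=
    Real.rpow_le_rpow_of_nonpos hs0 h1 (by linarith)
  rw [Real.mul_rpow hM0.le (by positivity), ← Real.rpow_mul hX0.le] at h2
  unfold energyConst
  rw [mul_assoc]
  refine mul_le_mul_of_nonneg_left ?_ (by norm_num)
  have h3 : X ^ theta α ≤ X ^ (2 - α) * X ^ (delta α * -(1 + α)) := by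
    rw [← Real.rpow_add hX0]
    refine Real.rpow_le_rpow_of_exponent_le hX ?_
    have := theta_le α
    nlinarith
  calc M₀ ^ (-(1 + α)) * X ^ theta α
      ≤ M₀ ^ (-(1 + α)) * (X ^ (2 - α) * X ^ (delta α * -(1 + α))) := by gcongr
    _ = X ^ (2 - α) * (M₀ ^ (-(1 + α)) * X ^ (delta α * -(1 + α))) := by ring
    _ ≤ _ := by gcongr

lemma scaleM_mul_mono {α M₀ : ℝ} (hα₂ : α < 3 / 2) (hM : 0 < M₀) {i j : ℕ} (h : i ≤ j) :
    scaleM α M₀ i * 2 ^ i ≤ scaleM α M₀ j * 2 ^ j := by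
  have h1 := scaleM_mono hα₂ hM h
  have h2 : (2 : ℝ) ^ i ≤ 2 ^ j := pow_le_pow_right₀ (by norm_num) h
  have h3 : 0 < scaleM α M₀ j := hM.trans_le (le_scaleM hα₂ hM _)
  gcongr

lemma expansion_subset_Ico {α M₀ : ℝ} {j : ℕ} {x a a' b : ℤ}
    (hI : ellInterval j x = Set.Ico a' (a' + 2 ^ j)) {K : ℤ}
    (hK : scaleM α M₀ j * 2 ^ j ≤ K) (h1 : a + K ≤ a') (h2 : a' + 2 ^ j + K ≤ b) :
    expansion (scaleM α M₀ j) (ellInterval j x) ⊆ Set.Ico a b := by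
  intro y hy
  have hlt : a' < a' + 2 ^ j := by
    have : (0 : ℤ) < 2 ^ j := by positivity
    omega
  have hn : (Set.Ico a' (a' + 2 ^ j)).ncard = 2 ^ j := by
    have := ncard_Ico_add a' (2 ^ j)
    exact_mod_cast this
  rw [hI] at hy
  have hy' : Metric.infDist y (Set.Ico a' (a' + 2 ^ j)) ≤ (scaleM α M₀ j - 1) *
    ((Set.Ico a' (a' + 2 ^ j)).ncard : ℝ) := hy
  rw [hn] at hy'
  push_cast at hy'
  have h2j : (0 : ℝ) < 2 ^ j := by positivity
  have hlt' : Metric.infDist y (Set.Ico a' (a' + 2 ^ j)) < K := by linarith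
  rw [Set.mem_Ico]
  constructor
  · by_contra hcon
    have := (sub_le_infDist_Ico (y := y) hlt).trans_lt hlt'
    rw [Int.cast_lt] at this
    omega
  · by_contra hcon
    have := (sub_le_infDist_Ico' (y := y) hlt).trans_lt hlt'
    rw [Int.cast_lt] at this
    omega

/-- Windows around clusters of a balanced configuration carry energy. -/
lemma extendable {α M₀ : ℝ} (hα₁ : 1 < α) (hα₂ : α < 3 / 2) (hM : 2 < M₀) {σ : Config} {a b : ℤ}
    (hbal : Balanced α M₀ σ (Set.Ico a b)) {ℓ : ℕ} {K : ℤ}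
    (hK : scaleM α M₀ (ℓ + 1) * 2 ^ (ℓ + 1) ≤ K) :
    IsClustering.Extendable (a + K) (b - K) (IsWall σ) (siteEnergy α (Finset.Ico a b) σ) (2 ^ ℓ)
      (energyConst α M₀) (theta α) := by
  intro m d g hd1 hdL hg hin hwall hexw
  obtain ⟨i, a', hdvd, hi1, hi2, ha1, ha2, ha3, ha4⟩ := exists_window m d g hd1 hg
  obtain ⟨x, hx⟩ := exists_ellInterval_shift (i + 1) a' hdvd
  have hM0 : 0 < M₀ := by linarith
  have hα0 : 0 ≤ α := by linarith
  have hcast : (2 : ℤ) ^ i = ((2 ^ i : ℕ) : ℤ) := by push_cast; rfl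
  have hiℓ : i ≤ ℓ := by
    have : 2 ^ i < 2 ^ (ℓ + 1) := by rw [pow_succ]; omega
    have := (Nat.pow_lt_pow_iff_right (by norm_num : 1 < 2)).1 this
    omega
  have hKi : scaleM α M₀ (i + 1) * 2 ^ (i + 1) ≤ K :=
    (scaleM_mul_mono hα₂ hM0 (by omega)).trans hK
  set M := scaleM α M₀ (i + 1) with hMdef
  have hMM : M₀ ≤ M := le_scaleM hα₂ hM0 _
  set h : ℕ := 2 ^ i with hh
  have hh1 : 1 ≤ h := Nat.one_le_two_pow
  have hhR : (2 : ℝ) ^ i = h := by rw [hh]; push_cast; rfl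
  have hh1R : (1 : ℝ) ≤ h := by exact_mod_cast hh1
  have hpow : (2 : ℤ) ^ (i + 1) = 2 * h := by rw [hh]; push_cast; ring
  have hpowR : (2 : ℝ) ^ (i + 1) = 2 * h := by rw [hh]; push_cast; ring
  rw [hcast] at ha2 ha3 ha4
  rw [hpow] at hx
  rw [hpowR] at hKi
  have hx0 : ellInterval (i + 1) x = Set.Ico a' (a' + 2 * h) := by simpa using hx 0
  have hin1 := hin (a' - h) (by omega) (by omega)
  have hin2 := hin (a' + 3 * h - 1) (by omega) (by omega)
  rw [Finset.mem_Ico] at hin1 hin2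
  refine ⟨(a' - h, 4 * h), ?_, ?_, ?_, ?_, ?_, ?_, ?_⟩
  · simpa using ha3
  · simp only; omega
  · push_cast; omega
  · push_cast; omega
  · simp only; omega
  · simp only; omega
  set e := siteEnergy α (Finset.Ico a b) σ with he
  set S := Finset.Ico (a' - h) a' with hS
  have hScard : S.card = h := by simp [hS]
  have hSsub : S ⊆ hull (a' - h, 4 * h) := by
    intro y hy
    rw [hS, Finset.mem_Ico] at hy
    rw [mem_hull]; push_cast; omega
  -- All the energy is collected from the left margin `S`, on which the spin is constant because it
  -- contains no wall. Each of its `h` sites sees many opposite spins: in the right margin if the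
  -- margins disagree, in a non-dense neighbouring interval if they agree.
  have hcases : 1 / 16 * ((4 * h : ℝ) ^ (2 - α) * M ^ (-(1 + α))) ≤ ∑ z ∈ S, e z := by
    have hl : ∀ y, a' - h ≤ y → y < a' → σ y = σ (a' - h) := by
      refine spin_const_of_not_isWall fun y h1 h2 hw => ?_
      have := hwall y (by omega) (by omega) hw
      rw [mem_hull] at this; simp only at this; omega
    have hr : ∀ y, a' + 2 * h ≤ y → y < a' + 3 * h → σ y = σ (a' + 2 * h) := by
      refine spin_const_of_not_isWall fun y h1 h2 hw => ?_
      have := hwall y (by omega) (by omega) hw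
      rw [mem_hull] at this; simp only at this; omega
    set s := σ (a' - h) with hsdef
    have hS' : ∀ z ∈ S, σ z = s := by
      intro z hz
      rw [hS, Finset.mem_Ico] at hz
      exact hl z hz.1 hz.2
    have hX0 : (0 : ℝ) < 4 * h := by linarith
    have hX : (4 * h : ℝ) ^ (2 - α) = (4 * h) ^ 2 * (4 * h : ℝ) ^ (-α) := by
      rw [show 2 - α = (2 : ℕ) + -α by push_cast; ring, Real.rpow_add hX0, Real.rpow_natCast]
    by_cases hsr : σ (a' + 2 * h) = s
    · -- equal spins on both sides
      have hnotiso : ¬ Isolated α M₀ σ (i + 1) x := by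
        refine hbal (i + 1) x (expansion_subset_Ico (K := K) (by rw [hx0, hpow]) ?_ ?_ ?_)
        · rw [hpowR]; exact hKi
        · omega
        · rw [hpow]; omega
      -- If the whole window had the spin of its margins, the cluster would contain no wall.
      have hy : ∃ y ∈ ellInterval (i + 1) x, σ y ≠ s := by
        by_contra hcon
        push Not at hcon
        rw [hx0] at hcon
        have hall : ∀ y, a' - h ≤ y → y < a' + 3 * h → σ y = s := by
          intro y h1 h2
          by_cases h3 : y < a'
          · exact hl y h1 h3
          by_cases h4 : y < a' + 2 * h
          · exact hcon y ⟨by omega, h4⟩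
          · rw [hr y (by omega) h2, hsr]
        obtain ⟨w, hw, hww⟩ := hexw
        rw [mem_hull] at hw
        simp only at hw
        rcases hww with hww | hww
        · exact hww (by rw [hall w (by omega) (by omega), hall (w - 1) (by omega) (by omega)])
        · exact hww (by rw [hall w (by omega) (by omega), hall (w + 1) (by omega) (by omega)])
      obtain ⟨y, hy, hys⟩ := hy
      have hnf : ¬ Favored α M₀ s σ (i + 1) x := fun hf => hnotiso (isolated_of_favored hf hy hys)
      have hfirst : ∀ y : ℤ, 1 ≤ Metric.infDist y (ellInterval (i + 1) x) →
          Metric.infDist y (ellInterval (i + 1) x) ≤ (2 : ℝ) ^ (((i + 1 : ℕ) : ℤ) - 1) →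
          σ y = s := by
        intro y h1 h2
        have hz : (2 : ℝ) ^ (((i + 1 : ℕ) : ℤ) - 1) = ((h : ℤ) : ℝ) := by
          rw [show ((i + 1 : ℕ) : ℤ) - 1 = (i : ℤ) by push_cast; ring, zpow_natCast, hhR]
          norm_cast
        rw [hz] at h2
        rw [hx0] at h1 h2
        have hlt : a' < a' + 2 * h := by omega
        have h3 := (sub_le_infDist_Ico (y := y) hlt).trans h2
        have h4 := (sub_le_infDist_Ico' (y := y) hlt).trans h2
        rw [Int.cast_le] at h3 h4
        by_cases h5 : y < a'
        · exact hl y (by omega) h5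
        by_cases h6 : y < a' + 2 * h
        · rw [Metric.infDist_zero_of_mem (Set.mem_Ico.2 ⟨by omega, h6⟩)] at h1
          norm_num at h1
        · rw [hr y (by omega) (by omega), hsr]
      -- The interval contains an opposite spin and its margins are as required, so the only way not
      -- to be isolated is a non-dense interval among the nearby ones. It holds at least `2h / M`
      -- opposite spins, all within distance `4 h M` of `S`.
      obtain ⟨k, hk, hnd⟩ : ∃ k : ℤ, |(k : ℝ)| ≤ M ∧ ¬ SpinDense α M₀ s σ (i + 1) (x + 16 * k) := by
        by_contra hcon
        push Not at hcon
        refine hnf ⟨hfirst, fun k _ hkM => ⟨hcon k ?_, ?_⟩⟩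
        · simpa using hkM
        · have := hcon (-(k : ℤ)) (by simpa using hkM)
          rwa [mul_neg, ← sub_eq_add_neg] at this
      have hR := le_card_of_not_spinDense (by rw [hx k, hpow]) hnd
      rw [hpow, hpowR] at hR
      set R := (Finset.Ico (a' + k * (2 * h)) (a' + k * (2 * h) + 2 * h)).filter fun y => σ y ≠ s
        with hRdef
      have hkK : |k| * (2 * h) ≤ K := by
        have h1 : (|(k : ℝ)|) * (2 * h) ≤ K :=
          (mul_le_mul_of_nonneg_right hk (by positivity)).trans hKi
        exact_mod_cast h1
      have hkK1 : k * (2 * h) ≤ K :=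
        (mul_le_mul_of_nonneg_right (le_abs_self k) (by positivity)).trans hkK
      have hkK2 : -(k * (2 * h)) ≤ K := by
        rw [← neg_mul]
        exact (mul_le_mul_of_nonneg_right (neg_le_abs k) (by positivity)).trans hkK
      have hRsub : R ⊆ Finset.Ico a b := by
        intro y hy
        have := (Finset.mem_filter.1 hy).1
        rw [Finset.mem_Ico] at this ⊢
        constructor <;> omega
      have hdist : ∀ z ∈ S, ∀ y ∈ R, |(z : ℝ) - y| ≤ 4 * h * M := by
        intro z hz y hy
        have hy' := (Finset.mem_filter.1 hy).1
        rw [hS, Finset.mem_Ico] at hz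
        rw [Finset.mem_Ico] at hy'
        have hz1 : ((a' : ℝ) - h) ≤ z := by exact_mod_cast hz.1
        have hz2 : (z : ℝ) < a' := by exact_mod_cast hz.2
        have hy1 : ((a' : ℝ) + k * (2 * h)) ≤ y := by exact_mod_cast hy'.1
        have hy2 : (y : ℝ) < a' + k * (2 * h) + 2 * h := by exact_mod_cast hy'.2
        have hk' := abs_le.1 hk
        have hk1 : (k : ℝ) * (2 * h) ≤ M * (2 * h) :=
          mul_le_mul_of_nonneg_right hk'.2 (by positivity)
        have hk2 : -M * (2 * h) ≤ (k : ℝ) * (2 * h) :=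
          mul_le_mul_of_nonneg_right hk'.1 (by positivity)
        have hMh : 2 * (h : ℝ) ≤ M * h := by nlinarith
        rw [abs_le]
        constructor <;> nlinarith
      have := le_sum_siteEnergy hα0 hRsub hS' (fun y hy => (Finset.mem_filter.1 hy).2) hdist
      refine le_trans ?_ this
      rw [hScard, hX, Real.mul_rpow hX0.le (by linarith)]
      have hMpos : 0 < M := by linarith
      have hMexp : M ^ (-(1 + α)) = M⁻¹ * M ^ (-α) := by
        rw [show -(1 + α) = (-1 : ℝ) + -α by ring, Real.rpow_add hMpos, Real.rpow_neg_one]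
      rw [hMexp]
      have h1 : (0 : ℝ) ≤ (4 * h : ℝ) ^ (-α) * M ^ (-α) := by positivity
      calc 1 / 16 * ((4 * (h : ℝ)) ^ 2 * (4 * h : ℝ) ^ (-α) * (M⁻¹ * M ^ (-α)))
          = h * ((h / M) * ((4 * h : ℝ) ^ (-α) * M ^ (-α))) := by field_simp; ring
        _ ≤ h * (R.card * ((4 * h : ℝ) ^ (-α) * M ^ (-α))) := by
            refine mul_le_mul_of_nonneg_left (mul_le_mul_of_nonneg_right ?_ h1) (by positivity)
            refine le_trans ?_ hR
            gcongr
            linarith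
    · -- opposite spins
      set R := Finset.Ico (a' + 2 * h) (a' + 3 * h) with hRdef
      have hRcard : R.card = h := by rw [hRdef, Int.card_Ico]; omega
      have hRsub : R ⊆ Finset.Ico a b := by
        have hK0 : 0 ≤ K := by
          have h1 : (0 : ℝ) ≤ M * (2 * h) := mul_nonneg (by linarith) (by positivity)
          exact_mod_cast h1.trans hKi
        intro y hy
        rw [Finset.mem_Ico] at hy ⊢
        omega
      have hRs : ∀ y ∈ R, σ y ≠ s := by
        intro y hy
        rw [Finset.mem_Ico] at hy
        rw [hr y hy.1 hy.2]
        exact hsr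
      have hdist : ∀ z ∈ S, ∀ y ∈ R, |(z : ℝ) - y| ≤ 4 * h := by
        intro z hz y hy
        rw [Finset.mem_Ico] at hz hy
        rw [← Int.cast_sub, ← Int.cast_abs]
        have : |z - y| ≤ 4 * h := by rw [abs_le]; omega
        exact_mod_cast this
      have := le_sum_siteEnergy hα0 hRsub hS' hRs hdist
      refine le_trans ?_ this
      rw [hScard, hRcard, hX]
      have h1 : M ^ (-(1 + α)) ≤ 1 :=
        Real.rpow_le_one_of_one_le_of_nonpos (by linarith) (by linarith)
      have h2 : (0 : ℝ) ≤ (h : ℝ) * (h * (4 * h : ℝ) ^ (-α)) := by positivity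
      calc 1 / 16 * ((4 * (h : ℝ)) ^ 2 * (4 * h : ℝ) ^ (-α) * M ^ (-(1 + α)))
          = ((h : ℝ) * (h * (4 * h : ℝ) ^ (-α))) * M ^ (-(1 + α)) := by ring
        _ ≤ _ := mul_le_of_le_one_right h2 h1
  have hfinal := energyConst_mul_le (i := i) hα₁ hα₂ (by linarith : 1 ≤ M₀)
  rw [hhR] at hfinal
  calc energyConst α M₀ * (((4 * h : ℕ) : ℝ)) ^ theta α
      = energyConst α M₀ * (4 * h : ℝ) ^ theta α := by push_cast; rfl
    _ ≤ _ := hfinal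
    _ ≤ _ := hcases
    _ ≤ _ := Finset.sum_le_sum_of_subset_of_nonneg hSsub fun y _ _ => siteEnergy_nonneg _ _ _ _

/-! ### Interaction energy and the number of mixed blocks -/

lemma summable_coupling {α : ℝ} (hα : 1 < α) (x : ℤ) : Summable fun y => coupling α x y := by
  have h1 : Summable fun y : ℤ => |((x - y : ℤ) : ℝ)| ^ (-α) :=
    (Equiv.subLeft x).summable_iff.2 (Real.summable_abs_int_rpow hα)
  refine Summable.of_nonneg_of_le (fun y => coupling_nonneg α x y) (fun y => ?_) h1
  unfold coupling
  split_ifs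
  · positivity
  · rw [Real.rpow_neg (abs_nonneg _), one_div]
    push_cast
    exact le_rfl

lemma sum_coupling_le_interaction {α : ℝ} (hα : 1 < α) (A R : Finset ℤ) (hAR : Disjoint A R) :
    ∑ z ∈ A, ∑ y ∈ R, coupling α z y ≤ interaction α A (A : Set ℤ)ᶜ := by
  have hsum : Summable fun p : ↥(A : Set ℤ) × ↥((A : Set ℤ)ᶜ) => coupling α p.1 p.2 := by
    refine (summable_prod_of_nonneg
      (f := fun p : ↥(A : Set ℤ) × ↥((A : Set ℤ)ᶜ) => coupling α p.1 p.2)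
      fun p => coupling_nonneg α p.1 p.2).2 ?_
    exact ⟨fun x => (summable_coupling hα x).subtype _, Summable.of_finite⟩
  have hR : ∀ y ∈ R, y ∈ ((A : Set ℤ)ᶜ : Set ℤ) := fun y hy hyA =>
    Finset.disjoint_left.1 hAR hyA hy
  have h1 : ∑ z ∈ A, ∑ y ∈ R, coupling α z y = ∑ p ∈ (A.attach ×ˢ R.attach).map
      ⟨fun p => ((⟨p.1.1, p.1.2⟩, ⟨p.2.1, hR _ p.2.2⟩) : ↥(A : Set ℤ) × ↥((A : Set ℤ)ᶜ)),
        fun p q h => by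
          simp only [Prod.mk.injEq, Subtype.mk.injEq] at h
          exact Prod.ext (Subtype.ext h.1) (Subtype.ext h.2)⟩, coupling α p.1 p.2 := by
    rw [Finset.sum_map, Finset.sum_product, ← Finset.sum_attach]
    refine Finset.sum_congr rfl fun z _ => ?_
    rw [← Finset.sum_attach]
    rfl
  rw [h1]
  exact hsum.sum_le_tsum _ fun p _ => coupling_nonneg _ _ _

lemma interaction_nonneg (α : ℝ) (A B : Set ℤ) : 0 ≤ interaction α A B :=
  tsum_nonneg fun _ => coupling_nonneg _ _ _

lemma coupling_comm (α : ℝ) (x y : ℤ) : coupling α x y = coupling α y x := by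
  unfold coupling
  rw [abs_sub_comm]
  simp only [eq_comm]

/-- The minus sites of `σ` in `[a, a + 2 ^ n)`. -/
def minusSites (a : ℤ) (n : ℕ) (σ : Config) : Finset ℤ :=
  (Finset.Ico a (a + 2 ^ n)).filter fun y => σ y = -1

/-- Each pair of opposite spins inside the interval is counted from both ends, and the pairs leaving
the interval are dropped. -/
lemma sum_siteEnergy_le {α : ℝ} (hα : 1 < α) (a : ℤ) (n : ℕ) (σ : Config) :
    ∑ z ∈ Finset.Ico a (a + 2 ^ n), siteEnergy α (Finset.Ico a (a + 2 ^ n)) σ z ≤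
      2 * interaction α (minusSites a n σ) ((minusSites a n σ : Set ℤ))ᶜ := by
  set I := Finset.Ico a (a + 2 ^ n) with hI
  set A := minusSites a n σ with hA
  set R := I.filter fun y => ¬ σ y = -1 with hR
  have hdis : Disjoint A R := Finset.disjoint_filter_filter_not _ _ _
  have h1 : ∑ z ∈ I, siteEnergy α I σ z = ∑ z ∈ A, siteEnergy α I σ z + ∑ z ∈ R, siteEnergy α I σ z :=
    (Finset.sum_filter_add_sum_filter_not _ _ _).symm
  have h2 : ∑ z ∈ A, siteEnergy α I σ z = ∑ z ∈ A, ∑ y ∈ R, coupling α z y := by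
    refine Finset.sum_congr rfl fun z hz => ?_
    have hz' : σ z = -1 := (Finset.mem_filter.1 hz).2
    rw [siteEnergy, hz']
  have h3 : ∑ z ∈ R, siteEnergy α I σ z = ∑ z ∈ A, ∑ y ∈ R, coupling α z y := by
    rw [Finset.sum_comm]
    refine Finset.sum_congr rfl fun z hz => ?_
    have hz' : σ z = 1 := by
      have := Int.units_ne_iff_eq_neg.1 (Finset.mem_filter.1 hz).2
      simpa using this
    rw [siteEnergy, hz']
    have : (I.filter fun y => σ y ≠ 1) = A := by
      rw [hA, minusSites]
      refine Finset.filter_congr fun y _ => ?_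
      exact Int.units_ne_iff_eq_neg
    rw [this]
    exact Finset.sum_congr rfl fun y _ => coupling_comm _ _ _
  rw [h1, h2, h3, ← two_mul]
  exact mul_le_mul_of_nonneg_left (sum_coupling_le_interaction hα A R hdis) (by norm_num)

/-- The index of the dyadic block of scale `j`, counted from `a`, which contains `y`. -/
def blockIndex (a : ℤ) (j : ℕ) (y : ℤ) : ℤ := (y - a) / 2 ^ j

lemma blockIndex_eq_iff {a : ℤ} {j : ℕ} {y k : ℤ} :
    blockIndex a j y = k ↔ a + k * 2 ^ j ≤ y ∧ y < a + k * 2 ^ j + 2 ^ j := by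
  have h2 : (0 : ℤ) < 2 ^ j := by positivity
  unfold blockIndex
  rw [le_antisymm_iff, Int.le_ediv_iff_mul_le h2, ← Int.lt_add_one_iff, Int.ediv_lt_iff_lt_mul h2,
    add_mul, one_mul]
  constructor <;> rintro ⟨h3, h4⟩ <;> constructor <;> linarith

open Classical in
/-- The union of the blocks of scale `j` of `[a, a + 2 ^ n)` which are contained in `A`. -/
def lowerApprox (a : ℤ) (n j : ℕ) (A : Finset ℤ) : Finset ℤ :=
  (Finset.Ico a (a + 2 ^ n)).filter fun y =>
    ∀ y' ∈ Finset.Ico a (a + 2 ^ n), blockIndex a j y' = blockIndex a j y → y' ∈ A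

open Classical in
/-- The union of the blocks of scale `j` of `[a, a + 2 ^ n)` which meet `A`. -/
def upperApprox (a : ℤ) (n j : ℕ) (A : Finset ℤ) : Finset ℤ :=
  (Finset.Ico a (a + 2 ^ n)).filter fun y => ∃ y' ∈ A, blockIndex a j y' = blockIndex a j y

lemma mem_lowerApprox {a : ℤ} {n j : ℕ} {A : Finset ℤ} {y : ℤ} : y ∈ lowerApprox a n j A ↔
    y ∈ Finset.Ico a (a + 2 ^ n) ∧
      ∀ y' ∈ Finset.Ico a (a + 2 ^ n), blockIndex a j y' = blockIndex a j y → y' ∈ A := by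
  simp only [lowerApprox, Finset.mem_filter]

lemma mem_upperApprox {a : ℤ} {n j : ℕ} {A : Finset ℤ} {y : ℤ} : y ∈ upperApprox a n j A ↔
    y ∈ Finset.Ico a (a + 2 ^ n) ∧ ∃ y' ∈ A, blockIndex a j y' = blockIndex a j y := by
  simp only [upperApprox, Finset.mem_filter]

/-- The blocks of scale `j` which meet both `A` and its complement. -/
def mixedBlocks (a : ℤ) (n j : ℕ) (A : Finset ℤ) : Finset ℤ :=
  (upperApprox a n j A \ lowerApprox a n j A).image (blockIndex a j)

lemma mem_mixedBlocks {a : ℤ} {n j : ℕ} {A : Finset ℤ} (hA : A ⊆ Finset.Ico a (a + 2 ^ n)) {k : ℤ} :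
    k ∈ mixedBlocks a n j A ↔ (∃ y ∈ A, blockIndex a j y = k) ∧
      ∃ y ∈ Finset.Ico a (a + 2 ^ n), y ∉ A ∧ blockIndex a j y = k := by
  unfold mixedBlocks
  rw [Finset.mem_image]
  constructor
  · rintro ⟨y, hy, rfl⟩
    rw [Finset.mem_sdiff, mem_upperApprox, mem_lowerApprox] at hy
    obtain ⟨⟨hy1, y', hy', hb⟩, h2⟩ := hy
    push Not at h2
    obtain ⟨z, hz, hzb, hzA⟩ := h2 hy1
    exact ⟨⟨y', hy', hb⟩, z, hz, hzA, hzb⟩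
  · rintro ⟨⟨y, hy, rfl⟩, z, hz, hzA, hzb⟩
    refine ⟨y, ?_, rfl⟩
    rw [Finset.mem_sdiff, mem_upperApprox, mem_lowerApprox]
    exact ⟨⟨hA hy, y, hy, rfl⟩, fun h => hzA (h.2 z hz hzb)⟩

lemma minusSites_subset (a : ℤ) (n : ℕ) (σ : Config) :
    minusSites a n σ ⊆ Finset.Ico a (a + 2 ^ n) := Finset.filter_subset _ _

lemma exists_isWall_of_ne {σ : Config} {u v : ℤ} (huv : u ≤ v) (hne : σ v ≠ σ u) :
    ∃ w, u ≤ w ∧ w ≤ v ∧ IsWall σ w := by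
  by_contra hcon
  push Not at hcon
  exact hne (spin_const_of_not_isWall (v := v + 1) (fun y h1 h2 => hcon y h1 (by omega)) v huv
    (by omega))

lemma exists_isWall_of_mem_mixedBlocks {a : ℤ} {n j : ℕ} {σ : Config} {k : ℤ}
    (hk : k ∈ mixedBlocks a n j (minusSites a n σ)) :
    ∃ w, a + k * 2 ^ j ≤ w ∧ w < a + k * 2 ^ j + 2 ^ j ∧ IsWall σ w := by
  rw [mem_mixedBlocks (minusSites_subset a n σ)] at hk
  obtain ⟨⟨y, hy, hyk⟩, z, hz, hzA, hzk⟩ := hk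
  rw [blockIndex_eq_iff] at hyk hzk
  have hy1 : σ y = -1 := (Finset.mem_filter.1 hy).2
  have hz1 : σ z ≠ -1 := fun h => hzA (Finset.mem_filter.2 ⟨hz, h⟩)
  rcases le_total y z with h | h
  · obtain ⟨w, h1, h2, h3⟩ := exists_isWall_of_ne (σ := σ) h (by rw [hy1]; exact hz1)
    exact ⟨w, by omega, by omega, h3⟩
  · obtain ⟨w, h1, h2, h3⟩ := exists_isWall_of_ne (σ := σ) h (by rw [hy1]; exact hz1.symm)
    exact ⟨w, by omega, by omega, h3⟩

lemma bounds_of_mem_mixedBlocks {a : ℤ} {n j : ℕ} (hjn : j ≤ n) {A : Finset ℤ}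
    (hA : A ⊆ Finset.Ico a (a + 2 ^ n)) {k : ℤ} (hk : k ∈ mixedBlocks a n j A) :
    0 ≤ k * 2 ^ j ∧ k * 2 ^ j + 2 ^ j ≤ 2 ^ n := by
  rw [mem_mixedBlocks hA] at hk
  obtain ⟨⟨y, hy, hyk⟩, -⟩ := hk
  rw [blockIndex_eq_iff] at hyk
  have hy' := Finset.mem_Ico.1 (hA hy)
  have h2 : (0 : ℤ) < 2 ^ j := by positivity
  have h2n : (2 : ℤ) ^ n = 2 ^ (n - j) * 2 ^ j := by rw [← pow_add]; congr 1; omega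
  rw [h2n] at hy' ⊢
  have h3 : -1 < k := by
    by_contra hcon
    nlinarith
  have h4 : k < 2 ^ (n - j) := by
    by_contra hcon
    nlinarith
  constructor
  · exact mul_nonneg (by omega) h2.le
  · nlinarith

/-- A double count. A mixed block contains a wall, and by thickness `2^j` points of `H` or of the
boundary layers lie in this block and its two neighbours; each point is charged by at most three
blocks. -/
lemma card_mixedBlocks_mul_le {a : ℤ} {n j : ℕ} (hjn : j ≤ n) {σ : Config} {K : ℤ} (hK0 : 0 ≤ K)
    {e : ℤ → ℝ} {c s : ℝ} {H : Finset ℤ}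
    (hH : IsClustering (a + K) (a + 2 ^ n - K) (IsWall σ) e (2 ^ j) c s H ∅) :
    ((mixedBlocks a n j (minusSites a n σ)).card : ℤ) * 2 ^ j ≤ 3 * (H.card + 2 * (K + 2 ^ j)) := by
  classical
  set X := mixedBlocks a n j (minusSites a n σ) with hX
  have hL : (0 : ℤ) < 2 ^ j := by positivity
  set G := H ∪ (Finset.Ico (a - 2 ^ j) (a + K) ∪ Finset.Ico (a + 2 ^ n - K) (a + 2 ^ n + 2 ^ j))
    with hG
  have hGcard : (G.card : ℤ) ≤ H.card + 2 * (K + 2 ^ j) := by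
    have h1 := Finset.card_union_le H
      (Finset.Ico (a - 2 ^ j) (a + K) ∪ Finset.Ico (a + 2 ^ n - K) (a + 2 ^ n + 2 ^ j))
    have h2 := Finset.card_union_le (Finset.Ico (a - 2 ^ j) (a + K))
      (Finset.Ico (a + 2 ^ n - K) (a + 2 ^ n + 2 ^ j))
    rw [Int.card_Ico, Int.card_Ico] at h2
    change G.card ≤ _ at h1
    omega
  have hkey := Finset.card_mul_le_card_mul (s := X) (t := G)
    (fun k y => a + k * 2 ^ j - 2 ^ j ≤ y ∧ y < a + k * 2 ^ j + 2 * 2 ^ j) (m := 2 ^ j) (n := 3)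
    (by
      intro k hk
      obtain ⟨w, hw1, hw2, hw⟩ := exists_isWall_of_mem_mixedBlocks hk
      obtain ⟨hb1, hb2⟩ := bounds_of_mem_mixedBlocks hjn (minusSites_subset a n σ) hk
      have hwH : w ∈ H ∨ w ∉ Finset.Ico (a + K) (a + 2 ^ n - K) := by
        by_cases hwT : w ∈ Finset.Ico (a + K) (a + 2 ^ n - K)
        · rcases hH.cover w hwT hw with h1 | ⟨C, hC, -⟩
          · exact Or.inl h1
          · simp at hC
        · exact Or.inr hwT
      obtain ⟨u, v, h1, h2, h3, h4⟩ := hH.thick' hwH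
      push_cast at h3
      -- Cuts from the thick interval a piece of length exactly `2^j` that still contains `w`, so
      -- that it cannot leave the neighbouring blocks.
      set u' := max u (w - 2 ^ j + 1) with hu'
      have hcard : (Finset.Ico u' (u' + 2 ^ j)).card = 2 ^ j := by
        rw [Int.card_Ico]
        have : u' + 2 ^ j - u' = ((2 ^ j : ℕ) : ℤ) := by push_cast; ring
        rw [this, Int.toNat_natCast]
      rw [← hcard]
      refine Finset.card_le_card fun y hy => ?_
      rw [Finset.mem_Ico] at hy
      rw [Finset.mem_bipartiteAbove]
      refine ⟨?_, by omega, by omega⟩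
      rw [hG, Finset.mem_union, Finset.mem_union, Finset.mem_Ico, Finset.mem_Ico]
      rcases h4 y (by omega) (by omega) with h5 | h5
      · exact Or.inl h5
      · right
        rw [Finset.mem_Ico] at h5
        omega)
    (by
      intro y _
      have hsub : Finset.bipartiteBelow
          (fun k y => a + k * 2 ^ j - 2 ^ j ≤ y ∧ y < a + k * 2 ^ j + 2 * 2 ^ j) X y ⊆
          {blockIndex a j y - 1, blockIndex a j y, blockIndex a j y + 1} := by
        intro k hk
        rw [Finset.mem_bipartiteBelow] at hk
        obtain ⟨-, h1, h2⟩ := hk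
        simp only [Finset.mem_insert, Finset.mem_singleton]
        by_cases h3 : y < a + k * 2 ^ j
        · have : blockIndex a j y = k - 1 := by
            rw [blockIndex_eq_iff, sub_mul, one_mul]; omega
          omega
        by_cases h4 : y < a + k * 2 ^ j + 2 ^ j
        · have : blockIndex a j y = k := by
            rw [blockIndex_eq_iff]; omega
          omega
        · have : blockIndex a j y = k + 1 := by
            rw [blockIndex_eq_iff, add_mul, one_mul]; omega
          omega
      exact (Finset.card_le_card hsub).trans Finset.card_le_three)
  have hkey' : (X.card : ℤ) * 2 ^ j ≤ G.card * 3 := by exact_mod_cast hkey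
  linarith

/-- The constant in the bound for the number of mixed blocks. -/
def mixedConst (α M₀ : ℝ) : ℝ := 30 / energyConst α M₀ + 24 * M₀ + 12

/-- Clustering with `L = 2^j` bounds `|H|` by a multiple of `2^(j(1-θ)) J`, whence the term `J 2^(-θ
j)`. The term `2^(δ j)` comes from the layers of width about `M_{j+1} 2^(j+1)` at the ends of the
interval, where balancedness says nothing. -/
lemma card_mixedBlocks_le {α M₀ : ℝ} (hα₁ : 1 < α) (hα₂ : α < 3 / 2) (hM : 2 < M₀) {σ : Config}
    {a : ℤ} {n j : ℕ} (hbal : Balanced α M₀ σ (Set.Ico a (a + 2 ^ n))) (hj : 1 ≤ j) (hjn : j ≤ n) :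
    ((mixedBlocks a n j (minusSites a n σ)).card : ℝ) ≤ mixedConst α M₀ *
      (interaction α (minusSites a n σ) ((minusSites a n σ : Set ℤ))ᶜ *
        (2 : ℝ) ^ (-(theta α * j)) + (2 : ℝ) ^ (delta α * j)) := by
  have hM0 : 0 < M₀ := by linarith
  set K : ℤ := ⌈scaleM α M₀ (j + 1) * 2 ^ (j + 1)⌉ with hKdef
  set e := siteEnergy α (Finset.Ico a (a + 2 ^ n)) σ with he
  set c := energyConst α M₀ with hc
  have hc0 : 0 < c := energyConst_pos α hM0
  have hsc : 0 < scaleM α M₀ (j + 1) := hM0.trans_le (le_scaleM hα₂ hM0 _)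
  have hK1 : scaleM α M₀ (j + 1) * 2 ^ (j + 1) ≤ K := Int.le_ceil _
  have hK2 : (K : ℝ) ≤ scaleM α M₀ (j + 1) * 2 ^ (j + 1) + 1 := (Int.ceil_lt_add_one _).le
  have hK0 : 1 ≤ K := by
    have : (0 : ℝ) < K := lt_of_lt_of_le (by positivity) hK1
    exact_mod_cast this
  obtain ⟨H, hH⟩ := IsClustering.exists_empty (p := a + K) (q := a + 2 ^ n - K) (wall := IsWall σ)
    (e := e) (L := 2 ^ j) (c := c) (s := theta α) hc0 (theta_pos hα₂) (theta_le_one hα₁ hα₂)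
    (rpow_theta_le α) (fun x => siteEnergy_nonneg _ _ _ _)
    (extendable hα₁ hα₂ hM hbal hK1)
    (by calc 2 = 2 ^ 1 := rfl
          _ ≤ 2 ^ j := Nat.pow_le_pow_right (by norm_num) hj)
    (by
      intro x hx hw
      rw [Finset.mem_Ico] at hx
      have h1 : x - 1 ∈ Finset.Ico a (a + 2 ^ n) := by rw [Finset.mem_Ico]; omega
      have h2 : x + 1 ∈ Finset.Ico a (a + 2 ^ n) := by rw [Finset.mem_Ico]; omega
      linarith [one_le_siteEnergy α h1 h2 hw, energyConst_le hα₁ (by linarith : 1 ≤ M₀)])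
  have hcount := card_mixedBlocks_mul_le hjn (by omega) hH
  set X := ((mixedBlocks a n j (minusSites a n σ)).card : ℝ) with hX
  set J := interaction α (minusSites a n σ) ((minusSites a n σ : Set ℤ))ᶜ with hJ
  have hcount' : X * 2 ^ j ≤ 3 * ((H.card : ℝ) + 2 * ((K : ℝ) + 2 ^ j)) := by
    have := (Int.cast_le (R := ℝ)).2 hcount
    push_cast at this
    exact this
  have hJ0 : 0 ≤ J := interaction_nonneg _ _ _
  have hHe : ∑ x ∈ H, e x ≤ 2 * J := by
    refine (Finset.sum_le_sum_of_subset_of_nonneg ?_ fun x _ _ => siteEnergy_nonneg _ _ _ _).trans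
      (sum_siteEnergy_le hα₁ a n σ)
    intro x hx
    have := Finset.mem_Ico.1 (hH.sub_left hx)
    rw [Finset.mem_Ico]; omega
  have hHc := hH.card_le
  have hLs : (((2 ^ j : ℕ) : ℝ)) ^ (1 - theta α) = 2 ^ j * (2 : ℝ) ^ (-(theta α * j)) := by
    push_cast
    rw [← Real.rpow_natCast, ← Real.rpow_mul (by norm_num), ← Real.rpow_add (by norm_num)]
    congr 1; ring
  rw [hLs] at hHc
  set u : ℝ := (2 : ℝ) ^ (-(theta α * j)) with hu
  set v : ℝ := (2 : ℝ) ^ (delta α * j) with hv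
  set Lr : ℝ := 2 ^ j with hLr
  have hu0 : 0 < u := by positivity
  have hLr1 : 1 ≤ Lr := one_le_pow₀ (by norm_num)
  have hv1 : 1 ≤ v := Real.one_le_rpow (by norm_num) (mul_nonneg (delta_pos hα₂).le (by positivity))
  have hHcard : (H.card : ℝ) ≤ 10 / c * (Lr * u * J) := by
    rw [div_mul_eq_mul_div, le_div_iff₀ hc0]
    calc (H.card : ℝ) * c ≤ 5 * (Lr * u) * ∑ x ∈ H, e x := hHc
      _ ≤ 5 * (Lr * u) * (2 * J) := mul_le_mul_of_nonneg_left hHe (by positivity)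
      _ = _ := by ring
  have hKL : (K : ℝ) ≤ (4 * M₀ * v + 1) * Lr := by
    have h1 : scaleM α M₀ (j + 1) ≤ M₀ * (2 * v) := by
      unfold scaleM
      refine mul_le_mul_of_nonneg_left ?_ hM0.le
      push_cast
      rw [mul_add, Real.rpow_add (by norm_num), mul_comm, mul_one]
      refine mul_le_mul_of_nonneg_right ?_ (by positivity)
      calc (2 : ℝ) ^ delta α ≤ 2 ^ (1 : ℝ) :=
            Real.rpow_le_rpow_of_exponent_le (by norm_num) (by linarith [delta_le α])
        _ = 2 := Real.rpow_one _
    calc (K : ℝ) ≤ scaleM α M₀ (j + 1) * 2 ^ (j + 1) + 1 := hK2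
      _ = scaleM α M₀ (j + 1) * (2 * Lr) + 1 := by rw [hLr, pow_succ]; ring
      _ ≤ M₀ * (2 * v) * (2 * Lr) + Lr := by gcongr
      _ = _ := by ring
  have hfin : X * Lr ≤ (mixedConst α M₀ * (J * u + v)) * Lr := by
    have h1 : X * Lr ≤ (30 / c * (J * u) + 24 * M₀ * v + 12) * Lr := by
      calc X * Lr ≤ 3 * (H.card + 2 * (K + Lr)) := hcount'
        _ ≤ 3 * (10 / c * (Lr * u * J) + 2 * ((4 * M₀ * v + 1) * Lr + Lr)) := by gcongr
        _ = _ := by ring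
    refine h1.trans (mul_le_mul_of_nonneg_right ?_ (by linarith))
    unfold mixedConst
    have h2 : 0 ≤ 30 / c := by positivity
    have h3 : 0 ≤ J * u := by positivity
    have h4 : 0 ≤ 30 / c * v := by positivity
    have h5 : 0 ≤ 24 * M₀ * (J * u) := by positivity
    nlinarith
  exact le_of_mul_le_mul_right hfin (by linarith)

/-! ### Entropy of the multiscale approximations -/

section Entropy

variable {a : ℤ} {n j : ℕ} {A A' : Finset ℤ}

lemma blockIndex_succ (a : ℤ) (j : ℕ) (y : ℤ) : blockIndex a (j + 1) y = blockIndex a j y / 2 := by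
  unfold blockIndex
  rw [Int.ediv_ediv_of_nonneg (by positivity), pow_succ]

lemma blockIndex_succ_eq {y y' : ℤ} (h : blockIndex a j y = blockIndex a j y') :
    blockIndex a (j + 1) y = blockIndex a (j + 1) y' := by
  rw [blockIndex_succ, blockIndex_succ, h]

lemma lowerApprox_subset : lowerApprox a n j A ⊆ A := fun y hy =>
  (mem_lowerApprox.1 hy).2 y (mem_lowerApprox.1 hy).1 rfl

lemma lowerApprox_subset_Ico : lowerApprox a n j A ⊆ Finset.Ico a (a + 2 ^ n) := fun _ hy =>
  (mem_lowerApprox.1 hy).1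

lemma subset_upperApprox (hA : A ⊆ Finset.Ico a (a + 2 ^ n)) : A ⊆ upperApprox a n j A :=
  fun y hy => mem_upperApprox.2 ⟨hA hy, y, hy, rfl⟩

lemma lowerApprox_succ_subset : lowerApprox a n (j + 1) A ⊆ lowerApprox a n j A := by
  intro y hy
  rw [mem_lowerApprox] at hy ⊢
  exact ⟨hy.1, fun y' hy' h => hy.2 y' hy' (blockIndex_succ_eq h)⟩

lemma lowerApprox_zero (hA : A ⊆ Finset.Ico a (a + 2 ^ n)) : lowerApprox a n 0 A = A := by
  refine Finset.Subset.antisymm lowerApprox_subset fun y hy => ?_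
  rw [mem_lowerApprox]
  refine ⟨hA hy, fun y' _ h => ?_⟩
  have : y' = y := by simpa [blockIndex] using h
  exact this ▸ hy

/-- The inner and outer approximations of a set by blocks of scale `j`. -/
def approxPair (a : ℤ) (n j : ℕ) (A : Finset ℤ) : Finset ℤ × Finset ℤ :=
  (lowerApprox a n j A, upperApprox a n j A)

lemma mem_lowerApprox_succ {y : ℤ} : y ∈ lowerApprox a n (j + 1) A ↔
    y ∈ Finset.Ico a (a + 2 ^ n) ∧ ∀ y' ∈ Finset.Ico a (a + 2 ^ n),
      blockIndex a (j + 1) y' = blockIndex a (j + 1) y → y' ∈ lowerApprox a n j A := by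
  rw [mem_lowerApprox]
  refine and_congr_right fun _ => ⟨fun h y' hy' hb => ?_, fun h y' hy' hb =>
    lowerApprox_subset (h y' hy' hb)⟩
  rw [mem_lowerApprox]
  exact ⟨hy', fun z hz hzb => h z hz ((blockIndex_succ_eq hzb).trans hb)⟩

lemma mem_upperApprox_succ (hA : A ⊆ Finset.Ico a (a + 2 ^ n)) {y : ℤ} :
    y ∈ upperApprox a n (j + 1) A ↔ y ∈ Finset.Ico a (a + 2 ^ n) ∧
      ∃ y' ∈ upperApprox a n j A, blockIndex a (j + 1) y' = blockIndex a (j + 1) y := by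
  rw [mem_upperApprox]
  refine and_congr_right fun _ => ⟨?_, ?_⟩
  · rintro ⟨y', hy', hb⟩
    exact ⟨y', subset_upperApprox hA hy', hb⟩
  · rintro ⟨y', hy', hb⟩
    obtain ⟨-, z, hz, hzb⟩ := mem_upperApprox.1 hy'
    exact ⟨z, hz, (blockIndex_succ_eq hzb).trans hb⟩

/-- The coarser pair can be computed from the finer one, so agreement at one scale propagates
upwards. Both members of the pair are kept because together they determine the mixed blocks. -/
lemma approxPair_succ_eq (hA : A ⊆ Finset.Ico a (a + 2 ^ n)) (hA' : A' ⊆ Finset.Ico a (a + 2 ^ n))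
    (h : approxPair a n j A = approxPair a n j A') :
    approxPair a n (j + 1) A = approxPair a n (j + 1) A' := by
  have h1 : lowerApprox a n j A = lowerApprox a n j A' := congrArg Prod.fst h
  have h2 : upperApprox a n j A = upperApprox a n j A' := congrArg Prod.snd h
  refine Prod.ext ?_ ?_ <;> ext y <;> simp only [approxPair]
  · rw [mem_lowerApprox_succ, mem_lowerApprox_succ, h1]
  · rw [mem_upperApprox_succ hA, mem_upperApprox_succ hA', h2]

lemma mixedBlocks_eq_of_approxPair_eq (h : approxPair a n j A = approxPair a n j A') :
    mixedBlocks a n j A = mixedBlocks a n j A' := by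
  have h1 : lowerApprox a n j A = lowerApprox a n j A' := congrArg Prod.fst h
  have h2 : upperApprox a n j A = upperApprox a n j A' := congrArg Prod.snd h
  rw [mixedBlocks, h1, h2, mixedBlocks]

lemma approxPair_eq_of_le (hA : A ⊆ Finset.Ico a (a + 2 ^ n))
    (hA' : A' ⊆ Finset.Ico a (a + 2 ^ n)) (h : approxPair a n j A = approxPair a n j A') {i : ℕ}
    (hij : j ≤ i) : approxPair a n i A = approxPair a n i A' := by
  induction i, hij using Nat.le_induction with
  | base => exact h
  | succ i _ ih => exact approxPair_succ_eq hA hA' ih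

/-- The number of mixed blocks of scales above `j`. -/
def mixedSum (a : ℤ) (n j : ℕ) (A : Finset ℤ) : ℕ :=
  ∑ i ∈ Finset.Ioc j n, (mixedBlocks a n i A).card

lemma mixedSum_eq_add (hj : j < n) :
    mixedSum a n j A = (mixedBlocks a n (j + 1) A).card + mixedSum a n (j + 1) A := by
  unfold mixedSum
  rw [← Finset.insert_Ioc_add_one_left_eq_Ioc hj, Finset.sum_insert (by simp)]

lemma mixedSum_eq_of_approxPair_eq (hA : A ⊆ Finset.Ico a (a + 2 ^ n))
    (hA' : A' ⊆ Finset.Ico a (a + 2 ^ n)) (h : approxPair a n j A = approxPair a n j A') :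
    mixedSum a n j A = mixedSum a n j A' := by
  refine Finset.sum_congr rfl fun i hi => ?_
  rw [mixedBlocks_eq_of_approxPair_eq
    (approxPair_eq_of_le hA hA' h (Finset.mem_Ioc.1 hi).1.le)]

lemma card_lowerApprox_sdiff_le (hA : A ⊆ Finset.Ico a (a + 2 ^ n)) :
    (lowerApprox a n j A \ lowerApprox a n (j + 1) A).card ≤
      (mixedBlocks a n (j + 1) A).card * 2 ^ (j + 1) := by
  have hsub : lowerApprox a n j A \ lowerApprox a n (j + 1) A ⊆ (mixedBlocks a n (j + 1) A).biUnion
      fun k => Finset.Ico (a + k * 2 ^ (j + 1)) (a + k * 2 ^ (j + 1) + 2 ^ (j + 1)) := by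
    intro y hy
    rw [Finset.mem_sdiff] at hy
    rw [Finset.mem_biUnion]
    refine ⟨blockIndex a (j + 1) y, ?_, Finset.mem_Ico.2 (blockIndex_eq_iff.1 rfl)⟩
    exact Finset.mem_image_of_mem _ (Finset.mem_sdiff.2
      ⟨subset_upperApprox hA (lowerApprox_subset hy.1), hy.2⟩)
  refine (Finset.card_le_card hsub).trans (Finset.card_biUnion_le_card_mul _ _ _ fun k _ => ?_)
  rw [Int.card_Ico]
  have : a + k * 2 ^ (j + 1) + 2 ^ (j + 1) - (a + k * 2 ^ (j + 1)) = ((2 ^ (j + 1) : ℕ) : ℤ) := by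
    push_cast; ring
  rw [this, Int.toNat_natCast]

/-- Outside the mixed blocks of scale `j + 1` a block is full or empty, for `A` and `A'` alike.
Hence the pair at scale `j` is determined by its traces on `X`. -/
lemma subset_of_codes_eq (hA : A ⊆ Finset.Ico a (a + 2 ^ n)) (hA' : A' ⊆ Finset.Ico a (a + 2 ^ n))
    {A₀ : Finset ℤ}
    (h : approxPair a n (j + 1) A = approxPair a n (j + 1) A₀)
    (h' : approxPair a n (j + 1) A' = approxPair a n (j + 1) A₀)
    {X : Finset ℤ} (hX : X = (Finset.Ico a (a + 2 ^ n)).filter fun y =>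
      blockIndex a (j + 1) y ∈ mixedBlocks a n (j + 1) A₀)
    (h1 : (lowerApprox a n j A ∩ X).image (blockIndex a j) ⊆
      (lowerApprox a n j A' ∩ X).image (blockIndex a j))
    (h2 : (upperApprox a n j A ∩ X).image (blockIndex a j) ⊆
      (upperApprox a n j A' ∩ X).image (blockIndex a j)) :
    lowerApprox a n j A ⊆ lowerApprox a n j A' ∧ upperApprox a n j A ⊆ upperApprox a n j A' := by
  have hup : ∀ y ∈ upperApprox a n j A, y ∉ X → y ∈ lowerApprox a n j A' := by
    intro y hy hyX
    obtain ⟨hyI, z, hz, hzb⟩ := mem_upperApprox.1 hy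
    have hyU : y ∈ upperApprox a n (j + 1) A₀ := by
      rw [← show upperApprox a n (j + 1) A = upperApprox a n (j + 1) A₀ from congrArg Prod.snd h]
      exact mem_upperApprox.2 ⟨hyI, z, hz, blockIndex_succ_eq hzb⟩
    have hyL : y ∈ lowerApprox a n (j + 1) A₀ := by
      by_contra hcon
      refine hyX ?_
      rw [hX, Finset.mem_filter]
      exact ⟨hyI, Finset.mem_image_of_mem _ (Finset.mem_sdiff.2 ⟨hyU, hcon⟩)⟩
    rw [← show lowerApprox a n (j + 1) A' = lowerApprox a n (j + 1) A₀ from congrArg Prod.fst h']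
      at hyL
    exact lowerApprox_succ_subset hyL
  constructor
  · intro y hy
    have hyI := lowerApprox_subset_Ico hy
    by_cases hyX : y ∈ X
    · obtain ⟨z, hz, hzb⟩ := Finset.mem_image.1
        (h1 (Finset.mem_image_of_mem _ (Finset.mem_inter.2 ⟨hy, hyX⟩)))
      have hz' := mem_lowerApprox.1 (Finset.mem_inter.1 hz).1
      rw [mem_lowerApprox]
      exact ⟨hyI, fun y' hy' hb => hz'.2 y' hy' (hb.trans hzb.symm)⟩
    · exact hup y (subset_upperApprox hA (lowerApprox_subset hy)) hyX
  · intro y hy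
    by_cases hyX : y ∈ X
    · obtain ⟨z, hz, hzb⟩ := Finset.mem_image.1
        (h2 (Finset.mem_image_of_mem _ (Finset.mem_inter.2 ⟨hy, hyX⟩)))
      obtain ⟨-, w, hw, hwb⟩ := mem_upperApprox.1 (Finset.mem_inter.1 hz).1
      rw [mem_upperApprox]
      exact ⟨(mem_upperApprox.1 hy).1, w, hw, hwb.trans hzb⟩
    · exact subset_upperApprox hA' (lowerApprox_subset (hup y hy hyX))

/-- Each mixed block has two halves, and for each half one records whether it belongs to the inner
and to the outer approximation: `4² = 16` choices per mixed block. -/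
lemma card_fiber_le {𝒮 : Finset (Finset ℤ)} (h𝒮 : ∀ A ∈ 𝒮, A ⊆ Finset.Ico a (a + 2 ^ n))
    (hinj : Set.InjOn (approxPair a n j) 𝒮) {A₀ : Finset ℤ}
    (h : ∀ A ∈ 𝒮, approxPair a n (j + 1) A = approxPair a n (j + 1) A₀) :
    𝒮.card ≤ 16 ^ (mixedBlocks a n (j + 1) A₀).card := by
  set X := (Finset.Ico a (a + 2 ^ n)).filter fun y =>
      blockIndex a (j + 1) y ∈ mixedBlocks a n (j + 1) A₀ with hX
  set V := X.image (blockIndex a j) with hV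
  have hVcard : V.card ≤ (mixedBlocks a n (j + 1) A₀).card * 2 := by
    have hsub : V ⊆ (mixedBlocks a n (j + 1) A₀).biUnion fun k => {2 * k, 2 * k + 1} := by
      intro k hk
      obtain ⟨y, hy, rfl⟩ := Finset.mem_image.1 hk
      have hy' := (Finset.mem_filter.1 hy).2
      rw [Finset.mem_biUnion]
      refine ⟨_, hy', ?_⟩
      rw [blockIndex_succ]
      simp only [Finset.mem_insert, Finset.mem_singleton]
      omega
    exact (Finset.card_le_card hsub).trans
      (Finset.card_biUnion_le_card_mul _ _ _ fun k _ => Finset.card_le_two)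
  calc 𝒮.card ≤ (V.powerset ×ˢ V.powerset).card := by
        refine Finset.card_le_card_of_injOn (fun A => ((lowerApprox a n j A ∩ X).image (blockIndex a j),
          (upperApprox a n j A ∩ X).image (blockIndex a j))) ?_ ?_
        · intro A _
          rw [Finset.mem_coe, Finset.mem_product, Finset.mem_powerset, Finset.mem_powerset]
          exact ⟨Finset.image_subset_image Finset.inter_subset_right,
            Finset.image_subset_image Finset.inter_subset_right⟩
        · intro A hA A' hA' heq
          have h1 := congrArg Prod.fst heq
          have h2 := congrArg Prod.snd heq
          simp only at h1 h2
          obtain ⟨h3, h4⟩ := subset_of_codes_eq (h𝒮 A hA) (h𝒮 A' hA') (h A hA) (h A' hA') hX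
            h1.subset h2.subset
          obtain ⟨h5, h6⟩ := subset_of_codes_eq (h𝒮 A' hA') (h𝒮 A hA) (h A' hA') (h A hA) hX
            h1.superset h2.superset
          exact hinj hA hA' (Prod.ext (h3.antisymm h5) (h4.antisymm h6))
    _ = 4 ^ V.card := by
        rw [Finset.card_product, Finset.card_powerset, ← mul_pow]; norm_num
    _ ≤ 4 ^ ((mixedBlocks a n (j + 1) A₀).card * 2) := Nat.pow_le_pow_right (by norm_num) hVcard
    _ = 16 ^ (mixedBlocks a n (j + 1) A₀).card := by rw [mul_comm, pow_mul]; norm_num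

lemma blockIndex_top {y : ℤ} (hy : y ∈ Finset.Ico a (a + 2 ^ n)) : blockIndex a n y = 0 := by
  rw [Finset.mem_Ico] at hy
  rw [blockIndex_eq_iff, zero_mul, add_zero]
  exact hy

lemma card_le_four {𝒮 : Finset (Finset ℤ)} (hinj : Set.InjOn (approxPair a n n) 𝒮) :
    𝒮.card ≤ 4 := by
  set I := Finset.Ico a (a + 2 ^ n) with hI
  have hsat : ∀ B : Finset ℤ, B ⊆ I → (∀ y ∈ B, ∀ z ∈ I, z ∈ B) → B ∈ ({∅, I} : Finset (Finset ℤ)) := by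
    intro B hB hBs
    rw [Finset.mem_insert, Finset.mem_singleton]
    rcases B.eq_empty_or_nonempty with h | ⟨y, hy⟩
    · exact Or.inl h
    · exact Or.inr (hB.antisymm fun z hz => hBs y hy z hz)
  calc 𝒮.card ≤ (({∅, I} : Finset (Finset ℤ)) ×ˢ ({∅, I} : Finset (Finset ℤ))).card := by
        refine Finset.card_le_card_of_injOn (approxPair a n n) (fun A _ => ?_) hinj
        rw [Finset.mem_coe, Finset.mem_product]
        constructor
        · refine hsat _ lowerApprox_subset_Ico fun y hy z hz => ?_
          simp only [approxPair, mem_lowerApprox] at hy ⊢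
          exact ⟨hz, fun w hw _ => hy.2 w hw (by rw [blockIndex_top hw, blockIndex_top hy.1])⟩
        · refine hsat _ (fun y hy => (mem_upperApprox.1 hy).1) fun y hy z hz => ?_
          simp only [approxPair, mem_upperApprox] at hy ⊢
          obtain ⟨hyI, w, hw, hwb⟩ := hy
          exact ⟨hz, w, hw, by rw [hwb, blockIndex_top hyI, blockIndex_top hz]⟩
    _ ≤ 2 * 2 := by
        rw [Finset.card_product]
        exact Nat.mul_le_mul Finset.card_le_two Finset.card_le_two
    _ = 4 := rfl

/-- Kraft inequality for the approximations by blocks. -/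
lemma sum_pow_mixedSum_le (k : ℕ) : ∀ {j : ℕ}, j + k = n → ∀ {𝒮 : Finset (Finset ℤ)},
    (∀ A ∈ 𝒮, A ⊆ Finset.Ico a (a + 2 ^ n)) → Set.InjOn (approxPair a n j) 𝒮 →
    ∑ A ∈ 𝒮, (1 / 16 : ℝ) ^ mixedSum a n j A ≤ 4 := by
  classical
  induction k with
  | zero =>
    intro j hj 𝒮 _ hinj
    obtain rfl : j = n := by omega
    have h1 : ∀ A ∈ 𝒮, (1 / 16 : ℝ) ^ mixedSum a j j A = 1 := by
      intro A _
      simp [mixedSum]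
    rw [Finset.sum_congr rfl h1, Finset.sum_const, nsmul_eq_mul, mul_one]
    exact_mod_cast card_le_four hinj
  | succ k ih =>
    intro j hj 𝒮 h𝒮 hinj
    set T := approxPair a n (j + 1) with hT
    have hrep : ∀ τ ∈ 𝒮.image T, ∃ A ∈ 𝒮, T A = τ := fun τ hτ => Finset.mem_image.1 hτ
    choose! r hr𝒮 hrT using hrep
    rw [← Finset.sum_fiberwise_of_maps_to (t := 𝒮.image T) (g := T)
      (fun A hA => Finset.mem_image_of_mem _ hA)]
    -- The weight is constant on a fiber, and its factor for scale `j + 1` cancels the size of the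
    -- fiber. The representatives of the fibers are injective at scale `j + 1`, so the induction
    -- continues.
    have hfib : ∀ τ ∈ 𝒮.image T, ∑ A ∈ 𝒮 with T A = τ, (1 / 16 : ℝ) ^ mixedSum a n j A ≤
        (1 / 16 : ℝ) ^ mixedSum a n (j + 1) (r τ) := by
      intro τ hτ
      have hcard : (𝒮.filter fun A => T A = τ).card ≤
          16 ^ (mixedBlocks a n (j + 1) (r τ)).card := by
        refine card_fiber_le (fun A hA => h𝒮 A (Finset.mem_filter.1 hA).1)
          (hinj.mono fun A hA => (Finset.mem_filter.1 hA).1) fun A hA => ?_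
        rw [← hT, (Finset.mem_filter.1 hA).2, hrT τ hτ]
      have hconst : ∀ A ∈ 𝒮.filter fun A => T A = τ, (1 / 16 : ℝ) ^ mixedSum a n j A =
          (1 / 16 : ℝ) ^ (mixedBlocks a n (j + 1) (r τ)).card *
            (1 / 16 : ℝ) ^ mixedSum a n (j + 1) (r τ) := by
        intro A hA
        have hTA : T A = T (r τ) := by rw [(Finset.mem_filter.1 hA).2, hrT τ hτ]
        rw [← pow_add, mixedSum_eq_add (by omega), mixedBlocks_eq_of_approxPair_eq hTA,
          mixedSum_eq_of_approxPair_eq (h𝒮 A (Finset.mem_filter.1 hA).1) (h𝒮 _ (hr𝒮 τ hτ)) hTA]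
      rw [Finset.sum_congr rfl hconst, Finset.sum_const, nsmul_eq_mul, ← mul_assoc]
      refine mul_le_of_le_one_left (by positivity) ?_
      rw [one_div, inv_pow, ← div_eq_mul_inv, div_le_one (by positivity)]
      exact_mod_cast hcard
    refine (Finset.sum_le_sum hfib).trans ?_
    have hrinj : Set.InjOn r (𝒮.image T) := by
      intro τ hτ τ' hτ' h
      rw [← hrT τ hτ, ← hrT τ' hτ', h]
    rw [← Finset.sum_image (f := fun A => (1 / 16 : ℝ) ^ mixedSum a n (j + 1) A) hrinj]
    refine ih (by omega) ?_ ?_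
    · intro A hA
      obtain ⟨τ, hτ, rfl⟩ := Finset.mem_image.1 hA
      exact h𝒮 _ (hr𝒮 τ hτ)
    · intro A hA A' hA' h
      obtain ⟨τ, hτ, rfl⟩ := Finset.mem_image.1 hA
      obtain ⟨τ', hτ', rfl⟩ := Finset.mem_image.1 hA'
      rw [← hT, hrT τ hτ, hrT τ' hτ'] at h
      rw [h]

end Entropy

/-! ### Chaining: Gaussian tails against entropy -/

/-- The weights of the scales in the chaining argument. -/
def chainWeight (α : ℝ) (j : ℕ) : ℝ := (1 - (2 : ℝ) ^ (-(delta α / 2))) * ((2 : ℝ) ^ (-(delta α / 2))) ^ j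

lemma rpow_neg_delta_lt_one {α : ℝ} (hα₂ : α < 3 / 2) : (2 : ℝ) ^ (-(delta α / 2)) < 1 :=
  Real.rpow_lt_one_of_one_lt_of_neg (by norm_num) (by linarith [delta_pos hα₂])

lemma chainWeight_pos {α : ℝ} (hα₂ : α < 3 / 2) (j : ℕ) : 0 < chainWeight α j :=
  mul_pos (sub_pos.2 (rpow_neg_delta_lt_one hα₂)) (by positivity)

lemma sum_chainWeight_le {α : ℝ} (hα₂ : α < 3 / 2) (n : ℕ) :
    ∑ j ∈ Finset.range n, chainWeight α j ≤ 1 := by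
  unfold chainWeight
  have h := rpow_neg_delta_lt_one hα₂
  rw [← Finset.mul_sum, mul_comm, geom_sum_mul_neg]
  have : (0 : ℝ) ≤ ((2 : ℝ) ^ (-(delta α / 2))) ^ n := by positivity
  linarith

lemma chainWeight_sq (α : ℝ) (j : ℕ) :
    chainWeight α j ^ 2 = (1 - (2 : ℝ) ^ (-(delta α / 2))) ^ 2 * (2 : ℝ) ^ (-(delta α * j)) := by
  unfold chainWeight
  rw [mul_pow, ← pow_mul, ← Real.rpow_natCast _ (j * 2), ← Real.rpow_mul (by norm_num)]
  congr 2
  push_cast; ring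

lemma sum_mixed_le {α : ℝ} (hα₂ : α < 3 / 2) {C J : ℝ} (hC : 0 < C) (hJ : 0 ≤ J) {n j : ℕ}
    {ν : ℕ → ℝ} (hν : ∀ i, 1 ≤ i → i ≤ n →
      ν i ≤ C * (J * (2 : ℝ) ^ (-(theta α * i)) + (2 : ℝ) ^ (delta α * i))) :
    ∑ i ∈ Finset.Ioc j n, ν i ≤ C * (1 / (1 - (2 : ℝ) ^ (-theta α)) *
      (J * (2 : ℝ) ^ (-(theta α * j))) +
      (2 : ℝ) ^ delta α / ((2 : ℝ) ^ delta α - 1) * (2 : ℝ) ^ (delta α * n)) := by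
  set r : ℝ := (2 : ℝ) ^ (-theta α) with hr
  set R : ℝ := (2 : ℝ) ^ delta α with hR
  have hr0 : 0 < r := by positivity
  have hr1 : r < 1 := Real.rpow_lt_one_of_one_lt_of_neg (by norm_num) (by linarith [theta_pos hα₂])
  have hR1 : 1 < R := Real.one_lt_rpow (by norm_num) (delta_pos hα₂)
  have hri : ∀ i : ℕ, (2 : ℝ) ^ (-(theta α * i)) = r ^ i := by
    intro i
    rw [hr, ← Real.rpow_natCast, ← Real.rpow_mul (by norm_num)]
    congr 1; ring
  have hRi : ∀ i : ℕ, (2 : ℝ) ^ (delta α * i) = R ^ i := by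
    intro i
    rw [hR, ← Real.rpow_natCast, ← Real.rpow_mul (by norm_num)]
  have h1 : ∑ i ∈ Finset.Ioc j n, r ^ i ≤ 1 / (1 - r) * r ^ j := by
    have h2 : ∑ i ∈ Finset.Ioc j n, r ^ i ≤ ∑ i ∈ Finset.Ico j (n + 1), r ^ i := by
      refine Finset.sum_le_sum_of_subset_of_nonneg (fun i hi => ?_) fun i _ _ => by positivity
      rw [Finset.mem_Ioc] at hi
      rw [Finset.mem_Ico]; omega
    refine h2.trans ((geom_sum_Ico_le_of_lt_one hr0.le hr1).trans (le_of_eq ?_))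
    ring
  have h3 : ∑ i ∈ Finset.Ioc j n, R ^ i ≤ R / (R - 1) * R ^ n := by
    have h2 : ∑ i ∈ Finset.Ioc j n, R ^ i ≤ ∑ i ∈ Finset.range (n + 1), R ^ i := by
      refine Finset.sum_le_sum_of_subset_of_nonneg (fun i hi => ?_) fun i _ _ => by positivity
      rw [Finset.mem_Ioc] at hi
      rw [Finset.mem_range]; omega
    refine h2.trans ?_
    rw [geom_sum_eq hR1.ne', div_mul_eq_mul_div, ← pow_succ']
    gcongr
    linarith
  rw [hri, hRi]
  calc ∑ i ∈ Finset.Ioc j n, ν i ≤ ∑ i ∈ Finset.Ioc j n, C * (J * r ^ i + R ^ i) := by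
        refine Finset.sum_le_sum fun i hi => ?_
        rw [Finset.mem_Ioc] at hi
        rw [← hri, ← hRi]
        exact hν i (by omega) hi.2
    _ = C * (J * ∑ i ∈ Finset.Ioc j n, r ^ i + ∑ i ∈ Finset.Ioc j n, R ^ i) := by
        rw [← Finset.mul_sum, Finset.sum_add_distrib, ← Finset.mul_sum]
    _ ≤ C * (J * (1 / (1 - r) * r ^ j) + R / (R - 1) * R ^ n) := by gcongr
    _ = _ := by ring

/-- Bounds the size of an increment linearly in `J`. The first term uses `1 - θ ≤ θ - δ`; the second
is traded for `J` through `2^(θ n) ≤ J / c₂` and `j ≤ n`. -/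
lemma card_scale_le {δ θ c₂ C J : ℝ} {n j : ℕ} (hδ : 0 < δ) (hθδ : 1 + 18 * δ ≤ 2 * θ)
    (hδ1 : δ ≤ 0.001) (hc₂ : 0 < c₂) (hC : 0 < C) (hjn : j ≤ n)
    (hJ : c₂ * (2 : ℝ) ^ (θ * n) ≤ J) :
    C * (J * (2 : ℝ) ^ (-(θ * ((j + 1 : ℕ) : ℝ))) + (2 : ℝ) ^ (δ * ((j + 1 : ℕ) : ℝ))) *
      2 ^ (j + 1) ≤ 4 * C * (1 + 1 / c₂) * (J * (2 : ℝ) ^ ((θ - δ) * j)) := by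
  have hJ0 : 0 < J := lt_of_lt_of_le (by positivity) hJ
  have hjnR : (j : ℝ) ≤ n := by exact_mod_cast hjn
  have hj0 : (0 : ℝ) ≤ j := by positivity
  have h12 : (1 : ℝ) ≤ 2 := by norm_num
  have h02 : (0 : ℝ) < 2 := by norm_num
  have e1 : (2 : ℝ) ^ (-(θ * ((j + 1 : ℕ) : ℝ))) * 2 ^ (j + 1) ≤ 2 * (2 : ℝ) ^ ((θ - δ) * j) := by
    rw [pow_succ, ← Real.rpow_natCast 2 j, ← mul_assoc, ← Real.rpow_add h02, mul_comm]
    refine mul_le_mul_of_nonneg_left (Real.rpow_le_rpow_of_exponent_le h12 ?_) h02.le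
    push_cast
    nlinarith
  have e3 : (2 : ℝ) ^ (δ * ((j + 1 : ℕ) : ℝ)) * 2 ^ (j + 1) ≤
      4 * ((2 : ℝ) ^ (θ * n) * (2 : ℝ) ^ ((θ - δ) * j)) := by
    have e4 : (4 : ℝ) = (2 : ℝ) ^ (2 : ℝ) := by norm_num
    rw [← Real.rpow_natCast 2 (j + 1), ← Real.rpow_add h02, ← Real.rpow_add h02, e4,
      ← Real.rpow_add h02]
    refine Real.rpow_le_rpow_of_exponent_le h12 ?_
    push_cast
    nlinarith
  have e4 : (2 : ℝ) ^ (θ * n) ≤ 1 / c₂ * J := by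
    rw [one_div, ← div_eq_inv_mul, le_div_iff₀ hc₂]
    linarith
  set u : ℝ := (2 : ℝ) ^ ((θ - δ) * j)
  have hu : 0 < u := by positivity
  have e2 : (2 : ℝ) ^ (δ * ((j + 1 : ℕ) : ℝ)) * 2 ^ (j + 1) ≤ 4 * (1 / c₂ * J * u) :=
    e3.trans (mul_le_mul_of_nonneg_left (mul_le_mul_of_nonneg_right e4 hu.le) (by norm_num))
  have e5 : 0 < J * u := by positivity
  have e6 := mul_le_mul_of_nonneg_left e1 hJ0.le
  have e7 : J * ((2 : ℝ) ^ (-(θ * ((j + 1 : ℕ) : ℝ))) * 2 ^ (j + 1)) +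
      (2 : ℝ) ^ (δ * ((j + 1 : ℕ) : ℝ)) * 2 ^ (j + 1) ≤ 4 * (J * u) + 4 * (1 / c₂ * J * u) := by
    linarith
  calc _ = C * (J * ((2 : ℝ) ^ (-(θ * ((j + 1 : ℕ) : ℝ))) * 2 ^ (j + 1)) +
            (2 : ℝ) ^ (δ * ((j + 1 : ℕ) : ℝ)) * 2 ^ (j + 1)) := by ring
    _ ≤ C * (4 * (J * u) + 4 * (1 / c₂ * J * u)) := mul_le_mul_of_nonneg_left e7 hC.le
    _ = _ := by ring

/-- The balance between the Gaussian tails and the entropy at every scale. -/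
lemma exists_exponent_bound {α c₂ C : ℝ} (hα₁ : 1 < α) (hα₂ : α < 3 / 2) (hc₂ : 0 < c₂) (hC : 0 < C) :
    ∃ κ : ℝ, 0 < κ ∧ ∀ (n j : ℕ), j ≤ n → ∀ J : ℝ, c₂ * (2 : ℝ) ^ (theta α * n) ≤ J →
      ∀ ν : ℕ → ℝ, (∀ i, 1 ≤ i → i ≤ n →
        ν i ≤ C * (J * (2 : ℝ) ^ (-(theta α * i)) + (2 : ℝ) ^ (delta α * i))) →
      ∀ D : ℝ, D ≤ 2 ^ n → (j < n → D ≤ ν (j + 1) * 2 ^ (j + 1)) →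
      ∃ m : ℝ, 0 < m ∧ D ≤ m ∧
        κ * ((2 : ℝ) ^ ((2 * theta α - 1 - 2 * delta α) * n) + ∑ i ∈ Finset.Ioc j n, ν i) ≤
          (chainWeight α j * J / 10) ^ 2 / (8 * m) := by
  have hδ := delta_pos hα₂
  have hθδ := one_add_delta_le_theta hα₂
  have hθ0 := theta_pos hα₂
  have hθ1 := theta_le_one hα₁ hα₂
  have hδ1 := delta_le α
  set δ := delta α with hδdef
  set θ := theta α with hθdef
  set w : ℝ := 1 - (2 : ℝ) ^ (-(δ / 2)) with hw
  have hw0 : 0 < w := sub_pos.2 (rpow_neg_delta_lt_one hα₂)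
  set s₁ : ℝ := 1 / (1 - (2 : ℝ) ^ (-θ)) with hs₁
  set s₂ : ℝ := (2 : ℝ) ^ δ / ((2 : ℝ) ^ δ - 1) with hs₂
  have hs₁0 : 0 < s₁ := by
    have : (2 : ℝ) ^ (-θ) < 1 := Real.rpow_lt_one_of_one_lt_of_neg (by norm_num) (by linarith)
    exact div_pos one_pos (by linarith)
  have hs₂0 : 0 < s₂ := by
    have : 1 < (2 : ℝ) ^ δ := Real.one_lt_rpow (by norm_num) hδ
    exact div_pos (by linarith) (by linarith)
  -- The Gaussian exponent `Q` has two lower bounds: `k₀ 2^((2θ-1-δ)n)`, from `m ≤ 2^n`, and `k₁ J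
  -- 2^(-θ j)`, from `card_scale_le`. The first pays for the target and the part `2^(δ n)` of the
  -- entropy, the second for the part proportional to `J`.
  set k₀ : ℝ := w ^ 2 * c₂ ^ 2 with hk₀
  set k₁ : ℝ := w ^ 2 / (4 * C * (1 + 1 / c₂)) with hk₁
  have hk₀0 : 0 < k₀ := by positivity
  have hk₁0 : 0 < k₁ := by positivity
  set S : ℝ := (1 + C * s₂) / k₀ + C * s₁ / k₁ with hS
  have hS0 : 0 < S := by positivity
  -- Here `800 = 8 * 10²`, from the factor 8 in the tail and the threshold `J / 10`.
  refine ⟨1 / (800 * S), by positivity, ?_⟩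
  intro n j hjn J hJ ν hν D hD1 hD2
  have hJ0 : 0 < J := lt_of_lt_of_le (by positivity) hJ
  have hjnR : (j : ℝ) ≤ n := by exact_mod_cast hjn
  have hj0 : (0 : ℝ) ≤ j := by positivity
  have hn0 : (0 : ℝ) ≤ n := by positivity
  have h12 : (1 : ℝ) ≤ 2 := by norm_num
  have h02 : (0 : ℝ) < 2 := by norm_num
  -- At `j = n` the increment goes from the approximation by the single top block to `∅`, and only
  -- the trivial bound `2^n` is available; no entropy has to be paid there.
  set m : ℝ := if j < n then min (2 ^ n) (C * (J * (2 : ℝ) ^ (-(θ * ((j + 1 : ℕ) : ℝ))) +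
    (2 : ℝ) ^ (δ * ((j + 1 : ℕ) : ℝ))) * 2 ^ (j + 1)) else 2 ^ n with hm
  have hm0 : 0 < m := by
    rw [hm]; split_ifs
    · exact lt_min (by positivity) (by positivity)
    · positivity
  have hmn : m ≤ 2 ^ n := by
    rw [hm]; split_ifs
    · exact min_le_left _ _
    · exact le_rfl
  have hDm : D ≤ m := by
    rw [hm]; split_ifs with hlt
    · refine le_min hD1 ((hD2 hlt).trans ?_)
      exact mul_le_mul_of_nonneg_right (hν (j + 1) (by omega) (by omega)) (by positivity)
    · exact hD1
  refine ⟨m, hm0, hDm, ?_⟩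
  set Q : ℝ := (chainWeight α j * J) ^ 2 / m with hQ
  have hQ' : Q = w ^ 2 * (2 : ℝ) ^ (-(δ * j)) * J ^ 2 / m := by
    rw [hQ, mul_pow, chainWeight_sq]
  set Y' : ℝ := (2 : ℝ) ^ ((2 * θ - 1 - δ) * n) with hY'
  have hQ0 : k₀ * Y' ≤ Q := by
    rw [hQ', le_div_iff₀ hm0]
    calc k₀ * Y' * m ≤ k₀ * Y' * 2 ^ n := by gcongr
      _ = w ^ 2 * (c₂ ^ 2 * (Y' * 2 ^ n)) := by rw [hk₀]; ring
      _ = w ^ 2 * (c₂ ^ 2 * ((2 : ℝ) ^ (-(δ * n)) * ((2 : ℝ) ^ (θ * n)) ^ 2)) := by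
          rw [hY', ← Real.rpow_natCast 2 n, ← Real.rpow_add h02,
            ← Real.rpow_natCast ((2 : ℝ) ^ (θ * n)) 2, ← Real.rpow_mul h02.le, ← Real.rpow_add h02]
          congr 3
          push_cast; ring
      _ = w ^ 2 * (2 : ℝ) ^ (-(δ * n)) * (c₂ * (2 : ℝ) ^ (θ * n)) ^ 2 := by ring
      _ ≤ w ^ 2 * (2 : ℝ) ^ (-(δ * j)) * J ^ 2 := by
          have : (2 : ℝ) ^ (-(δ * n)) ≤ (2 : ℝ) ^ (-(δ * j)) :=
            Real.rpow_le_rpow_of_exponent_le h12 (by nlinarith)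
          gcongr
  have hYY' : (2 : ℝ) ^ ((2 * θ - 1 - 2 * δ) * n) ≤ Y' :=
    Real.rpow_le_rpow_of_exponent_le h12 (by nlinarith)
  have hδY' : (2 : ℝ) ^ (δ * n) ≤ Y' :=
    Real.rpow_le_rpow_of_exponent_le h12 (mul_le_mul_of_nonneg_right (by linarith) hn0)
  have hY'0 : 0 < Y' := by positivity
  have hQpos : 0 < Q := lt_of_lt_of_le (by positivity) hQ0
  have hsum : (2 : ℝ) ^ ((2 * θ - 1 - 2 * δ) * n) + ∑ i ∈ Finset.Ioc j n, ν i ≤ Q * S := by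
    have hY'Q : Y' ≤ Q / k₀ := by rw [le_div_iff₀ hk₀0]; linarith
    by_cases hlt : j < n
    · have hmle : m ≤ 4 * C * (1 + 1 / c₂) * (J * (2 : ℝ) ^ ((θ - δ) * j)) := by
        have h1 : m ≤ C * (J * (2 : ℝ) ^ (-(θ * ((j + 1 : ℕ) : ℝ))) +
            (2 : ℝ) ^ (δ * ((j + 1 : ℕ) : ℝ))) * 2 ^ (j + 1) := by
          rw [hm, if_pos hlt]; exact min_le_right _ _
        exact h1.trans (card_scale_le hδ hθδ hδ1 hc₂ hC hjn hJ)
      have hQ1 : k₁ * (J * (2 : ℝ) ^ (-(θ * j))) ≤ Q := by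
        rw [hQ', le_div_iff₀ hm0]
        calc k₁ * (J * (2 : ℝ) ^ (-(θ * j))) * m ≤ k₁ * (J * (2 : ℝ) ^ (-(θ * j))) *
              (4 * C * (1 + 1 / c₂) * (J * (2 : ℝ) ^ ((θ - δ) * j))) := by gcongr
          _ = (k₁ * (4 * C * (1 + 1 / c₂))) * ((2 : ℝ) ^ (-(θ * j)) * (2 : ℝ) ^ ((θ - δ) * j)) *
              J ^ 2 := by ring
          _ = w ^ 2 * (2 : ℝ) ^ (-(δ * j)) * J ^ 2 := by
              rw [← Real.rpow_add h02, hk₁, div_mul_cancel₀ _ (by positivity)]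
              congr 3; ring
      have hJQ : J * (2 : ℝ) ^ (-(θ * j)) ≤ Q / k₁ := by rw [le_div_iff₀ hk₁0]; linarith
      have hN := sum_mixed_le hα₂ hC hJ0.le (j := j) hν
      calc (2 : ℝ) ^ ((2 * θ - 1 - 2 * δ) * n) + ∑ i ∈ Finset.Ioc j n, ν i
          ≤ Y' + C * (s₁ * (J * (2 : ℝ) ^ (-(θ * j))) + s₂ * (2 : ℝ) ^ (δ * n)) :=
            add_le_add hYY' hN
        _ ≤ Y' + C * (s₁ * (Q / k₁) + s₂ * Y') := by gcongr
        _ = (1 + C * s₂) * Y' + C * s₁ * (Q / k₁) := by ring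
        _ ≤ (1 + C * s₂) * (Q / k₀) + C * s₁ * (Q / k₁) := by gcongr
        _ = Q * S := by rw [hS]; ring
    · have hjn' : Finset.Ioc j n = ∅ := Finset.Ioc_eq_empty (by omega)
      rw [hjn', Finset.sum_empty, add_zero]
      calc (2 : ℝ) ^ ((2 * θ - 1 - 2 * δ) * n) ≤ Y' := hYY'
        _ ≤ Q / k₀ := hY'Q
        _ = Q * (1 / k₀) := by ring
        _ ≤ Q * S := by
            refine mul_le_mul_of_nonneg_left ?_ hQpos.le
            have h1 : 1 / k₀ ≤ (1 + C * s₂) / k₀ := by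
              gcongr
              linarith [mul_pos hC hs₂0]
            have h2 : 0 ≤ C * s₁ / k₁ := by positivity
            linarith
  calc 1 / (800 * S) * ((2 : ℝ) ^ ((2 * θ - 1 - 2 * δ) * n) + ∑ i ∈ Finset.Ioc j n, ν i)
      ≤ 1 / (800 * S) * (Q * S) := by gcongr
    _ = Q / 800 := by field_simp
    _ = (chainWeight α j * J / 10) ^ 2 / (8 * m) := by rw [hQ]; field_simp; ring

/-- The increment at a scale depends only on the approximation, but the threshold depends on the
energy of the set. In each class a set of least energy has the lowest threshold, so its event
contains those of all the others. -/
lemma exists_minimal_representatives {X Y : Type*} [Nonempty X] [DecidableEq X] [DecidableEq Y]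
    (𝒮 : Finset X) (T : X → Y) (J : X → ℝ) : ∃ 𝒮' ⊆ 𝒮, Set.InjOn T 𝒮' ∧
      ∀ A ∈ 𝒮, ∃ A' ∈ 𝒮', T A = T A' ∧ J A' ≤ J A := by
  have hrep : ∀ τ ∈ 𝒮.image T, ∃ A ∈ 𝒮, T A = τ ∧ ∀ B ∈ 𝒮, T B = τ → J A ≤ J B := by
    intro τ hτ
    obtain ⟨A₀, hA₀, hτ₀⟩ := Finset.mem_image.1 hτ
    obtain ⟨A, hA, hmin⟩ := Finset.exists_min_image (𝒮.filter fun A => T A = τ) J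
      ⟨A₀, Finset.mem_filter.2 ⟨hA₀, hτ₀⟩⟩
    rw [Finset.mem_filter] at hA
    exact ⟨A, hA.1, hA.2, fun B hB hBτ => hmin B (Finset.mem_filter.2 ⟨hB, hBτ⟩)⟩
  choose! r hr𝒮 hrT hrmin using hrep
  refine ⟨(𝒮.image T).image r, ?_, ?_, ?_⟩
  · intro A hA
    obtain ⟨τ, hτ, rfl⟩ := Finset.mem_image.1 hA
    exact hr𝒮 τ hτ
  · intro A hA A' hA' h
    obtain ⟨τ, hτ, rfl⟩ := Finset.mem_image.1 hA
    obtain ⟨τ', hτ', rfl⟩ := Finset.mem_image.1 hA'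
    rw [hrT τ hτ, hrT τ' hτ'] at h
    rw [h]
  · intro A hA
    have hτ := Finset.mem_image_of_mem T hA
    exact ⟨r (T A), Finset.mem_image_of_mem r hτ, (hrT _ hτ).symm, hrmin _ hτ A hA rfl⟩

/-- The approximations in the chaining argument, from `A` at scale `0` to `∅` above scale `n`. -/
def chainApprox (a : ℤ) (n j : ℕ) (A : Finset ℤ) : Finset ℤ :=
  if j ≤ n then lowerApprox a n j A else ∅

lemma chainApprox_succ_subset {a : ℤ} {n j : ℕ} {A : Finset ℤ} :
    chainApprox a n (j + 1) A ⊆ chainApprox a n j A := by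
  unfold chainApprox
  split_ifs with h1 h2
  · exact lowerApprox_succ_subset
  · omega
  · exact Finset.empty_subset _
  · exact Finset.empty_subset _

lemma card_chainApprox_sdiff_le {a : ℤ} {n j : ℕ} {A : Finset ℤ} :
    (chainApprox a n j A \ chainApprox a n (j + 1) A).card ≤ 2 ^ n := by
  have h1 : chainApprox a n j A ⊆ Finset.Ico a (a + 2 ^ n) := by
    unfold chainApprox
    split_ifs
    · exact lowerApprox_subset_Ico
    · exact Finset.empty_subset _
  refine (Finset.card_le_card (Finset.sdiff_subset.trans h1)).trans (le_of_eq ?_)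
  rw [Int.card_Ico]
  have : a + 2 ^ n - a = ((2 ^ n : ℕ) : ℤ) := by push_cast; ring
  rw [this, Int.toNat_natCast]

lemma chainApprox_eq_of_approxPair_eq {a : ℤ} {n j : ℕ} {A A' : Finset ℤ}
    (hA : A ⊆ Finset.Ico a (a + 2 ^ n)) (hA' : A' ⊆ Finset.Ico a (a + 2 ^ n))
    (h : approxPair a n j A = approxPair a n j A') :
    chainApprox a n j A = chainApprox a n j A' ∧
      chainApprox a n (j + 1) A = chainApprox a n (j + 1) A' := by
  have h1 : lowerApprox a n j A = lowerApprox a n j A' := congrArg Prod.fst h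
  have h2 : lowerApprox a n (j + 1) A = lowerApprox a n (j + 1) A' :=
    congrArg Prod.fst (approxPair_succ_eq hA hA' h)
  unfold chainApprox
  rw [h1, h2]
  exact ⟨rfl, rfl⟩

/-- If the error function is large, then so is one of its increments along the chain. -/
lemma exists_chain_increment_gt {α β ε : ℝ} (hα₂ : α < 3 / 2) {Λ : Finset ℤ} {a : ℤ} {n : ℕ}
    {A : Finset ℤ} (hA : A ⊆ Finset.Ico a (a + 2 ^ n)) {J : ℝ} (hJ : 0 ≤ J) {h : ℤ → ℝ}
    (hlt : J / 10 < errorFn α β ε Λ A h) :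
    ∃ j ∈ Finset.range (n + 1), chainWeight α j * J / 10 <
      errorFn α β ε Λ (chainApprox a n j A) h - errorFn α β ε Λ (chainApprox a n (j + 1) A) h := by
  by_contra hcon
  push Not at hcon
  have h1 := Finset.sum_le_sum hcon
  rw [Finset.sum_range_sub' fun j => errorFn α β ε Λ (chainApprox a n j A) h] at h1
  have h2 : chainApprox a n 0 A = A := by
    rw [chainApprox, if_pos (Nat.zero_le n), lowerApprox_zero hA]
  have h3 : chainApprox a n (n + 1) A = ∅ := by rw [chainApprox, if_neg (by omega)]
  rw [h2, h3, Finset.coe_empty, errorFn_empty, sub_zero] at h1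
  have h4 : ∑ j ∈ Finset.range (n + 1), chainWeight α j * J / 10 =
      (∑ j ∈ Finset.range (n + 1), chainWeight α j) * (J / 10) := by
    rw [Finset.sum_mul]
    exact Finset.sum_congr rfl fun j _ => by ring
  rw [h4] at h1
  have h5 := mul_le_mul_of_nonneg_right (sum_chainWeight_le hα₂ (n + 1))
    (by positivity : 0 ≤ J / 10)
  linarith

lemma exists_minusSites_eq {α M₀ c₂ : ℝ} {n : ℕ} {x a : ℤ}
    (hI : ellInterval n x = Set.Ico a (a + 2 ^ n)) {A : Set ℤ}
    (hA : A ∈ largeBalancedSets α M₀ c₂ n x) :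
    ∃ σ : Config, Balanced α M₀ σ (Set.Ico a (a + 2 ^ n)) ∧ A = minusSites a n σ := by
  obtain ⟨σ, hσ, rfl⟩ := hA.1
  rw [hI] at hσ ⊢
  refine ⟨σ, hσ, ?_⟩
  ext y
  rw [minusSites, Finset.coe_filter]
  simp only [Finset.mem_Ico]
  rfl

lemma succ_mul_exp_le {κ γ : ℝ} (hκ : 0 < κ) (hγ : 0 < γ) (n : ℕ) :
    ((n : ℝ) + 1) * Real.exp (-(κ * (2 : ℝ) ^ (γ * n))) ≤ 1 / (κ * min 1 (γ * Real.log 2)) := by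
  have hlog : 0 < Real.log 2 := Real.log_pos (by norm_num)
  set q := min 1 (γ * Real.log 2) with hq
  have hq0 : 0 < q := lt_min one_pos (by positivity)
  have h1 : q * (n + 1) ≤ (2 : ℝ) ^ (γ * n) := by
    rw [Real.rpow_def_of_pos (by norm_num)]
    have h2 := Real.add_one_le_exp (Real.log 2 * (γ * n))
    have h3 : q ≤ 1 := min_le_left _ _
    have h4 : q * n ≤ γ * Real.log 2 * n :=
      mul_le_mul_of_nonneg_right (min_le_right _ _) (by positivity)
    linarith
  set Y := (2 : ℝ) ^ (γ * n) with hY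
  have hY0 : 0 < Y := by positivity
  have h5 : κ * Y ≤ Real.exp (κ * Y) := by linarith [Real.add_one_le_exp (κ * Y)]
  rw [Real.exp_neg, ← div_eq_mul_inv, div_le_div_iff₀ (Real.exp_pos _) (by positivity)]
  calc ((n : ℝ) + 1) * (κ * q) = κ * (q * (n + 1)) := by ring
    _ ≤ κ * Y := by gcongr
    _ ≤ 1 * Real.exp (κ * Y) := by linarith

/-- The union bound over the chain, with the constant of `exists_exponent_bound`. -/
lemma measureReal_compl_goodFields_le {α M₀ c₂ κ : ℝ} (hα₁ : 1 < α) (hα₂ : α < 3 / 2) (hM : 2 < M₀)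
    (hc₂ : 0 < c₂)
    (hκ : ∀ (n j : ℕ), j ≤ n → ∀ J : ℝ, c₂ * (2 : ℝ) ^ (theta α * n) ≤ J →
      ∀ ν : ℕ → ℝ, (∀ i, 1 ≤ i → i ≤ n → ν i ≤ mixedConst α M₀ *
        (J * (2 : ℝ) ^ (-(theta α * i)) + (2 : ℝ) ^ (delta α * i))) →
      ∀ D : ℝ, D ≤ 2 ^ n → (j < n → D ≤ ν (j + 1) * 2 ^ (j + 1)) →
      ∃ m : ℝ, 0 < m ∧ D ≤ m ∧
        κ * ((2 : ℝ) ^ ((2 * theta α - 1 - 2 * delta α) * n) + ∑ i ∈ Finset.Ioc j n, ν i) ≤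
          (chainWeight α j * J / 10) ^ 2 / (8 * m))
    {Ω : Type*} [MeasurableSpace Ω] {P : Measure Ω} [IsProbabilityMeasure P]
    {h : ℤ → Ω → ℝ} (hlaw : ∀ x, HasLaw (h x) (gaussianReal 0 1) P) (hind : iIndepFun h P)
    {β ε : ℝ} (hβ : 0 < β) (hε : 0 < ε) (hε16 : Real.log 16 * ε ^ 2 ≤ κ) (Λ : Finset ℤ)
    (n : ℕ) (x : ℤ) :
    P.real {ω | (fun y => h y ω) ∈ goodFields α M₀ c₂ β ε Λ n x}ᶜ ≤
      ((n : ℝ) + 1) * (4 * Real.exp (-(κ *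
        (2 : ℝ) ^ ((2 * theta α - 1 - 2 * delta α) * (n : ℝ)) / ε ^ 2))) := by
  classical
  obtain ⟨a, hI⟩ := exists_ellInterval_eq n x
  set Y : ℝ := (2 : ℝ) ^ ((2 * theta α - 1 - 2 * delta α) * (n : ℝ)) with hY
  set J : Finset ℤ → ℝ := fun A => interaction α A (A : Set ℤ)ᶜ with hJ
  set 𝒜 : Finset (Finset ℤ) := (Finset.Ico a (a + 2 ^ n)).powerset.filter
    fun A => (A : Set ℤ) ∈ largeBalancedSets α M₀ c₂ n x with h𝒜
  have h𝒜sub : ∀ A ∈ 𝒜, A ⊆ Finset.Ico a (a + 2 ^ n) := fun A hA =>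
    Finset.mem_powerset.1 (Finset.mem_filter.1 hA).1
  have h𝒜J : ∀ A ∈ 𝒜, c₂ * (2 : ℝ) ^ (theta α * n) ≤ J A := fun A hA =>
    (Finset.mem_filter.1 hA).2.2
  choose 𝒮 h𝒮sub h𝒮inj h𝒮rep using fun j => exists_minimal_representatives 𝒜 (approxPair a n j) J
  set E : ℕ → Finset ℤ → Set Ω := fun j A => {ω | chainWeight α j * J A / 10 <
    errorFn α β ε Λ (chainApprox a n j A) (fun y => h y ω) -
      errorFn α β ε Λ (chainApprox a n (j + 1) A) (fun y => h y ω)} with hE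
  have hcover : {ω | (fun y => h y ω) ∈ goodFields α M₀ c₂ β ε Λ n x}ᶜ ⊆
      ⋃ j ∈ Finset.range (n + 1), ⋃ A ∈ 𝒮 j, E j A := by
    intro ω hω
    have hω' : ¬ ∀ A ∈ largeBalancedSets α M₀ c₂ n x,
      errorFn α β ε Λ A (fun y => h y ω) ≤ interaction α A Aᶜ / 10 := hω
    push Not at hω'
    obtain ⟨A, hA, hlt⟩ := hω'
    obtain ⟨σ, -, rfl⟩ := exists_minusSites_eq hI hA
    set A := minusSites a n σ with hAdef
    have hA𝒜 : A ∈ 𝒜 := Finset.mem_filter.2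
      ⟨Finset.mem_powerset.2 (minusSites_subset a n σ), hA⟩
    obtain ⟨j, hj, hinc⟩ := exists_chain_increment_gt hα₂ (minusSites_subset a n σ)
      (interaction_nonneg α _ _) hlt
    obtain ⟨A', hA', hT, hJA⟩ := h𝒮rep j A hA𝒜
    obtain ⟨e1, e2⟩ := chainApprox_eq_of_approxPair_eq (h𝒜sub A hA𝒜)
      (h𝒜sub A' (h𝒮sub j hA')) hT
    rw [Set.mem_iUnion₂]
    refine ⟨j, hj, ?_⟩
    rw [Set.mem_iUnion₂]
    refine ⟨A', hA', ?_⟩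
    change chainWeight α j * J A' / 10 < _
    rw [← e1, ← e2]
    refine lt_of_le_of_lt ?_ hinc
    have := (chainWeight_pos hα₂ j).le
    gcongr
  have hbound : ∀ j ∈ Finset.range (n + 1), ∀ A ∈ 𝒮 j,
      P.real (E j A) ≤ Real.exp (-(κ * Y / ε ^ 2)) * (1 / 16 : ℝ) ^ mixedSum a n j A := by
    intro j hj A hA
    rw [Finset.mem_range] at hj
    have hA𝒜 := h𝒮sub j hA
    have hAI := h𝒜sub A hA𝒜
    obtain ⟨σ, hσ, hAσ⟩ := exists_minusSites_eq hI (Finset.mem_filter.1 hA𝒜).2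
    rw [Finset.coe_inj] at hAσ
    have hJpos : 0 < J A := lt_of_lt_of_le (by positivity) (h𝒜J A hA𝒜)
    obtain ⟨m, hm0, hDm, hm⟩ := hκ n j (by omega) (J A) (h𝒜J A hA𝒜)
      (fun i => ((mixedBlocks a n i A).card : ℝ))
      (fun i hi1 hin => by
        rw [hJ, hAσ]
        exact card_mixedBlocks_le hα₁ hα₂ hM hσ hi1 hin)
      ((chainApprox a n j A \ chainApprox a n (j + 1) A).card : ℝ)
      (by exact_mod_cast card_chainApprox_sdiff_le)
      (fun hjn => by
        have := card_lowerApprox_sdiff_le (j := j) hAI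
        rw [chainApprox, chainApprox, if_pos (by omega), if_pos (by omega)]
        exact_mod_cast this)
    have hpos : 0 < chainWeight α j * J A / 10 := by
      have := chainWeight_pos hα₂ j
      positivity
    refine (measureReal_errorFn_sub_gt_le hlaw hind hβ hε Λ chainApprox_succ_subset hm0 hDm
      hpos).trans ?_
    have hN : ∑ i ∈ Finset.Ioc j n, ((mixedBlocks a n i A).card : ℝ) = (mixedSum a n j A : ℝ) := by
      rw [mixedSum]; push_cast; rfl
    rw [hN] at hm
    have h16 : (1 / 16 : ℝ) ^ mixedSum a n j A = Real.exp (-(Real.log 16 * mixedSum a n j A)) := by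
      rw [Real.exp_neg, mul_comm, Real.exp_nat_mul, Real.exp_log (by norm_num), one_div, inv_pow]
    rw [h16, ← Real.exp_add]
    apply Real.exp_le_exp.2
    have h1 : (chainWeight α j * J A / 10) ^ 2 / (8 * ε ^ 2 * m) =
        (chainWeight α j * J A / 10) ^ 2 / (8 * m) / ε ^ 2 := by
      rw [div_div]; congr 1; ring
    -- Smallness of `ε` is used here: the Gaussian gain per mixed block exceeds the entropy `log
    -- 16`.
    have h2 : Real.log 16 * mixedSum a n j A ≤ κ * mixedSum a n j A / ε ^ 2 := by
      rw [le_div_iff₀ (by positivity)]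
      calc Real.log 16 * mixedSum a n j A * ε ^ 2 = (Real.log 16 * ε ^ 2) * mixedSum a n j A := by ring
        _ ≤ κ * mixedSum a n j A := by gcongr
    have h3 : κ * (Y + mixedSum a n j A) / ε ^ 2 ≤
        (chainWeight α j * J A / 10) ^ 2 / (8 * m) / ε ^ 2 := by gcongr
    have h4 : κ * (Y + mixedSum a n j A) / ε ^ 2 =
        κ * Y / ε ^ 2 + κ * mixedSum a n j A / ε ^ 2 := by ring
    rw [h1]
    linarith
  calc P.real {ω | (fun y => h y ω) ∈ goodFields α M₀ c₂ β ε Λ n x}ᶜ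
      ≤ P.real (⋃ j ∈ Finset.range (n + 1), ⋃ A ∈ 𝒮 j, E j A) :=
        measureReal_mono hcover (measure_ne_top P _)
    _ ≤ ∑ j ∈ Finset.range (n + 1), P.real (⋃ A ∈ 𝒮 j, E j A) :=
        measureReal_biUnion_finset_le _ _
    _ ≤ ∑ j ∈ Finset.range (n + 1), 4 * Real.exp (-(κ * Y / ε ^ 2)) := by
        refine Finset.sum_le_sum fun j hj => ?_
        refine (measureReal_biUnion_finset_le _ _).trans
          ((Finset.sum_le_sum fun A hA => hbound j hj A hA).trans ?_)
        rw [← Finset.mul_sum, mul_comm]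
        refine mul_le_mul_of_nonneg_right ?_ (Real.exp_pos _).le
        rw [Finset.mem_range] at hj
        exact sum_pow_mixedSum_le (n - j) (by omega) (fun A hA => h𝒜sub A (h𝒮sub j hA))
          (h𝒮inj j)
    _ = _ := by
        rw [Finset.sum_const, Finset.card_range, nsmul_eq_mul]
        push_cast
        rfl

lemma mixedConst_pos {α M₀ : ℝ} (hM : 0 < M₀) : 0 < mixedConst α M₀ := by
  have := energyConst_pos α hM
  unfold mixedConst
  positivity

end LongRangeRFIM
end

/-! ### Choice of the constants -/

theorem mainTheorem7 (α : ℝ) (hα₁ : 1 < α) (hα₂ : α < 3 / 2) :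
    ∃ Mmin : ℝ, 2 < Mmin ∧ ∀ M₀ : ℝ, Mmin ≤ M₀ → ∀ c₂ : ℝ, 0 < c₂ →
      ∃ ε₀ : ℝ, 0 < ε₀ ∧ ∃ c₃ : ℝ, 0 < c₃ ∧
        ∀ (Ω : Type*) [MeasurableSpace Ω] (P : Measure Ω) [IsProbabilityMeasure P]
          (h : ℤ → Ω → ℝ), (∀ x, HasLaw (h x) (gaussianReal 0 1) P) → iIndepFun h P →
        ∀ (β ε : ℝ), 0 < β → 0 < ε → ε < ε₀ →
        ∀ Λ : Finset ℤ, (0 : ℤ) ∈ Λ →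
        ∀ (n : ℕ) (x : ℤ), (0 : ℤ) ∈ LongRangeRFIM.ellInterval n x →
          P.real {ω | (fun y => h y ω) ∈ LongRangeRFIM.goodFields α M₀ c₂ β ε Λ n x}ᶜ ≤
            c₃⁻¹ * Real.exp (-c₃ *
              ((2 : ℝ) ^ ((2 * LongRangeRFIM.theta α - 1 - 2 * LongRangeRFIM.delta α) * (n : ℝ))
                / ε ^ 2)) := by
  -- Any threshold above 2 would do, since only `2 < M₀` is needed.
  refine ⟨3, by norm_num, fun M₀ hM₀ c₂ hc₂ => ?_⟩
  have hM : 2 < M₀ := by linarith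
  obtain ⟨κ, hκ0, hκ⟩ := LongRangeRFIM.exists_exponent_bound hα₁ hα₂ hc₂
    (LongRangeRFIM.mixedConst_pos (α := α) (by linarith : 0 < M₀))
  have hlog : 0 < Real.log 16 := Real.log_pos (by norm_num)
  have hlog2 : 0 < Real.log 2 := Real.log_pos (by norm_num)
  set γ := 2 * LongRangeRFIM.theta α - 1 - 2 * LongRangeRFIM.delta α with hγ
  have hγ0 : 0 < γ := by
    linarith [LongRangeRFIM.one_add_delta_le_theta hα₂, LongRangeRFIM.delta_pos hα₂]
  set q := min 1 (γ * Real.log 2) with hq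
  have hq0 : 0 < q := lt_min one_pos (by positivity)
  -- The square root ensures `log 16 * ε² ≤ κ`. The bound by 1 lets half of the exponent, now free
  -- of `ε`, absorb the factor `n + 1`; the other half gives `κ / 2`, and `κ q / 8` accounts for the
  -- prefactor `4 / ((κ / 2) q)`.
  refine ⟨min 1 (Real.sqrt (κ / Real.log 16)), lt_min one_pos (by positivity),
    min (κ / 2) (κ * q / 8), lt_min (by positivity) (by positivity), ?_⟩
  intro Ω _ P _ h hlaw hind β ε hβ hε hε₀ Λ _ n x _
  set c₃ := min (κ / 2) (κ * q / 8) with hc₃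
  have hc₃0 : 0 < c₃ := lt_min (by positivity) (by positivity)
  have hε1 : ε < 1 := hε₀.trans_le (min_le_left _ _)
  have hε2 : Real.log 16 * ε ^ 2 ≤ κ := by
    have h1 : ε ≤ Real.sqrt (κ / Real.log 16) := (hε₀.trans_le (min_le_right _ _)).le
    have h2 := (Real.le_sqrt hε.le (by positivity)).1 h1
    rw [le_div_iff₀ hlog] at h2
    linarith
  refine (LongRangeRFIM.measureReal_compl_goodFields_le hα₁ hα₂ hM hc₂ hκ hlaw hind hβ hε hε2
    Λ n x).trans ?_
  rw [← hγ]
  have hpre := LongRangeRFIM.succ_mul_exp_le (by positivity : 0 < κ / 2) hγ0 n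
  rw [← hq] at hpre
  set Y := (2 : ℝ) ^ (γ * (n : ℝ)) with hY
  have hY0 : 0 < Y := by positivity
  have hYε : Y ≤ Y / ε ^ 2 := by
    rw [le_div_iff₀ (by positivity)]
    nlinarith [mul_le_mul_of_nonneg_left (pow_le_one₀ hε.le hε1.le : ε ^ 2 ≤ 1) hY0.le]
  have hYε0 : 0 < Y / ε ^ 2 := by positivity
  have hexp : Real.exp (-(κ * Y / ε ^ 2)) ≤
      Real.exp (-(κ / 2 * Y)) * Real.exp (-c₃ * (Y / ε ^ 2)) := by
    rw [← Real.exp_add]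
    apply Real.exp_le_exp.2
    have h1 : c₃ * (Y / ε ^ 2) ≤ κ / 2 * (Y / ε ^ 2) :=
      mul_le_mul_of_nonneg_right (min_le_left _ _) hYε0.le
    have h2 : κ / 2 * Y ≤ κ / 2 * (Y / ε ^ 2) := mul_le_mul_of_nonneg_left hYε (by positivity)
    have h3 : κ * Y / ε ^ 2 = κ / 2 * (Y / ε ^ 2) + κ / 2 * (Y / ε ^ 2) := by ring
    linarith
  have hinv : 4 * (1 / (κ / 2 * q)) ≤ c₃⁻¹ := by
    have h1 : 4 * (1 / (κ / 2 * q)) = (κ * q / 8)⁻¹ := by field_simp; norm_num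
    rw [h1]
    exact inv_anti₀ hc₃0 (min_le_right _ _)
  calc ((n : ℝ) + 1) * (4 * Real.exp (-(κ * Y / ε ^ 2)))
      ≤ ((n : ℝ) + 1) * (4 * (Real.exp (-(κ / 2 * Y)) * Real.exp (-c₃ * (Y / ε ^ 2)))) := by gcongr
    _ = 4 * (((n : ℝ) + 1) * Real.exp (-(κ / 2 * Y))) * Real.exp (-c₃ * (Y / ε ^ 2)) := by ring
    _ ≤ 4 * (1 / (κ / 2 * q)) * Real.exp (-c₃ * (Y / ε ^ 2)) := by gcongr
    _ ≤ c₃⁻¹ * Real.exp (-c₃ * (Y / ε ^ 2)) := by gcongr
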